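/- Let $(M^6,J,g)$ be a strict nearly K\"ahler $6$-manifold, i.e. a smooth $6$-manifold with a smooth Riemannian metric $g$ and a smooth $g$-orthogonal almost complex structure $J$ such that $(\nabla^{LC}_XJ)X=0$ for all $X\in TM$ and $\nabla^{LC}_XJ\neq 0$ for all $X\in TM\setminus\{0\}$, where $\nabla^{LC}$ is the Levi-Civita connection of $g$. Put $\omega(X,Y)=g(JX,Y)$, and let $L^3$ be a Lagrangian submanifold of $M$, i.e. a smooth (embedded or, more generally, immersed) $3$-dimensional submanifold with $\omega|_L=0$. Then: (1) $L$ is orientable; (2) $L$ is minimal, i.e. its mean curvature vector $H_L$ (the trace, for the induced metric, of the second fundamental form of $L$ in $(M,g)$) vanishes identically; (3) consequently the Maslov $1$-form $\mu(L)$ vanishes identically. Here $\mu(L)$ is defined as follows. The canonical Hermitian connection $\nabla^{can}$ is the unique connection on $TM$ preserving $g$ and $J$ whose torsion satisfies $T(JX,Y)=T(X,JY)$. Let $(\alpha^i_j)$ be its connection form on the bundle $U(M)$ of unitary frames, and let $\gamma=-\sqrt{-1}\sum_i\alpha^i_i$. Let $g_L$ be the Gauss map $p\mapsto T_pL$ from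 $L$ to the bundle $Lag(M)$ of Lagrangian subspaces of the tangent spaces of $M$. Then $\mu(L)$ is the unique $1$-form on $L$ that equals $s^*(2\gamma)$ for every smooth local lift $s$ of $g_L$ to $U(M)$, i.e. for every local unitary frame field $s=(e_1,Je_1,e_2,Je_2,e_3,Je_3)$ along $L$ with $e_1,e_2,e_3$ tangent to $L$; thus $\mu(L)=2\sum_i g(\nabla^{can}e_i,Je_i)$. -/

import Mathlib

open Bundle Set FiberBundle VectorField
open scoped Manifold ContDiff Topology

noncomputable section

set_option linter.unusedSectionVars false

section Riesz

variable {V : Type*} [NormedAddCommGroup V] [InnerProductSpace ℝ V] [FiniteDimensional ℝ V]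

/-- The endomorphism `A` of a finite-dimensional inner product space with `⟪A v, w⟫ = B v w`. -/
def rieszMap (B : V →L[ℝ] V →L[ℝ] ℝ) : V →L[ℝ] V :=
  haveI : CompleteSpace V := FiniteDimensional.complete ℝ V
  LinearMap.toContinuousLinearMap
    { toFun := fun v => (InnerProductSpace.toDual ℝ V).symm (B v)
      map_add' := fun v w => by simp
      map_smul' := fun c v => by simp }

theorem inner_rieszMap (B : V →L[ℝ] V →L[ℝ] ℝ) (v w : V) : inner ℝ (rieszMap B v) w = B v w := by
  have : CompleteSpace V := FiniteDimensional.complete ℝ V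
  simp [rieszMap]

end Riesz

section LeviCivita

variable {E : Type*} [NormedAddCommGroup E] [NormedSpace ℝ E] [FiniteDimensional ℝ E]
  [CompleteSpace E]
  {H : Type*} [TopologicalSpace H] {I : ModelWithCorners ℝ E H}
  {M : Type*} [TopologicalSpace M] [ChartedSpace H M] [IsManifold I ∞ M]
  [RiemannianBundle (fun x : M => TangentSpace I x)]
  [IsContMDiffRiemannianBundle I ∞ E (fun x : M => TangentSpace I x)]

/-- The right-hand side of the Koszul formula for `2 g(∇_X Y, Z)`. -/
def koszulForm (Y X Z : Π x : M, TangentSpace I x) (x : M) : ℝ :=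
  d% (fun p => inner ℝ (Y p) (Z p)) x (X x) + d% (fun p => inner ℝ (X p) (Z p)) x (Y x)
    - d% (fun p => inner ℝ (X p) (Y p)) x (Z x)
    + inner ℝ (mlieBracket I X Y x) (Z x) - inner ℝ (mlieBracket I X Z x) (Y x)
    - inner ℝ (mlieBracket I Y Z x) (X x)

theorem mdiffAt_inner {X Y : Π x : M, TangentSpace I x} {x : M}
    (hX : MDiffAt (T% X) x) (hY : MDiffAt (T% Y) x) :
    MDiffAt (fun p => (inner ℝ (X p) (Y p) : ℝ)) x :=
  MDifferentiableAt.inner_bundle (IB := I) (F := E) (E := fun x : M => TangentSpace I x)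
    (b := fun p => p) hX hY

theorem mvfderiv_inner_smul_left {f : M → ℝ} {X Y : Π x : M, TangentSpace I x} {x : M}
    (hf : MDiffAt f x) (hX : MDiffAt (T% X) x) (hY : MDiffAt (T% Y) x) (v : TangentSpace I x) :
    d% (fun p => inner ℝ ((f • X) p) (Y p)) x v
      = f x * d% (fun p => inner ℝ (X p) (Y p)) x v + d% f x v * inner ℝ (X x) (Y x) := by
  have h : (fun p => inner ℝ ((f • X) p) (Y p)) = fun p => f p * inner ℝ (X p) (Y p) := by
    ext p; simp [inner_smul_left]
  rw [h, mvfderiv_fun_mul hf (mdiffAt_inner hX hY)]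
  simp; ring

theorem mvfderiv_inner_add_left {X X' Y : Π x : M, TangentSpace I x} {x : M}
    (hX : MDiffAt (T% X) x) (hX' : MDiffAt (T% X') x) (hY : MDiffAt (T% Y) x)
    (v : TangentSpace I x) :
    d% (fun p => inner ℝ ((X + X') p) (Y p)) x v
      = d% (fun p => inner ℝ (X p) (Y p)) x v + d% (fun p => inner ℝ (X' p) (Y p)) x v := by
  have h : (fun p => inner ℝ ((X + X') p) (Y p))
      = fun p => inner ℝ (X p) (Y p) + inner ℝ (X' p) (Y p) := by
    ext p; simp [inner_add_left]
  rw [h, mvfderiv_fun_add (mdiffAt_inner hX hY) (mdiffAt_inner hX' hY)]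
  simp

theorem inner_comm_fun (X Y : Π x : M, TangentSpace I x) :
    (fun p => (inner ℝ (X p) (Y p) : ℝ)) = fun p => inner ℝ (Y p) (X p) := by
  ext p; exact real_inner_comm _ _

theorem koszulForm_tensorial_left {Y Z : Π x : M, TangentSpace I x} {x : M}
    (hY : MDiffAt (T% Y) x) (hZ : MDiffAt (T% Z) x) :
    TensorialAt I E (fun X : Π x : M, TangentSpace I x => koszulForm Y X Z x) x where
  smul {f X} hf hX := by
    simp only [koszulForm]
    rw [mvfderiv_inner_smul_left hf hX hZ, mvfderiv_inner_smul_left hf hX hY,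
      mlieBracket_smul_left hf hX, mlieBracket_smul_left hf hX]
    simp [inner_add_left, inner_smul_left, inner_smul_right]
    ring
  add {X X'} hX hX' := by
    simp only [koszulForm]
    rw [mvfderiv_inner_add_left hX hX' hZ, mvfderiv_inner_add_left hX hX' hY,
      mlieBracket_add_left hX hX', mlieBracket_add_left hX hX']
    simp [inner_add_left, inner_add_right]
    ring


theorem koszulForm_tensorial_right {Y X : Π x : M, TangentSpace I x} {x : M}
    (hY : MDiffAt (T% Y) x) (hX : MDiffAt (T% X) x) :
    TensorialAt I E (fun Z : Π x : M, TangentSpace I x => koszulForm Y X Z x) x where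
  smul {f Z} hf hZ := by
    simp only [koszulForm]
    rw [inner_comm_fun Y, inner_comm_fun X, mvfderiv_inner_smul_left hf hZ hX,
      mvfderiv_inner_smul_left hf hZ hY, mlieBracket_smul_right hf hZ, mlieBracket_smul_right hf hZ,
      inner_comm_fun Z, inner_comm_fun Z]
    simp [inner_add_left, inner_smul_left, inner_smul_right]
    rw [real_inner_comm (X x) (Z x), real_inner_comm (Y x) (Z x)]
    ring
  add {Z Z'} hZ hZ' := by
    simp only [koszulForm]
    rw [inner_comm_fun Y (Z + Z'), inner_comm_fun X (Z + Z'),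
      mvfderiv_inner_add_left hZ hZ' hX,
      mvfderiv_inner_add_left hZ hZ' hY, mlieBracket_add_right hZ hZ', mlieBracket_add_right hZ hZ',
      inner_comm_fun Z, inner_comm_fun Z, inner_comm_fun Z', inner_comm_fun Z']
    simp [inner_add_left, inner_add_right]
    ring

instance tangentSpace_finiteDimensional (x : M) : FiniteDimensional ℝ (TangentSpace I x) :=
  inferInstanceAs (FiniteDimensional ℝ E)

/-- The bilinear form `(X, Z) ↦ 2 g(∇_X Y, Z)` at `x`, for a vector field `Y` differentiable
at `x`. -/
def koszulTensor (Y : Π x : M, TangentSpace I x) (x : M) (hY : MDiffAt (T% Y) x) :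
    TangentSpace I x →L[ℝ] TangentSpace I x →L[ℝ] ℝ :=
  TensorialAt.mkHom₂ (fun X Z => koszulForm Y X Z x) x
    (fun _ hZ => koszulForm_tensorial_left hY hZ)
    (fun _ hX => koszulForm_tensorial_right hY hX)

open Classical in
/-- `leviCivitaFun Y x X` is `∇^{LC}_X Y` at `x`, with value `0` if `Y` is not differentiable
at `x`. -/
def leviCivitaFun (Y : Π x : M, TangentSpace I x) (x : M) :
    TangentSpace I x →L[ℝ] TangentSpace I x :=
  if hY : MDiffAt (T% Y) x then (1 / 2 : ℝ) • rieszMap (koszulTensor Y x hY) else 0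

theorem inner_leviCivitaFun {Y X Z : Π x : M, TangentSpace I x} {x : M}
    (hY : MDiffAt (T% Y) x) (hX : MDiffAt (T% X) x) (hZ : MDiffAt (T% Z) x) :
    inner ℝ (leviCivitaFun Y x (X x)) (Z x) = (1 / 2 : ℝ) * koszulForm Y X Z x := by
  have h := TensorialAt.mkHom₂_apply (Φ := fun X Z => koszulForm Y X Z x)
    (fun _ hZ => koszulForm_tensorial_left hY hZ)
    (fun _ hX => koszulForm_tensorial_right hY hX) hX hZ
  rw [leviCivitaFun, dif_pos hY]
  simp only [smul_apply, inner_smul_left, inner_rieszMap]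
  simp [koszulTensor, h]

theorem leviCivitaFun_ext {x : M} {A B : TangentSpace I x →L[ℝ] TangentSpace I x}
    (h : ∀ X Z : Π x : M, TangentSpace I x, MDiffAt (T% X) x → MDiffAt (T% Z) x →
      (inner ℝ (A (X x)) (Z x) : ℝ) = inner ℝ (B (X x)) (Z x)) : A = B := by
  ext1 v
  refine ext_inner_right ℝ fun w => ?_
  simpa using h (extend E v) (extend E w) (mdifferentiableAt_extend I E v)
    (mdifferentiableAt_extend I E w)

variable (I M) in
/-- The Levi-Civita connection, given by the Koszul formula. It is torsion-free and metric, see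
`leviCivita_torsion` and `leviCivita_isMetric`. -/
def leviCivita : CovariantDerivative I E (fun x : M => TangentSpace I x) where
  toFun := leviCivitaFun
  isCovariantDerivativeOnUniv :=
    { add := by
        intro Y Y' x hY hY' _
        refine leviCivitaFun_ext fun X Z hX hZ => ?_
        have hs : MDiffAt (T% (Y + Y')) x := mdifferentiableAt_add_section hY hY'
        rw [add_apply, inner_add_left, inner_leviCivitaFun hs hX hZ,
          inner_leviCivitaFun hY hX hZ, inner_leviCivitaFun hY' hX hZ]
        simp only [koszulForm]
        rw [mvfderiv_inner_add_left hY hY' hZ, inner_comm_fun X (Y + Y'),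
          mvfderiv_inner_add_left hY hY' hX, mlieBracket_add_right hY hY',
          mlieBracket_add_left hY hY', inner_comm_fun Y X, inner_comm_fun Y' X]
        simp [inner_add_left, inner_add_right]
        ring
      leibniz := by
        intro Y f x hY hf _
        refine leviCivitaFun_ext fun X Z hX hZ => ?_
        have hs : MDiffAt (T% (f • Y)) x := hf.smul_section hY
        rw [add_apply, inner_add_left, inner_leviCivitaFun hs hX hZ,
          smul_apply, inner_smul_left,
          inner_leviCivitaFun hY hX hZ]
        simp only [koszulForm]
        rw [mvfderiv_inner_smul_left hf hY hZ, inner_comm_fun X (f • Y),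
          mvfderiv_inner_smul_left hf hY hX, mlieBracket_smul_right hf hY,
          mlieBracket_smul_left hf hY, inner_comm_fun Y X]
        simp [inner_add_left, inner_smul_left, inner_smul_right]
        rw [real_inner_comm (X x) (Y x)]
        ring }

theorem leviCivita_torsion : (leviCivita I M).torsion = 0 := by
  rw [CovariantDerivative.torsion_eq_zero_iff]
  intro X Y x hX hY
  refine ext_inner_right ℝ fun w => ?_
  have hZ := mdifferentiableAt_extend I E (V := fun x : M => TangentSpace I x) w
  have h1 := inner_leviCivitaFun hY hX hZ
  have h2 := inner_leviCivitaFun hX hY hZ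
  simp only [extend_apply_self] at h1 h2
  change inner ℝ (leviCivitaFun Y x (X x) - leviCivitaFun X x (Y x)) w = _
  rw [inner_sub_left, h1, h2]
  simp only [koszulForm]
  rw [mlieBracket_swap_apply (V := Y) (W := X), inner_comm_fun Y X]
  simp
  ring

/-- Compatibility of an affine connection with the Riemannian metric:
`X g(Y, Z) = g(∇_X Y, Z) + g(Y, ∇_X Z)`. -/
def IsMetricConnection (D : CovariantDerivative I E (fun x : M => TangentSpace I x)) : Prop :=
  ∀ (x : M) (Y Z : Π x : M, TangentSpace I x), MDiffAt (T% Y) x → MDiffAt (T% Z) x →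
    ∀ v : TangentSpace I x, d% (fun p => (inner ℝ (Y p) (Z p) : ℝ)) x v
      = inner ℝ (D Y x v) (Z x) + inner ℝ (Y x) (D Z x v)

theorem leviCivita_isMetric : IsMetricConnection (leviCivita I M) := by
  intro x Y Z hY hZ v
  have hX := mdifferentiableAt_extend I E (V := fun x : M => TangentSpace I x) v
  have h1 := inner_leviCivitaFun hY hX hZ
  have h2 := inner_leviCivitaFun hZ hX hY
  simp only [extend_apply_self] at h1 h2
  change _ = inner ℝ (leviCivitaFun Y x v) (Z x) + inner ℝ (Y x) (leviCivitaFun Z x v)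
  rw [real_inner_comm (leviCivitaFun Z x v) (Y x), h1, h2]
  simp only [koszulForm]
  rw [inner_comm_fun Z Y, inner_comm_fun _ Z, inner_comm_fun _ Y,
    mlieBracket_swap_apply (V := Y) (W := Z)]
  simp
  ring

end LeviCivita

section AlmostHermitian

variable {E : Type*} [NormedAddCommGroup E] [NormedSpace ℝ E] [FiniteDimensional ℝ E]
  [CompleteSpace E]
  {H : Type*} [TopologicalSpace H] {I : ModelWithCorners ℝ E H}
  {M : Type*} [TopologicalSpace M] [ChartedSpace H M] [IsManifold I ∞ M]
  [RiemannianBundle (fun x : M => TangentSpace I x)]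
  [IsContMDiffRiemannianBundle I ∞ E (fun x : M => TangentSpace I x)]

variable (I M) in
/-- A smooth orthogonal almost complex structure. -/
structure AlmostHermitianStructure where
  J : Π x : M, TangentSpace I x →L[ℝ] TangentSpace I x
  smooth : ContMDiff I (I.prod 𝓘(ℝ, E →L[ℝ] E)) ∞
    (fun x => TotalSpace.mk' (E →L[ℝ] E)
      (E := fun x : M => TangentSpace I x →L[ℝ] TangentSpace I x) x (J x))
  sq : ∀ (x : M) (v : TangentSpace I x), J x (J x v) = -v
  isometry : ∀ (x : M) (v w : TangentSpace I x), (inner ℝ (J x v) (J x w) : ℝ) = inner ℝ v w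

namespace AlmostHermitianStructure

variable (S : AlmostHermitianStructure I M)

/-- The fundamental `2`-form `ω(v, w) = g(J v, w)`. -/
def omega (x : M) (v w : TangentSpace I x) : ℝ := inner ℝ (S.J x v) w

theorem inner_J_left (x : M) (v w : TangentSpace I x) :
    (inner ℝ (S.J x v) w : ℝ) = -inner ℝ v (S.J x w) := by
  rw [← S.isometry x v (S.J x w), S.sq]; simp

theorem mdiffAt_J {Y : Π x : M, TangentSpace I x} {x : M} (hY : MDiffAt (T% Y) x) :
    MDiffAt (T% (fun p => S.J p (Y p))) x := by
  exact MDifferentiableAt.clm_bundle_apply (F₁ := E) (F₂ := E)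
    (E₁ := fun x : M => TangentSpace I x) (E₂ := fun x : M => TangentSpace I x) (b := fun p => p)
    ((S.smooth x).mdifferentiableAt (by simp)) hY

theorem nablaJ_tensorial (x : M) :
    TensorialAt I E (fun Y : Π x : M, TangentSpace I x =>
      leviCivita I M (fun p => S.J p (Y p)) x - (S.J x).comp (leviCivita I M Y x)) x where
  smul {f Y} hf hY := by
    have h1 : (fun p => S.J p ((f • Y) p)) = f • (fun p => S.J p (Y p)) := by
      ext p; simp
    rw [h1, (leviCivita I M).isCovariantDerivativeOn.leibniz (S.mdiffAt_J hY) hf,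
      (leviCivita I M).isCovariantDerivativeOn.leibniz hY hf]
    ext v
    simp
    module
  add {Y Y'} hY hY' := by
    have h1 : (fun p => S.J p ((Y + Y') p)) = (fun p => S.J p (Y p)) + fun p => S.J p (Y' p) := by
      ext p; simp
    rw [h1, (leviCivita I M).isCovariantDerivativeOn.add (S.mdiffAt_J hY) (S.mdiffAt_J hY'),
      (leviCivita I M).isCovariantDerivativeOn.add hY hY']
    ext v
    simp
    module

/-- `S.nablaJ x v w` is `(∇^{LC}_v J) w`. -/
def nablaJ (x : M) : TangentSpace I x →L[ℝ] TangentSpace I x →L[ℝ] TangentSpace I x :=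
  (TensorialAt.mkHom _ x (S.nablaJ_tensorial x)).flip

theorem nablaJ_apply {x : M} {Y : Π x : M, TangentSpace I x} (hY : MDiffAt (T% Y) x)
    (v : TangentSpace I x) :
    S.nablaJ x v (Y x)
      = leviCivita I M (fun p => S.J p (Y p)) x v - S.J x (leviCivita I M Y x v) := by
  have h := TensorialAt.mkHom_apply (S.nablaJ_tensorial x) hY
  simpa [nablaJ] using congr($h v)

/-- `(∇^{LC}_v J) v = 0` for all tangent vectors `v`. -/
def IsNearlyKahler : Prop := ∀ (x : M) (v : TangentSpace I x), S.nablaJ x v v = 0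

/-- Nearly Kähler, and `∇^{LC}_v J ≠ 0` for all tangent vectors `v ≠ 0`. -/
def IsStrictNearlyKahler : Prop :=
  S.IsNearlyKahler ∧ ∀ (x : M) (v : TangentSpace I x), v ≠ 0 → S.nablaJ x v ≠ 0

variable {S} in
theorem inner_nablaJ_skew {x : M} (u v w : TangentSpace I x) :
    (inner ℝ (S.nablaJ x u v) w : ℝ) = -inner ℝ (S.nablaJ x u w) v := by
  have hV := mdifferentiableAt_extend I E (V := fun x : M => TangentSpace I x) v
  have hW := mdifferentiableAt_extend I E (V := fun x : M => TangentSpace I x) w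
  have h1 := S.nablaJ_apply hV u
  have h2 := S.nablaJ_apply hW u
  have h3 := leviCivita_isMetric x _ _ (S.mdiffAt_J hV) hW u
  have h4 := leviCivita_isMetric x _ _ hV (S.mdiffAt_J hW) u
  have h5 : (fun p => (inner ℝ (S.J p (extend E v p)) (extend E w p) : ℝ))
      = fun p => (-1 : ℝ) * inner ℝ (extend E v p) (S.J p (extend E w p)) := by
    ext p; rw [S.inner_J_left]; ring
  rw [h5, mvfderiv_fun_mul mdifferentiableAt_const (mdiffAt_inner hV (S.mdiffAt_J hW))] at h3
  simp only [extend_apply_self] at h1 h2 h3 h4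
  simp [mvfderiv_const] at h3
  rw [h1, h2, inner_sub_left, inner_sub_left, S.inner_J_left, S.inner_J_left,
    real_inner_comm v, real_inner_comm (S.J x v)]
  linarith

variable {S} in
theorem nablaJ_J {x : M} (u v : TangentSpace I x) :
    S.nablaJ x u (S.J x v) = -S.J x (S.nablaJ x u v) := by
  have hV := mdifferentiableAt_extend I E (V := fun x : M => TangentSpace I x) v
  have h1 := S.nablaJ_apply hV u
  have h2 := S.nablaJ_apply (S.mdiffAt_J hV) u
  have h3 : (fun p => S.J p (S.J p (extend E v p))) = (-1 : ℝ) • extend E v := by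
    ext p; rw [S.sq]; simp
  have h4 := (leviCivita I M).isCovariantDerivativeOn.smul_const (-1 : ℝ) hV
  rw [h3, h4] at h2
  simp only [extend_apply_self] at h1 h2
  rw [h1, h2]
  simp [S.sq, sub_eq_add_neg]

/-- The trilinear form `(Y, X, Z) ↦ g(∇^{can}_X Y - ∇^{LC}_X Y, Z)`. -/
def canonicalForm (x : M) (Y X Z : TangentSpace I x) : ℝ :=
  (1 / 2 : ℝ) * inner ℝ (S.nablaJ x X Y) (S.J x Z)
    - (1 / 4 : ℝ) * (inner ℝ (S.nablaJ x Y (S.J x Z)) X - inner ℝ (S.nablaJ x Z (S.J x Y)) X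
      - inner ℝ (S.nablaJ x (S.J x Y) Z) X + inner ℝ (S.nablaJ x (S.J x Z) Y) X)

/-- The vector `∇^{can}_X Y - ∇^{LC}_X Y`. -/
def canonicalVector (x : M) (Y X : TangentSpace I x) : TangentSpace I x :=
  haveI : CompleteSpace (TangentSpace I x) := FiniteDimensional.complete ℝ (TangentSpace I x)
  (InnerProductSpace.toDual ℝ (TangentSpace I x)).symm (LinearMap.toContinuousLinearMap
    { toFun := fun Z => S.canonicalForm x Y X Z
      map_add' := fun Z Z' => by
        simp [canonicalForm, inner_add_left, inner_add_right]; ring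
      map_smul' := fun c Z => by
        simp [canonicalForm, inner_smul_left, inner_smul_right]; ring })

theorem inner_canonicalVector (x : M) (Y X Z : TangentSpace I x) :
    inner ℝ (S.canonicalVector x Y X) Z = S.canonicalForm x Y X Z := by
  have : CompleteSpace (TangentSpace I x) := FiniteDimensional.complete ℝ (TangentSpace I x)
  simp [canonicalVector]

/-- The tensor `(Y, X) ↦ ∇^{can}_X Y - ∇^{LC}_X Y`. -/
def canonicalTensor (x : M) : TangentSpace I x →L[ℝ] TangentSpace I x →L[ℝ] TangentSpace I x :=
  LinearMap.toContinuousBilinearMap (LinearMap.mk₂ ℝ (S.canonicalVector x)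
    (fun Y Y' X => ext_inner_right ℝ fun Z => by
      simp [inner_add_left, inner_canonicalVector, canonicalForm]; ring)
    (fun c Y X => ext_inner_right ℝ fun Z => by
      simp [inner_smul_left, inner_canonicalVector, canonicalForm]; ring)
    (fun Y X X' => ext_inner_right ℝ fun Z => by
      simp [inner_add_left, inner_canonicalVector, canonicalForm, inner_add_right]; ring)
    (fun c Y X => ext_inner_right ℝ fun Z => by
      simp [inner_smul_left, inner_canonicalVector, canonicalForm, inner_smul_right]; ring))

theorem inner_canonicalTensor (x : M) (Y X Z : TangentSpace I x) :
    inner ℝ (S.canonicalTensor x Y X) Z = S.canonicalForm x Y X Z := by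
  rw [← inner_canonicalVector]; rfl

/-- The canonical Hermitian connection of an almost Hermitian manifold: the unitary connection whose
torsion satisfies `T(J v, w) = T(v, J w)`, see `canonicalConnection_isUnitary` and
`canonicalConnection_torsion`. -/
def canonicalConnection : CovariantDerivative I E (fun x : M => TangentSpace I x) :=
  (leviCivita I M).addOneForm S.canonicalTensor

theorem canonicalConnection_apply (Y : Π x : M, TangentSpace I x) (x : M) (v : TangentSpace I x) :
    S.canonicalConnection Y x v = leviCivita I M Y x v + S.canonicalTensor x (Y x) v := rfl

/-- `D` is unitary: it preserves both `g` and `J`. -/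
def IsUnitaryConnection (D : CovariantDerivative I E (fun x : M => TangentSpace I x)) : Prop :=
  IsMetricConnection D ∧ ∀ (x : M) (Y : Π x : M, TangentSpace I x), MDiffAt (T% Y) x →
    ∀ v : TangentSpace I x, D (fun p => S.J p (Y p)) x v = S.J x (D Y x v)

theorem canonicalConnection_isUnitary : S.IsUnitaryConnection S.canonicalConnection := by
  constructor
  · intro x Y Z hY hZ v
    rw [leviCivita_isMetric x Y Z hY hZ v, canonicalConnection_apply, canonicalConnection_apply,
      inner_add_left, inner_add_right, real_inner_comm (S.canonicalTensor x (Z x) v) (Y x),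
      inner_canonicalTensor, inner_canonicalTensor]
    have h1 : (inner ℝ (S.nablaJ x v (Z x)) (S.J x (Y x)) : ℝ)
        = -inner ℝ (S.nablaJ x v (Y x)) (S.J x (Z x)) := by
      rw [inner_nablaJ_skew, nablaJ_J, inner_neg_left, S.inner_J_left]; ring
    simp only [canonicalForm, h1]
    ring
  · intro x Y hY v
    refine ext_inner_right ℝ fun w => ?_
    have h0 := S.nablaJ_apply hY v
    have h1 : leviCivita I M (fun p => S.J p (Y p)) x v
        = S.nablaJ x v (Y x) + S.J x (leviCivita I M Y x v) := by rw [h0]; simp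
    rw [canonicalConnection_apply, canonicalConnection_apply, h1, map_add, inner_add_left,
      inner_add_left, inner_add_left, inner_canonicalTensor, S.inner_J_left x (S.canonicalTensor _ _ _),
      inner_canonicalTensor]
    simp only [canonicalForm, nablaJ_J, S.sq, inner_neg_left, inner_neg_right, S.isometry, map_neg,
      neg_apply]
    ring

theorem canonicalConnection_torsion (x : M) (v w : TangentSpace I x) :
    S.canonicalConnection.torsion x (S.J x v) w = S.canonicalConnection.torsion x v (S.J x w) := by
  have key : ∀ v w : TangentSpace I x, S.canonicalConnection.torsion x v w
      = S.canonicalTensor x w v - S.canonicalTensor x v w := by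
    intro v w
    have h : (leviCivita I M).torsion x v w = 0 := by rw [leviCivita_torsion]; rfl
    rw [CovariantDerivative.torsion_apply_eq_extend] at h ⊢
    simp only [canonicalConnection_apply, extend_apply_self] at h ⊢
    rw [sub_eq_zero] at h
    rw [← h]
    abel
  refine ext_inner_right ℝ fun z => ?_
  rw [key, key, inner_sub_left, inner_sub_left]
  simp only [inner_canonicalTensor, canonicalForm]
  have hs := fun u v w : TangentSpace I x => inner_nablaJ_skew (S := S) u v w
  have hJ : ∀ u v w : TangentSpace I x, (inner ℝ (S.nablaJ x u (S.J x v)) w : ℝ)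
      = inner ℝ (S.nablaJ x u v) (S.J x w) := by
    intro u v w; rw [nablaJ_J, inner_neg_left, S.inner_J_left]; ring
  simp only [hJ, S.sq, inner_neg_right, map_neg, neg_apply, inner_neg_left]
  have hA : ∀ u v w : TangentSpace I x, (inner ℝ (S.nablaJ x u v) (S.J x w) : ℝ)
      = -inner ℝ (S.nablaJ x u w) (S.J x v) := by
    intro u v w; rw [← hJ u w v, ← hs]
  linarith [hA (S.J x v) z w, hA (S.J x w) z v, hA (S.J x z) w v, hs w z v, hs v z w, hs z w v]

end AlmostHermitianStructure
end AlmostHermitian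

section Submanifold

variable {E : Type*} [NormedAddCommGroup E] [NormedSpace ℝ E] [FiniteDimensional ℝ E]
  [CompleteSpace E]
  {H : Type*} [TopologicalSpace H] {I : ModelWithCorners ℝ E H}
  {M : Type*} [TopologicalSpace M] [ChartedSpace H M] [IsManifold I ∞ M]
  {n : ℕ} {L : Type*} [TopologicalSpace L] [ChartedSpace (EuclideanSpace ℝ (Fin n)) L]
  [IsManifold (𝓡 n) ∞ L]

/-- The pull-back connection `f^* D` on `f^* TM`: `pullbackConnection D f σ x v` is the covariant
derivative at `x`, in the direction `v`, of the vector field `σ` along `f`. It is computed by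
expanding `σ` in a local frame `(s_i)` of `TM` around `f x`, as
`∑ i, (d c_i (v) • s_i + c_i • D_{df v} s_i)` for `σ = ∑ i, c_i • (s_i ∘ f)`. -/
def pullbackConnection (D : CovariantDerivative I E (fun x : M => TangentSpace I x))
    (f : L → M) (σ : Π p : L, TangentSpace I (f p)) (x : L) (v : TangentSpace (𝓡 n) x) :
    TangentSpace I (f x) :=
  let t := trivializationAt E (fun x : M => TangentSpace I x) (f x)
  let b := Module.finBasis ℝ E
  ∑ i, ((mvfderiv (𝓡 n) (fun p => t.localFrameCoeff I b i (f p) (σ p)) x v) • t.localFrame b i (f x)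
    + t.localFrameCoeff I b i (f x) (σ x) • D (t.localFrame b i) (f x) (mfderiv (𝓡 n) I f x v))

/-- The pull-back connection is compatible with restriction of vector fields of `M`. -/
theorem pullbackConnection_comp (D : CovariantDerivative I E (fun x : M => TangentSpace I x))
    (f : L → M) (Y : Π x : M, TangentSpace I x) (x : L) (v : TangentSpace (𝓡 n) x)
    (hf : MDifferentiableAt (𝓡 n) I f x) (hY : MDiffAt (T% Y) (f x)) :
    pullbackConnection D f (fun p => Y (f p)) x v = D Y (f x) (mfderiv (𝓡 n) I f x v) := by
  classical
  let t := trivializationAt E (fun x : M => TangentSpace I x) (f x)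
  let b := Module.finBasis ℝ E
  have hx : f x ∈ t.baseSet := mem_baseSet_trivializationAt E _ (f x)
  have hs : ∀ i, MDiffAt (T% (t.localFrame b i)) (f x) := fun i =>
    (contMDiffAt_localFrame_of_mem 1 _ b i hx).mdifferentiableAt (by simp)
  have hc : ∀ i, MDiffAt (fun p => t.localFrameCoeff I b i p (Y p)) (f x) := fun i =>
    mdifferentiableAt_localFrameCoeff b hx hY i
  have hcs : ∀ i ∈ (Finset.univ : Finset (Fin (Module.finrank ℝ E))),
      MDiffAt (T% ((fun p => t.localFrameCoeff I b i p (Y p)) • t.localFrame b i)) (f x) :=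
    fun i _ => (hc i).smul_section (hs i)
  have hsum : ∀ T : Finset (Fin (Module.finrank ℝ E)),
      MDiffAt (T% (∑ i ∈ T, (fun p => t.localFrameCoeff I b i p (Y p)) • t.localFrame b i)) (f x) ∧
      D (∑ i ∈ T, (fun p => t.localFrameCoeff I b i p (Y p)) • t.localFrame b i) (f x)
        = ∑ i ∈ T, D ((fun p => t.localFrameCoeff I b i p (Y p)) • t.localFrame b i) (f x) := by
    intro T
    induction T using Finset.induction_on with
    | empty =>
      simp only [Finset.sum_empty]
      exact ⟨mdifferentiableAt_zeroSection .., D.isCovariantDerivativeOn.zero⟩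
    | insert a T ha ih =>
      simp only [Finset.sum_insert ha]
      have h1 := hcs a (Finset.mem_univ a)
      refine ⟨mdifferentiableAt_add_section h1 ih.1, ?_⟩
      rw [D.isCovariantDerivativeOn.add h1 ih.1, ih.2]
  have hY' : D Y (f x) = ∑ i, D ((fun p => t.localFrameCoeff I b i p (Y p)) • t.localFrame b i)
      (f x) := by
    rw [← (hsum Finset.univ).2]
    refine D.isCovariantDerivativeOn.congr_of_eventuallyEq hY (hsum Finset.univ).1
      Filter.univ_mem ?_
    filter_upwards [t.eventually_eq_localFrame_sum_coeff_smul (I := I) (s := Y) b hx] with p hp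
    simpa using hp
  rw [hY']
  simp only [pullbackConnection, sum_apply]
  refine Finset.sum_congr rfl fun i _ => ?_
  rw [D.isCovariantDerivativeOn.leibniz (hs i) (hc i)]
  have hch := mvfderiv_comp_apply x (hc i) hf v
  simp only [Function.comp_def] at hch
  erw [hch]
  simp [add_comm, t, b]

variable [RiemannianBundle (fun x : M => TangentSpace I x)]
  [IsContMDiffRiemannianBundle I ∞ E (fun x : M => TangentSpace I x)]

variable (n I)

/-- The component of `w ∈ T_{f x} M` orthogonal to the tangent space `df (T_x L)`. -/
def normalPart (f : L → M) (x : L) (w : TangentSpace I (f x)) : TangentSpace I (f x) :=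
  w - (LinearMap.range (mfderiv (𝓡 n) I f x).toLinearMap).starProjection w

/-- The second fundamental form `(v, w) ↦ (∇^{LC}_v df(W))^⊥` of an immersion `f`, where `W` is a
vector field of `L` with `W x = w`. -/
def secondFundamentalForm (f : L → M) (x : L) (v w : TangentSpace (𝓡 n) x) :
    TangentSpace I (f x) :=
  normalPart I n f x (pullbackConnection (leviCivita I M) f
    (fun p => mfderiv (𝓡 n) I f p (extend (EuclideanSpace ℝ (Fin n)) w p)) x v)

/-- A basis of `T_x L` that is orthonormal for the metric induced by the immersion `f`. -/
def inducedOrthonormalBasis (f : L → M) (x : L)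
    (i : Fin (Module.finrank ℝ (LinearMap.range (mfderiv (𝓡 n) I f x).toLinearMap))) :
    TangentSpace (𝓡 n) x :=
  Classical.choose (stdOrthonormalBasis ℝ (LinearMap.range (mfderiv (𝓡 n) I f x).toLinearMap) i).2

/-- The mean curvature vector: the trace of the second fundamental form for the induced metric. -/
def meanCurvature (f : L → M) (x : L) : TangentSpace I (f x) :=
  ∑ i, secondFundamentalForm I n f x (inducedOrthonormalBasis I n f x i)
    (inducedOrthonormalBasis I n f x i)

/-- The mean curvature vanishes identically. -/
def IsMinimalImmersion (f : L → M) : Prop := ∀ x, meanCurvature I n f x = 0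

variable {n I}

variable (n L) in
/-- `L` admits a smooth atlas all of whose transition maps have positive Jacobian determinant. -/
def IsOrientableManifold : Prop :=
  ∃ A ⊆ IsManifold.maximalAtlas (𝓡 n) ∞ L, (∀ x : L, ∃ e ∈ A, x ∈ e.source) ∧
    ∀ e ∈ A, ∀ e' ∈ A, ∀ y ∈ (e.symm ≫ₕ e').source, 0 < (fderiv ℝ (e.symm ≫ₕ e') y).det

namespace AlmostHermitianStructure

variable (S : AlmostHermitianStructure I M)

variable (n) in
/-- `f` is a smooth immersion of half the dimension along which `ω` vanishes. -/
structure IsLagrangianImmersion (f : L → M) : Prop where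
  contMDiff : ContMDiff (𝓡 n) I ∞ f
  injective_mfderiv : ∀ x, Function.Injective (mfderiv (𝓡 n) I f x)
  finrank_eq : Module.finrank ℝ E = 2 * n
  omega_eq_zero : ∀ (x : L) (v w : TangentSpace (𝓡 n) x),
    S.omega (f x) (mfderiv (𝓡 n) I f x v) (mfderiv (𝓡 n) I f x w) = 0

/-- `(v_1, J v_1, …, v_n, J v_n)` is a unitary frame. -/
def IsUnitaryFrame {x : M} (v : Fin n → TangentSpace I x) : Prop :=
  Orthonormal ℝ v ∧ ∀ i j, (inner ℝ (v i) (S.J x (v j)) : ℝ) = 0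

/-- `e` is, near `x`, a smooth lift to the bundle of unitary frames of the Gauss map
`p ↦ df (T_p L)` of the immersion `f`. -/
structure IsGaussLift (f : L → M) (x : L) (e : Fin n → Π p : L, TangentSpace I (f p)) : Prop where
  smooth : ∀ i, ContMDiffAt (𝓡 n) I.tangent ∞ (fun p => (⟨f p, e i p⟩ : TangentBundle I M)) x
  unitary : ∀ᶠ p in 𝓝 x, S.IsUnitaryFrame (fun i => e i p)
  span_eq : ∀ᶠ p in 𝓝 x, Submodule.span ℝ (Set.range fun i => e i p)
    = LinearMap.range (mfderiv (𝓡 n) I f p).toLinearMap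

/-- The entries `α^i_j` of the connection `1`-form of the canonical Hermitian connection, pulled
back by the unitary frame field `e` along `f`: `∇^{can}_v e_j = ∑ i, α^i_j(v) e_i`, where
`√-1` acts on tangent vectors as `J`. -/
def connectionEntry (f : L → M) (e : Fin n → Π p : L, TangentSpace I (f p)) (x : L)
    (v : TangentSpace (𝓡 n) x) (i j : Fin n) : ℂ :=
  ⟨inner ℝ (pullbackConnection S.canonicalConnection f (e j) x v) (e i x),
    inner ℝ (pullbackConnection S.canonicalConnection f (e j) x v) (S.J (f x) (e i x))⟩

/-- The pull-back by `e` of `γ = -√-1 ∑ i, α^i_i`. -/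
def gammaForm (f : L → M) (e : Fin n → Π p : L, TangentSpace I (f p)) (x : L)
    (v : TangentSpace (𝓡 n) x) : ℂ :=
  -Complex.I * ∑ i, S.connectionEntry f e x v i i

/-- `μ` is the Maslov `1`-form `g_L^*(2 γ̄)` of the Lagrangian immersion `f`. As `γ̄` is the form on
the Lagrangian Grassmannian bundle whose pull-back to the unitary frame bundle is `γ`, this means
that `μ` is the pull-back of `2γ` by every local lift of the Gauss map `g_L` to unitary frames. -/
def IsMaslovForm (f : L → M) (μ : Π x : L, TangentSpace (𝓡 n) x →L[ℝ] ℝ) : Prop :=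
  ∀ (x : L) (e : Fin n → Π p : L, TangentSpace I (f p)), S.IsGaussLift f x e →
    ∀ v : TangentSpace (𝓡 n) x, (μ x v : ℂ) = 2 * S.gammaForm f e x v

end AlmostHermitianStructure
end Submanifold

end

/-!
Let `G(u, v, w) = g((∇_u J) v, w)`. On a nearly Kähler manifold `G` is totally skew; it is a third of
`dω`, so it vanishes on a Lagrangian submanifold `L` (`inner_nablaJ_mfderiv`). If `s` is an
orthonormal frame of `T_x L`, then `s` and `J s` together span the tangent space of `M`, and the
vanishing of `G` forces `(∇_{s i} J) (s j) = c • J (s k)` for cyclic `(i, j, k)`, with a single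
constant `c` (`covDerivEnd_specialFrame`). Strictness says that `c ≠ 0` (`specialFrame_ne_zero`).

*Orientability.* The `3`-form `g((∇_u J) v, J w)` takes the value `c` on the frame `s`. It is
therefore a volume form on `L`, and the charts in which it is positive form an oriented atlas
(`isOrientableManifold`).

*The trace lemma.* The main point is that `∑ i, g(∇_v (s i), J (s i)) = 0` for every local
orthonormal frame `s` of `L` (`sum_inner_pullbackConnection_J`). Differentiate
`G(s 0, s 1, s 2) = 0` along `L` in the direction `v`. The terms in which a frame vector is
differentiated add up to `c` times the trace. The remaining term `g((∇²_{v, s 0} J) (s 1), s 2)`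
vanishes by Gray's formula `g((∇²_{w, x} J) w, z) = g((∇_w J) x, J (∇_w J) z)`
(`inner_covDerivEnd₂`): both factors on the right are known on the frame, the first being normal
and the second tangent to `L`. Gray's formula is a consequence of the Ricci identity for `J` and of
the fact that a curvature tensor is determined by its sectional curvatures; this part is pure
multilinear algebra (`secondDerivative_eq_of_ricci_identity`).

*Minimality.* As `G` vanishes on `L`, the cubic form `C(u, v, w) = g(∇_u v, J w)` on `L` is totally
symmetric, so that `g(H, J w) = ∑ i, C(s i, s i, w) = ∑ i, C(w, s i, s i)`, which is zero by the trace
lemma (`isMinimalImmersion`).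

*The Maslov form.* As `(∇_v J) v = 0`, the canonical connection and the Levi-Civita connection have
the same connection form on the canonical bundle (`canonicalForm_J`), so the trace lemma says that `γ`
vanishes along every local lift of the Gauss map (`gammaForm_eq_zero`). Such lifts exist by the
Gram–Schmidt process (`exists_isGaussLift`), so the Maslov form is well defined and zero
(`isMaslovForm_iff`).

All differentiation takes place in charts. `IsLocalNearlyKahler` is the local model, a nearly Kähler
structure near a point of a vector space with its connection given by Christoffel symbols. The
lemmas `leviCivita_eq_chartField`, `nablaJ_chartField` and `pullbackConnection_leviCivita` express the
Levi-Civita connection, `∇J` and the pull-back connection in charts.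
-/

set_option linter.unusedSectionVars false

/-! ### Gray's curvature identity as multilinear algebra -/

section GrayIdentity

variable {V : Type*} [AddCommGroup V]

/-- A quadrilinear form with the symmetries of a Riemannian curvature tensor. Additivity in the
first slot yields additivity in the other slots. -/
structure IsCurvatureLike (R : V → V → V → V → ℝ) : Prop where
  add : ∀ a a' b c d, R (a + a') b c d = R a b c d + R a' b c d
  skew_left : ∀ a b c d, R a b c d = -R b a c d
  skew_right : ∀ a b c d, R a b c d = -R a b d c
  bianchi : ∀ a b c d, R a b c d + R b c a d + R c a b d = 0

namespace IsCurvatureLike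

variable {R R' : V → V → V → V → ℝ}

/-- The pair symmetry follows from the other symmetries by adding four Bianchi identities. -/
theorem pair_symm (h : IsCurvatureLike R) (a b c d : V) : R a b c d = R c d a b := by
  linarith [h.bianchi a b c d, h.bianchi b c d a, h.bianchi c d a b, h.bianchi d a b c,
    h.skew_left a b c d, h.skew_right a b c d, h.skew_left c d a b, h.skew_right c d a b,
    h.skew_left b c a d, h.skew_right b c a d, h.skew_left a d b c, h.skew_right a d b c,
    h.skew_left c a b d, h.skew_right c a b d, h.skew_left d b c a, h.skew_right d b c a,
    h.skew_left d b a c, h.skew_right a c d b, h.skew_left a c d b, h.skew_left c a d b,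
    h.skew_left b d c a, h.skew_right c d b a, h.skew_right b c d a, h.skew_right d a c b,
    h.skew_right d a b c]

theorem add_right (h : IsCurvatureLike R) (a b c d d' : V) :
    R a b c (d + d') = R a b c d + R a b c d' := by
  rw [h.pair_symm, h.skew_left, h.add, h.pair_symm a b c d, h.pair_symm a b c d',
    h.skew_left c d, h.skew_left c d']
  ring

theorem add_second (h : IsCurvatureLike R) (a b b' c d : V) :
    R a (b + b') c d = R a b c d + R a b' c d := by
  rw [h.skew_left, h.add, h.skew_left a b, h.skew_left a b']
  ring

theorem sub (h : IsCurvatureLike R) (h' : IsCurvatureLike R') :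
    IsCurvatureLike fun a b c d => R a b c d - R' a b c d where
  add a a' b c d := by rw [h.add, h'.add]; ring
  skew_left a b c d := by rw [h.skew_left, h'.skew_left]; ring
  skew_right a b c d := by rw [h.skew_right, h'.skew_right]; ring
  bianchi a b c d := by linarith [h.bianchi a b c d, h'.bianchi a b c d]

theorem comp (h : IsCurvatureLike R) (J : V →+ V) :
    IsCurvatureLike fun a b c d => R (J a) (J b) (J c) (J d) where
  add a a' b c d := by rw [map_add, h.add]
  skew_left _ _ _ _ := h.skew_left ..
  skew_right _ _ _ _ := h.skew_right ..
  bianchi _ _ _ _ := h.bianchi ..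

theorem eq_zero_of_sectional (h : IsCurvatureLike R) (h0 : ∀ a b, R a b a b = 0) (a b c d : V) :
    R a b c d = 0 := by
  have h1 : ∀ a b d, R a b a d = 0 := fun a b d => by
    have e := h0 a (b + d)
    rw [h.add_second, h.add_right, h.add_right] at e
    linarith [h0 a b, h0 a d, h.pair_symm a b a d]
  have h2 : ∀ a b c d, R a b c d = -R c b a d := fun a b c d => by
    have e := h1 (a + c) b d
    rw [h.add, h.pair_symm, h.add, h.pair_symm c b, h.add, h.pair_symm a d a b, h.pair_symm c d a b,
      h.pair_symm a d c b, h.pair_symm c d c b] at e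
    linarith [h1 a b d, h1 c b d]
  linarith [h.bianchi a b c d, h2 a b c d, h2 b c a d, h2 c a b d, h.skew_left a b c d,
    h.skew_left b c a d, h.skew_left c a b d]

/-- A curvature-like form is determined by its sectional curvatures. -/
theorem eq_of_sectional (h : IsCurvatureLike R) (h' : IsCurvatureLike R')
    (h0 : ∀ a b, R a b a b = R' a b a b) (a b c d : V) : R a b c d = R' a b c d :=
  sub_eq_zero.1 ((h.sub h').eq_zero_of_sectional (fun a b => sub_eq_zero.2 (h0 a b)) a b c d)

end IsCurvatureLike

variable [Module ℝ V]

/-- The algebraic content of Gray's formula for the second covariant derivative of a nearly Kähler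
structure. Here `N w x = (∇_w J) x` and `A w x y z = g((∇²_{w,x} J) y, z)`; `hAJ` is the second
covariant derivative of `J² = -1`, and `hAR` is the Ricci identity. -/
theorem secondDerivative_eq_of_ricci_identity {g : V →ₗ[ℝ] V →ₗ[ℝ] ℝ} {J : V →ₗ[ℝ] V}
    {N : V →ₗ[ℝ] V →ₗ[ℝ] V} {A R : V → V → V → V → ℝ} (hR : IsCurvatureLike R)
    (hg : ∀ v w, g v w = g w v) (hJ : ∀ v, J (J v) = -v)
    (hNN : ∀ v, N v v = 0) (hNJ : ∀ v w, N v (J w) = -J (N v w))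
    (hA : ∀ w x z, A w x x z = 0) (hA' : ∀ w x y z, A w x y z = -A w x z y)
    (hAJ : ∀ w x y z, A w x (J y) z = A w x y (J z) + g (N w y) (N x z) + g (N x y) (N w z))
    (hAR : ∀ w x y z, A w x y z - A x w y z = R w x (J y) z + R w x y (J z)) (w x z : V) :
    A w x w z = g (N w x) (J (N w z)) := by
  have hneg : ∀ a b c d, R a b c (-d) = -R a b c d := fun a b c d => by
    have h1 := hR.add_right a b c d (-d)
    have h2 := hR.add_right a b c 0 0
    simp only [add_neg_cancel, add_zero] at h1 h2
    linarith
  have hneg' : ∀ a b c d, R a b (-c) d = -R a b c d := fun a b c d => by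
    rw [hR.skew_right, hneg, hR.skew_right a b c d]
  have hN : ∀ v w, N v w = -N w v := fun v w => by
    have h := hNN (v + w)
    simp only [map_add, LinearMap.add_apply, hNN, zero_add, add_zero] at h
    exact eq_neg_of_add_eq_zero_left (by rw [add_comm]; exact h)
  -- For `y = w` and `z = J x` the Ricci identity and the derivative of `J² = -1` compare `R` with
  -- its twist by `J` on sectional curvatures.
  have hsec : ∀ w x, R w x (J w) (J x) = R w x w x + g (N w x) (N w x) := fun w x => by
    have h1 := hAR w x w (J x)
    have h2 := hAJ w x w x
    rw [hA] at h1
    rw [hA' w x (J w) x, hA, hNN, hN x w] at h2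
    rw [hJ, hneg] at h1
    simp only [map_zero, LinearMap.zero_apply, map_neg, LinearMap.neg_apply] at h2
    linarith
  have hJJ : ∀ w x, g (N (J w) (J x)) (N (J w) (J x)) = g (N w x) (N w x) := fun w x => by
    have : N (J w) (J x) = -N w x := by
      rw [hNJ, hN, hNJ, neg_neg, hJ, hN w x, neg_neg]
    rw [this]; simp
  -- Hence `R` and `R(J ·, J ·, J ·, J ·)` have the same sectional curvatures, and are equal.
  have hRJ : ∀ a b c d, R (J a) (J b) (J c) (J d) = R a b c d :=
    (hR.comp J.toAddMonoidHom).eq_of_sectional hR fun a b => by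
      have h1 := hsec a b
      have h2 := hsec (J a) (J b)
      rw [hJ, hJ, hneg, hneg', hJJ, hR.pair_symm] at h2
      change R (J a) (J b) (J a) (J b) = _
      linarith
  have hsymm : ∀ w x z, R w x (J w) (J z) = R w z (J w) (J x) := fun w x z => by
    rw [← hRJ w x, hJ, hJ, hneg, hneg', neg_neg, hR.pair_symm]
  -- The invariance of `R` under `J` makes `R w x (J w) (J z)` symmetric in `x` and `z`, so
  -- `hsec` polarizes.
  have hpol : ∀ w x z, R w x (J w) (J z) = R w x w z + g (N w x) (N w z) := fun w x z => by
    have h1 := hsec w (x + z)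
    simp only [map_add, hR.add_second, hR.add_right, LinearMap.add_apply] at h1
    linarith [hsec w x, hsec w z, hsymm w x z, hR.pair_symm w x w z, hg (N w x) (N w z)]
  have h1 := hAR w x w z
  have h2 := hpol w x (J z)
  rw [hA] at h1
  rw [hJ, hneg, hNJ, map_neg] at h2
  linarith

end GrayIdentity

/-! ### Nearly Kähler structures on an open subset of a vector space -/

noncomputable section LocalModel

set_option synthInstance.maxHeartbeats 200000

variable {E : Type*} [NormedAddCommGroup E] [NormedSpace ℝ E]
  {E' : Type*} [NormedAddCommGroup E'] [NormedSpace ℝ E']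
  {F : Type*} [NormedAddCommGroup F] [NormedSpace ℝ F]

theorem fderiv_clm_apply₂ {B : E' → E →L[ℝ] E →L[ℝ] F} {a b : E' → E} {y : E'}
    (hB : DifferentiableAt ℝ B y) (ha : DifferentiableAt ℝ a y) (hb : DifferentiableAt ℝ b y)
    (w : E') :
    fderiv ℝ (fun z => B z (a z) (b z)) y w
      = fderiv ℝ B y w (a y) (b y) + B y (fderiv ℝ a y w) (b y) + B y (a y) (fderiv ℝ b y w) := by
  rw [fderiv_clm_apply (hB.clm_apply ha) hb, fderiv_clm_apply hB ha]
  simp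
  abel

theorem fderiv_apply_const {B : E' → E →L[ℝ] F} {y : E'} (hB : DifferentiableAt ℝ B y) (v : E)
    (w : E') : fderiv ℝ (fun z => B z v) y w = fderiv ℝ B y w v := by
  rw [fderiv_clm_apply hB (differentiableAt_const v)]; simp

theorem fderiv_apply_const₂ {B : E' → E →L[ℝ] E →L[ℝ] F} {y : E'} (hB : DifferentiableAt ℝ B y)
    (u v : E) (w : E') : fderiv ℝ (fun z => B z u v) y w = fderiv ℝ B y w u v := by
  rw [fderiv_clm_apply₂ hB (differentiableAt_const u) (differentiableAt_const v)]; simp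

theorem fderiv_apply_eq_zero_of_eventually {φ : E' → F} {c : F} {y : E'}
    (h : ∀ᶠ z in 𝓝 y, φ z = c) (w : E') : fderiv ℝ φ y w = 0 := by
  rw [Filter.EventuallyEq.fderiv_eq (f := fun _ => c) h]; simp

/-- The covariant derivative `(∇_u J) = ∂_u J + [Γ_u, J]` of the endomorphism field `J` with respect
to the connection with Christoffel symbols `Γ`. -/
def covDerivEnd (Γ : E → E →L[ℝ] E →L[ℝ] E) (J : E → E →L[ℝ] E) (y : E) :
    E →L[ℝ] E →L[ℝ] E :=
  fderiv ℝ J y + ((ContinuousLinearMap.mul ℝ (E →L[ℝ] E)).flip (J y)).comp (Γ y)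
    - (ContinuousLinearMap.mul ℝ (E →L[ℝ] E) (J y)).comp (Γ y)

/-- The second covariant derivative `∇²_{w,u} J` of the endomorphism field `J` with respect to the
connection with Christoffel symbols `Γ`. -/
def covDerivEnd₂ (Γ : E → E →L[ℝ] E →L[ℝ] E) (J : E → E →L[ℝ] E) (y w u : E) : E →L[ℝ] E :=
  fderiv ℝ (covDerivEnd Γ J) y w u + Γ y w * covDerivEnd Γ J y u - covDerivEnd Γ J y u * Γ y w
    - covDerivEnd Γ J y (Γ y w u)

/-- The curvature `R(w, u) = ∂_w Γ_u - ∂_u Γ_w + [Γ_w, Γ_u]` of the connection with Christoffel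
symbols `Γ`. -/
def christoffelCurvature (Γ : E → E →L[ℝ] E →L[ℝ] E) (y w u : E) : E →L[ℝ] E :=
  fderiv ℝ Γ y w u - fderiv ℝ Γ y u w + Γ y w * Γ y u - Γ y u * Γ y w

/-- Near `y`, the metric `g` has the torsion-free metric connection with Christoffel symbols `Γ`,
and `J` is a `g`-orthogonal almost complex structure with `(∇_u J) u = 0`. -/
structure IsLocalNearlyKahler (g : E → E →L[ℝ] E →L[ℝ] ℝ) (J : E → E →L[ℝ] E)
    (Γ : E → E →L[ℝ] E →L[ℝ] E) (y : E) : Prop where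
  contDiffAt_metric : ContDiffAt ℝ 2 g y
  contDiffAt_J : ContDiffAt ℝ 2 J y
  contDiffAt_christoffel : ContDiffAt ℝ 1 Γ y
  symm : ∀ᶠ z in 𝓝 y, ∀ v w, g z v w = g z w v
  sq : ∀ᶠ z in 𝓝 y, J z * J z = -1
  isometry : ∀ᶠ z in 𝓝 y, ∀ v w, g z (J z v) (J z w) = g z v w
  torsion_free : ∀ᶠ z in 𝓝 y, ∀ v w, Γ z v w = Γ z w v
  metric : ∀ᶠ z in 𝓝 y, ∀ u v w,
    fderiv ℝ g z u v w = g z (Γ z u v) w + g z v (Γ z u w)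
  nearlyKahler : ∀ᶠ z in 𝓝 y, ∀ u, covDerivEnd Γ J z u u = 0

theorem covDerivEnd_apply (Γ : E → E →L[ℝ] E →L[ℝ] E) (J : E → E →L[ℝ] E) (y u : E) :
    covDerivEnd Γ J y u = fderiv ℝ J y u + Γ y u * J y - J y * Γ y u := by
  simp [covDerivEnd]

theorem christoffelCurvature_apply (Γ : E → E →L[ℝ] E →L[ℝ] E) (y w u v : E) :
    christoffelCurvature Γ y w u v
      = fderiv ℝ Γ y w u v - fderiv ℝ Γ y u w v + Γ y w (Γ y u v) - Γ y u (Γ y w v) := rfl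

theorem contDiffAt_covDerivEnd {Γ : E → E →L[ℝ] E →L[ℝ] E} {J : E → E →L[ℝ] E} {y : E}
    (hJ : ContDiffAt ℝ 2 J y) (hΓ : ContDiffAt ℝ 1 Γ y) :
    ContDiffAt ℝ 1 (covDerivEnd Γ J) y := by
  have h1 : ContDiffAt ℝ 1 J y := hJ.of_le (by norm_num)
  refine ((hJ.fderiv_right (by norm_num)).add (ContDiffAt.clm_comp ?_ hΓ)).sub
    (ContDiffAt.clm_comp ?_ hΓ)
  · exact (ContinuousLinearMap.contDiff _).contDiffAt.comp y h1
  · exact (ContinuousLinearMap.contDiff _).contDiffAt.comp y h1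

/-- The Ricci identity for an endomorphism field and a torsion-free connection. -/
theorem covDerivEnd₂_sub_swap {Γ : E → E →L[ℝ] E →L[ℝ] E} {J : E → E →L[ℝ] E} {y : E}
    (hJ : ContDiffAt ℝ 2 J y) (hΓ : ContDiffAt ℝ 1 Γ y) (hs : ∀ v w, Γ y v w = Γ y w v) (w u : E) :
    covDerivEnd₂ Γ J y w u - covDerivEnd₂ Γ J y u w
      = christoffelCurvature Γ y w u * J y - J y * christoffelCurvature Γ y w u := by
  have hJ1 : DifferentiableAt ℝ J y := hJ.differentiableAt (by norm_num)
  have hΓ1 : DifferentiableAt ℝ Γ y := hΓ.differentiableAt (by norm_num)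
  have hJ2 : DifferentiableAt ℝ (fderiv ℝ J) y :=
    (hJ.fderiv_right (m := 1) (by norm_num)).differentiableAt (by norm_num)
  have hsymm := (hJ.isSymmSndFDerivAt (by simp)).eq w u
  have key : ∀ w u, fderiv ℝ (covDerivEnd Γ J) y w u = fderiv ℝ (fderiv ℝ J) y w u
      + (fderiv ℝ Γ y w u * J y + Γ y u * fderiv ℝ J y w)
      - (fderiv ℝ J y w * Γ y u + J y * fderiv ℝ Γ y w u) := by
    intro w u
    have hN := (contDiffAt_covDerivEnd hJ hΓ).differentiableAt (by norm_num)
    rw [← fderiv_apply_const hN]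
    simp only [covDerivEnd_apply]
    have e1 : DifferentiableAt ℝ (fun z => Γ z u) y := hΓ1.clm_apply (differentiableAt_const u)
    have e2 : DifferentiableAt ℝ (fun z => fderiv ℝ J z u) y :=
      hJ2.clm_apply (differentiableAt_const u)
    rw [fderiv_fun_sub (e2.fun_add (e1.fun_mul hJ1)) (hJ1.fun_mul e1), fderiv_fun_add e2 (e1.fun_mul hJ1),
      fderiv_fun_mul' e1 hJ1, fderiv_fun_mul' hJ1 e1]
    simp [fderiv_apply_const hJ2, fderiv_apply_const hΓ1]
    abel
  simp only [covDerivEnd₂, key, hsymm, hs u w, christoffelCurvature, covDerivEnd_apply]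
  noncomm_ring

namespace IsLocalNearlyKahler

variable {g : E → E →L[ℝ] E →L[ℝ] ℝ} {J : E → E →L[ℝ] E} {Γ : E → E →L[ℝ] E →L[ℝ] E} {y : E}

theorem eventually (h : IsLocalNearlyKahler g J Γ y) :
    ∀ᶠ z in 𝓝 y, IsLocalNearlyKahler g J Γ z := by
  filter_upwards [h.contDiffAt_metric.eventually (by simp), h.contDiffAt_J.eventually (by simp),
    h.contDiffAt_christoffel.eventually (by simp), h.symm.eventually_nhds, h.sq.eventually_nhds,
    h.isometry.eventually_nhds, h.torsion_free.eventually_nhds, h.metric.eventually_nhds,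
    h.nearlyKahler.eventually_nhds] with z h1 h2 h3 h4 h5 h6 h7 h8 h9
  exact ⟨h1, h2, h3, h4, h5, h6, h7, h8, h9⟩

theorem differentiableAt_metric (h : IsLocalNearlyKahler g J Γ y) : DifferentiableAt ℝ g y :=
  h.contDiffAt_metric.differentiableAt (by norm_num)

theorem differentiableAt_J (h : IsLocalNearlyKahler g J Γ y) : DifferentiableAt ℝ J y :=
  h.contDiffAt_J.differentiableAt (by norm_num)

theorem differentiableAt_christoffel (h : IsLocalNearlyKahler g J Γ y) : DifferentiableAt ℝ Γ y :=
  h.contDiffAt_christoffel.differentiableAt (by norm_num)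

theorem differentiableAt_covDerivEnd (h : IsLocalNearlyKahler g J Γ y) :
    DifferentiableAt ℝ (covDerivEnd Γ J) y :=
  (contDiffAt_covDerivEnd h.contDiffAt_J h.contDiffAt_christoffel).differentiableAt (by norm_num)

theorem J_J (h : IsLocalNearlyKahler g J Γ y) (v : E) : J y (J y v) = -v := by
  simpa using congr($h.sq.self_of_nhds v)

theorem inner_J_left (h : IsLocalNearlyKahler g J Γ y) (v w : E) :
    g y (J y v) w = -g y v (J y w) := by
  rw [← h.isometry.self_of_nhds v (J y w), h.J_J]; simp

theorem covDerivEnd_self (h : IsLocalNearlyKahler g J Γ y) (u : E) : covDerivEnd Γ J y u u = 0 :=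
  h.nearlyKahler.self_of_nhds u

theorem covDerivEnd_swap (h : IsLocalNearlyKahler g J Γ y) (u v : E) :
    covDerivEnd Γ J y u v = -covDerivEnd Γ J y v u := by
  have e := h.covDerivEnd_self (u + v)
  simp only [map_add, add_apply, h.covDerivEnd_self, zero_add, add_zero] at e
  exact eq_neg_of_add_eq_zero_left (by rw [add_comm]; exact e)

theorem covDerivEnd_mul_J (h : IsLocalNearlyKahler g J Γ y) (u : E) :
    covDerivEnd Γ J y u * J y + J y * covDerivEnd Γ J y u = 0 := by
  have e := fderiv_apply_eq_zero_of_eventually h.sq u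
  rw [fderiv_fun_mul' h.differentiableAt_J h.differentiableAt_J] at e
  simp only [add_apply, smul_apply, smul_eq_mul, MulOpposite.smul_eq_mul_unop,
    MulOpposite.unop_op] at e
  have e2 := h.sq.self_of_nhds
  rw [covDerivEnd_apply]
  calc _ = (J y * fderiv ℝ J y u + fderiv ℝ J y u * J y) + Γ y u * (J y * J y)
        - (J y * J y) * Γ y u := by noncomm_ring
    _ = 0 := by rw [e, e2]; noncomm_ring

theorem covDerivEnd_J (h : IsLocalNearlyKahler g J Γ y) (u v : E) :
    covDerivEnd Γ J y u (J y v) = -J y (covDerivEnd Γ J y u v) :=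
  eq_neg_of_add_eq_zero_left congr($(h.covDerivEnd_mul_J u) v)

theorem inner_covDerivEnd (h : IsLocalNearlyKahler g J Γ y) (u v w : E) :
    g y (covDerivEnd Γ J y u v) w + g y v (covDerivEnd Γ J y u w) = 0 := by
  have hev : ∀ᶠ z in 𝓝 y, g z (J z v) w + g z v (J z w) = 0 := by
    filter_upwards [h.eventually] with z hz
    rw [hz.inner_J_left]; ring
  have e := fderiv_apply_eq_zero_of_eventually hev u
  have d1 : ∀ v, DifferentiableAt ℝ (fun z => J z v) y := fun v =>
    h.differentiableAt_J.clm_apply (differentiableAt_const v)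
  have d2 : ∀ v : E, DifferentiableAt ℝ (fun _ : E => v) y := fun v => differentiableAt_const v
  have hg := h.differentiableAt_metric
  rw [fderiv_fun_add ((hg.clm_apply (d1 v)).clm_apply (d2 w))
    ((hg.clm_apply (d2 v)).clm_apply (d1 w)), add_apply,
    fderiv_clm_apply₂ hg (d1 v) (d2 w), fderiv_clm_apply₂ hg (d2 v) (d1 w),
    fderiv_apply_const h.differentiableAt_J, fderiv_apply_const h.differentiableAt_J,
    h.metric.self_of_nhds, h.metric.self_of_nhds] at e
  simp only [fderiv_fun_const, Pi.zero_apply, zero_apply, map_zero] at e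
  simp only [covDerivEnd_apply, add_apply, sub_apply, map_add, map_sub,
    mul_apply_eq_comp]
  linarith [h.inner_J_left (Γ y u v) w, h.inner_J_left v (Γ y u w)]

theorem inner_covDerivEnd_skew (h : IsLocalNearlyKahler g J Γ y) (u v w : E) :
    g y (covDerivEnd Γ J y u v) w = -g y (covDerivEnd Γ J y u w) v := by
  rw [h.symm.self_of_nhds _ v]
  linarith [h.inner_covDerivEnd u v w]

theorem covDerivEnd₂_self (h : IsLocalNearlyKahler g J Γ y) (w u : E) :
    covDerivEnd₂ Γ J y w u u = 0 := by
  have e := fderiv_apply_eq_zero_of_eventually (h.nearlyKahler.mono fun z hz => hz u) w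
  rw [fderiv_apply_const₂ h.differentiableAt_covDerivEnd] at e
  simp [covDerivEnd₂, e, h.covDerivEnd_self, h.covDerivEnd_swap u]

theorem inner_covDerivEnd₂_skew (h : IsLocalNearlyKahler g J Γ y) (w u v z : E) :
    g y (covDerivEnd₂ Γ J y w u v) z = -g y (covDerivEnd₂ Γ J y w u z) v := by
  have e := fderiv_apply_eq_zero_of_eventually
    (h.eventually.mono fun p hp => hp.inner_covDerivEnd u v z) w
  have hN := h.differentiableAt_covDerivEnd
  have d1 : ∀ v, DifferentiableAt ℝ (fun z => covDerivEnd Γ J z u v) y := fun v =>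
    (hN.clm_apply (differentiableAt_const u)).clm_apply (differentiableAt_const v)
  have d2 : ∀ v : E, DifferentiableAt ℝ (fun _ : E => v) y := fun v => differentiableAt_const v
  have hg := h.differentiableAt_metric
  rw [fderiv_fun_add ((hg.clm_apply (d1 v)).clm_apply (d2 z))
    ((hg.clm_apply (d2 v)).clm_apply (d1 z)), add_apply,
    fderiv_clm_apply₂ hg (d1 v) (d2 z), fderiv_clm_apply₂ hg (d2 v) (d1 z),
    fderiv_apply_const₂ hN, fderiv_apply_const₂ hN,
    h.metric.self_of_nhds, h.metric.self_of_nhds] at e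
  simp only [fderiv_fun_const, Pi.zero_apply, zero_apply, map_zero] at e
  rw [h.symm.self_of_nhds _ v]
  simp only [covDerivEnd₂, add_apply, sub_apply, map_add, map_sub, mul_apply_eq_comp]
  linarith [h.inner_covDerivEnd u (Γ y w v) z, h.inner_covDerivEnd u v (Γ y w z),
    h.inner_covDerivEnd (Γ y w u) v z]

/-- The second covariant derivative of `J² = -1`. -/
theorem covDerivEnd₂_mul_J (h : IsLocalNearlyKahler g J Γ y) (w u : E) :
    covDerivEnd₂ Γ J y w u * J y + J y * covDerivEnd₂ Γ J y w u
      + covDerivEnd Γ J y u * covDerivEnd Γ J y w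
      + covDerivEnd Γ J y w * covDerivEnd Γ J y u = 0 := by
  have e := fderiv_apply_eq_zero_of_eventually
    (h.eventually.mono fun p hp => hp.covDerivEnd_mul_J u) w
  have hN := h.differentiableAt_covDerivEnd
  have hJ := h.differentiableAt_J
  have d1 : DifferentiableAt ℝ (fun z => covDerivEnd Γ J z u) y :=
    hN.clm_apply (differentiableAt_const u)
  rw [fderiv_fun_add (d1.fun_mul hJ) (hJ.fun_mul d1), fderiv_fun_mul' d1 hJ, fderiv_fun_mul' hJ d1] at e
  simp only [add_apply, smul_apply, smul_eq_mul, MulOpposite.smul_eq_mul_unop,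
    MulOpposite.unop_op, fderiv_apply_const hN] at e
  have e1 := h.covDerivEnd_mul_J u
  have e2 := h.covDerivEnd_mul_J (Γ y w u)
  have e3 : fderiv ℝ J y w = covDerivEnd Γ J y w - Γ y w * J y + J y * Γ y w := by
    rw [covDerivEnd_apply]; abel
  rw [e3] at e
  simp only [covDerivEnd₂]
  generalize covDerivEnd Γ J y u = N at *
  generalize covDerivEnd Γ J y w = N' at *
  generalize covDerivEnd Γ J y (Γ y w u) = N'' at *
  generalize fderiv ℝ (covDerivEnd Γ J) y w u = D at *
  generalize Γ y w = G at *
  calc _ = (N * (N' - G * J y + J y * G) + D * J y + (J y * D + (N' - G * J y + J y * G) * N))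
        + G * (N * J y + J y * N) - (N * J y + J y * N) * G - (N'' * J y + J y * N'') := by
          noncomm_ring
    _ = 0 := by rw [e, e1, e2]; simp

/-- The second derivatives of the metric coefficients. Their symmetry in `w` and `u` is the
skew-symmetry of the curvature in its last two arguments. -/
theorem fderiv_fderiv_metric (h : IsLocalNearlyKahler g J Γ y) (w u v z : E) :
    fderiv ℝ (fderiv ℝ fun p => g p v z) y w u
      = g y (Γ y w (Γ y u v)) z + g y (Γ y u v) (Γ y w z) + g y (fderiv ℝ Γ y w u v) z
        + (g y (Γ y w v) (Γ y u z) + g y v (Γ y w (Γ y u z)) + g y v (fderiv ℝ Γ y w u z)) := by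
  have hg := h.differentiableAt_metric
  have hΓ := h.differentiableAt_christoffel
  have hφ : ContDiffAt ℝ 2 (fun p => g p v z) y :=
    (h.contDiffAt_metric.clm_apply contDiffAt_const).clm_apply contDiffAt_const
  have hφ2 : DifferentiableAt ℝ (fderiv ℝ fun p => g p v z) y :=
    (hφ.fderiv_right (m := 1) (by norm_num)).differentiableAt (by norm_num)
  have d1 : ∀ v, DifferentiableAt ℝ (fun z => Γ z u v) y := fun v =>
    (hΓ.clm_apply (differentiableAt_const u)).clm_apply (differentiableAt_const v)
  have d2 : ∀ v : E, DifferentiableAt ℝ (fun _ : E => v) y := fun v => differentiableAt_const v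
  have hev : ∀ᶠ p in 𝓝 y, fderiv ℝ (fun p => g p v z) p u = g p (Γ p u v) z + g p v (Γ p u z) := by
    filter_upwards [h.eventually] with p hp
    rw [fderiv_apply_const₂ hp.differentiableAt_metric, hp.metric.self_of_nhds]
  rw [← fderiv_apply_const hφ2, Filter.EventuallyEq.fderiv_eq hev,
    fderiv_fun_add ((hg.clm_apply (d1 v)).clm_apply (d2 z))
      ((hg.clm_apply (d2 v)).clm_apply (d1 z)), add_apply,
    fderiv_clm_apply₂ hg (d1 v) (d2 z), fderiv_clm_apply₂ hg (d2 v) (d1 z),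
    fderiv_apply_const₂ hΓ, fderiv_apply_const₂ hΓ,
    h.metric.self_of_nhds, h.metric.self_of_nhds]
  simp only [fderiv_fun_const, Pi.zero_apply, zero_apply, map_zero, add_zero]

theorem fderiv_christoffel_symm (h : IsLocalNearlyKahler g J Γ y) (w u v : E) :
    fderiv ℝ Γ y w u v = fderiv ℝ Γ y w v u := by
  have hΓ := h.differentiableAt_christoffel
  rw [← fderiv_apply_const₂ hΓ, ← fderiv_apply_const₂ hΓ,
    Filter.EventuallyEq.fderiv_eq (h.torsion_free.mono fun p hp => hp u v)]

theorem isCurvatureLike (h : IsLocalNearlyKahler g J Γ y) :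
    IsCurvatureLike fun w u v z => g y (christoffelCurvature Γ y w u v) z where
  add a a' b c d := by
    rw [christoffelCurvature_apply, christoffelCurvature_apply, christoffelCurvature_apply,
      (fderiv ℝ Γ y).map_add a a', (fderiv ℝ Γ y b).map_add a a', (Γ y).map_add a a']
    simp only [add_apply, map_add, map_sub, sub_apply]
    ring
  skew_left a b c d := by
    simp only [christoffelCurvature_apply, map_add, map_sub, add_apply, sub_apply]
    ring
  skew_right w u v z := by
    have hφ : ContDiffAt ℝ 2 (fun p => g p v z) y :=
      (h.contDiffAt_metric.clm_apply contDiffAt_const).clm_apply contDiffAt_const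
    have hsymm := (hφ.isSymmSndFDerivAt (by simp)).eq w u
    rw [h.fderiv_fderiv_metric, h.fderiv_fderiv_metric] at hsymm
    rw [h.symm.self_of_nhds (christoffelCurvature Γ y w u z) v]
    simp only [christoffelCurvature_apply, map_add, map_sub, add_apply, sub_apply]
    linarith
  bianchi a b c d := by
    have hs := h.torsion_free.self_of_nhds
    simp only [christoffelCurvature_apply, map_add, map_sub, add_apply, sub_apply]
    rw [h.fderiv_christoffel_symm b c a, h.fderiv_christoffel_symm a b c,
      h.fderiv_christoffel_symm c a b, hs b c, hs c a, hs a b]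
    ring

/-- Gray's formula `g((∇²_{w,x} J) w, z) = g((∇_w J) x, J (∇_w J) z)`. -/
theorem inner_covDerivEnd₂ (h : IsLocalNearlyKahler g J Γ y) (w x z : E) :
    g y (covDerivEnd₂ Γ J y w x w) z
      = g y (covDerivEnd Γ J y w x) (J y (covDerivEnd Γ J y w z)) := by
  refine secondDerivative_eq_of_ricci_identity (V := E)
    (g := (ContinuousLinearMap.coeLM ℝ).comp (g y).toLinearMap) (J := (J y).toLinearMap)
    (N := (ContinuousLinearMap.coeLM ℝ).comp (covDerivEnd Γ J y).toLinearMap)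
    (A := fun w u v z => g y (covDerivEnd₂ Γ J y w u v) z)
    h.isCurvatureLike h.symm.self_of_nhds h.J_J h.covDerivEnd_self h.covDerivEnd_J
    (fun w x z => by simp [h.covDerivEnd₂_self]) h.inner_covDerivEnd₂_skew ?_ ?_ w x z
  · intro w x y' z
    change g y (covDerivEnd₂ Γ J y w x (J y y')) z = g y (covDerivEnd₂ Γ J y w x y') (J y z)
      + g y (covDerivEnd Γ J y w y') (covDerivEnd Γ J y x z)
      + g y (covDerivEnd Γ J y x y') (covDerivEnd Γ J y w z)
    have e := congr(g y ($(h.covDerivEnd₂_mul_J w x) y') z)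
    simp only [add_apply, mul_apply_eq_comp, map_add, zero_apply, map_zero] at e
    linarith [h.inner_J_left (covDerivEnd₂ Γ J y w x y') z,
      h.inner_covDerivEnd x (covDerivEnd Γ J y w y') z,
      h.inner_covDerivEnd w (covDerivEnd Γ J y x y') z]
  · intro w x y' z
    have e := congr(g y ($(covDerivEnd₂_sub_swap h.contDiffAt_J h.contDiffAt_christoffel
      h.torsion_free.self_of_nhds w x) y') z)
    simp only [sub_apply, mul_apply_eq_comp, map_sub] at e
    change g y (covDerivEnd₂ Γ J y w x y') z - g y (covDerivEnd₂ Γ J y x w y') z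
      = g y (christoffelCurvature Γ y w x (J y y')) z + g y (christoffelCurvature Γ y w x y') (J y z)
    linarith [h.inner_J_left (christoffelCurvature Γ y w x y') z]

end IsLocalNearlyKahler

end LocalModel

/-! ### Lagrangian maps into a local nearly Kähler structure -/

noncomputable section LocalLagrangian

set_option synthInstance.maxHeartbeats 200000

variable {E : Type*} [NormedAddCommGroup E] [NormedSpace ℝ E]
  {E' : Type*} [NormedAddCommGroup E'] [NormedSpace ℝ E']

/-- The covariant derivative, in the direction `v`, of the vector field `σ` along the map `F`, for
the connection with Christoffel symbols `Γ`. -/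
def covDerivAlong (Γ : E → E →L[ℝ] E →L[ℝ] E) (F σ : E' → E) (x v : E') : E :=
  fderiv ℝ σ x v + Γ (F x) (fderiv ℝ F x v) (σ x)

theorem fderiv_comp_clm_apply₂ {G : Type*} [NormedAddCommGroup G] [NormedSpace ℝ G]
    {B : E → E →L[ℝ] E →L[ℝ] G} {F a b : E' → E} {x : E'}
    (hB : DifferentiableAt ℝ B (F x)) (hF : DifferentiableAt ℝ F x) (ha : DifferentiableAt ℝ a x)
    (hb : DifferentiableAt ℝ b x) (w : E') :
    fderiv ℝ (fun z => B (F z) (a z) (b z)) x w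
      = fderiv ℝ B (F x) (fderiv ℝ F x w) (a x) (b x) + B (F x) (fderiv ℝ a x w) (b x)
        + B (F x) (a x) (fderiv ℝ b x w) := by
  have hBF : DifferentiableAt ℝ (fun z => B (F z)) x :=
    DifferentiableAt.comp (g := B) x hB hF
  rw [fderiv_clm_apply₂ hBF ha hb]
  have : fderiv ℝ (fun z => B (F z)) x = (fderiv ℝ B (F x)).comp (fderiv ℝ F x) :=
    fderiv_comp (g := B) x hB hF
  rw [this, ContinuousLinearMap.comp_apply]

theorem fderiv_comp_clm_apply {G : Type*} [NormedAddCommGroup G] [NormedSpace ℝ G]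
    {B : E → E →L[ℝ] G} {F a : E' → E} {x : E'} (hB : DifferentiableAt ℝ B (F x))
    (hF : DifferentiableAt ℝ F x) (ha : DifferentiableAt ℝ a x) (w : E') :
    fderiv ℝ (fun z => B (F z) (a z)) x w
      = fderiv ℝ B (F x) (fderiv ℝ F x w) (a x) + B (F x) (fderiv ℝ a x w) := by
  have hBF : DifferentiableAt ℝ (fun z => B (F z)) x := hB.comp x hF
  rw [fderiv_clm_apply hBF ha]
  have : fderiv ℝ (fun z => B (F z)) x = (fderiv ℝ B (F x)).comp (fderiv ℝ F x) :=
    fderiv_comp x hB hF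
  rw [this, add_apply, ContinuousLinearMap.flip_apply, ContinuousLinearMap.comp_apply,
    ContinuousLinearMap.comp_apply, add_comm]

theorem covDerivEnd₂_apply (Γ : E → E →L[ℝ] E →L[ℝ] E) (J : E → E →L[ℝ] E) (y w u v : E) :
    covDerivEnd₂ Γ J y w u v
      = fderiv ℝ (covDerivEnd Γ J) y w u v + Γ y w (covDerivEnd Γ J y u v)
        - covDerivEnd Γ J y u (Γ y w v) - covDerivEnd Γ J y (Γ y w u) v := rfl

/-- For a torsion-free connection, `∇_v dF(u) = ∇_u dF(v)`. -/
theorem covDerivAlong_fderiv_symm {Γ : E → E →L[ℝ] E →L[ℝ] E} {F : E' → E} {x : E'}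
    (hF : ContDiffAt ℝ 2 F x) (hs : ∀ v w, Γ (F x) v w = Γ (F x) w v) (u v : E') :
    covDerivAlong Γ F (fun z => fderiv ℝ F z u) x v
      = covDerivAlong Γ F (fun z => fderiv ℝ F z v) x u := by
  have hF2 : DifferentiableAt ℝ (fderiv ℝ F) x :=
    (hF.fderiv_right (m := 1) (by norm_num)).differentiableAt (by norm_num)
  simp only [covDerivAlong]
  rw [fderiv_apply_const hF2, fderiv_apply_const hF2, hs, (hF.isSymmSndFDerivAt (by simp)).eq]

namespace IsLocalNearlyKahler

variable {g : E → E →L[ℝ] E →L[ℝ] ℝ} {J : E → E →L[ℝ] E} {Γ : E → E →L[ℝ] E →L[ℝ] E}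
  {F : E' → E} {x : E'}

theorem fderiv_inner_along (h : IsLocalNearlyKahler g J Γ (F x)) (hF : DifferentiableAt ℝ F x)
    {a b : E' → E} (ha : DifferentiableAt ℝ a x) (hb : DifferentiableAt ℝ b x) (v : E') :
    fderiv ℝ (fun z => g (F z) (a z) (b z)) x v
      = g (F x) (covDerivAlong Γ F a x v) (b x) + g (F x) (a x) (covDerivAlong Γ F b x v) := by
  rw [fderiv_comp_clm_apply₂ h.differentiableAt_metric hF ha hb, h.metric.self_of_nhds]
  simp only [covDerivAlong, map_add, add_apply]
  ring

theorem covDerivAlong_J (h : IsLocalNearlyKahler g J Γ (F x)) (hF : DifferentiableAt ℝ F x)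
    {a : E' → E} (ha : DifferentiableAt ℝ a x) (v : E') :
    covDerivAlong Γ F (fun z => J (F z) (a z)) x v
      = covDerivEnd Γ J (F x) (fderiv ℝ F x v) (a x) + J (F x) (covDerivAlong Γ F a x v) := by
  simp only [covDerivAlong]
  rw [fderiv_comp_clm_apply h.differentiableAt_J hF ha, covDerivEnd_apply]
  simp only [add_apply, sub_apply, map_add, mul_apply_eq_comp]
  abel

theorem covDerivAlong_covDerivEnd (h : IsLocalNearlyKahler g J Γ (F x))
    (hF : DifferentiableAt ℝ F x) {a b : E' → E} (ha : DifferentiableAt ℝ a x)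
    (hb : DifferentiableAt ℝ b x) (v : E') :
    covDerivAlong Γ F (fun z => covDerivEnd Γ J (F z) (a z) (b z)) x v
      = covDerivEnd₂ Γ J (F x) (fderiv ℝ F x v) (a x) (b x)
        + covDerivEnd Γ J (F x) (covDerivAlong Γ F a x v) (b x)
        + covDerivEnd Γ J (F x) (a x) (covDerivAlong Γ F b x v) := by
  simp only [covDerivAlong]
  rw [fderiv_comp_clm_apply₂ h.differentiableAt_covDerivEnd hF ha hb, covDerivEnd₂_apply]
  simp only [add_apply, map_add]
  abel

section FirstOrder

variable (h : IsLocalNearlyKahler g J Γ (F x)) (hF : ContDiffAt ℝ 2 F x)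
  (hL : ∀ᶠ z in 𝓝 x, ∀ u v, g (F z) (J (F z) (fderiv ℝ F z u)) (fderiv ℝ F z v) = 0)

include h hF hL

/-- The derivative of the Lagrangian condition `ω(dF u, dF v) = 0`. -/
theorem covDerivEnd_lagrangian_aux (w u v : E') :
    g (F x) (covDerivEnd Γ J (F x) (fderiv ℝ F x w) (fderiv ℝ F x u)) (fderiv ℝ F x v)
      = g (F x) (covDerivAlong Γ F (fun z => fderiv ℝ F z u) x w) (J (F x) (fderiv ℝ F x v))
        - g (F x) (covDerivAlong Γ F (fun z => fderiv ℝ F z v) x w)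
          (J (F x) (fderiv ℝ F x u)) := by
  have hF1 : DifferentiableAt ℝ F x := hF.differentiableAt (by norm_num)
  have hF2 : DifferentiableAt ℝ (fderiv ℝ F) x :=
    (hF.fderiv_right (m := 1) (by norm_num)).differentiableAt (by norm_num)
  have d : ∀ u, DifferentiableAt ℝ (fun z => fderiv ℝ F z u) x := fun u =>
    hF2.clm_apply (differentiableAt_const u)
  have dJ : DifferentiableAt ℝ (fun z => J (F z) (fderiv ℝ F z u)) x :=
    (h.differentiableAt_J.comp x hF1).clm_apply (d u)
  have e := fderiv_apply_eq_zero_of_eventually (hL.mono fun z hz => hz u v) w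
  rw [h.fderiv_inner_along hF1 dJ (d v), h.covDerivAlong_J hF1 (d u), map_add, add_apply,
    h.inner_J_left (covDerivAlong Γ F _ x w), h.symm.self_of_nhds (J (F x) _)] at e
  linarith

/-- The `3`-form `g((∇_u J) v, w)` vanishes on a Lagrangian submanifold: it is a third of `dω`. -/
theorem inner_covDerivEnd_lagrangian (w u v : E') :
    g (F x) (covDerivEnd Γ J (F x) (fderiv ℝ F x w) (fderiv ℝ F x u)) (fderiv ℝ F x v) = 0 := by
  -- Summing the derivative of the Lagrangian condition over cyclic permutations, the second
  -- derivatives of `F` cancel, and three times the form remains.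
  have k := h.covDerivEnd_lagrangian_aux hF hL
  have s := covDerivAlong_fderiv_symm hF h.torsion_free.self_of_nhds
  have k1 := k w u v
  have k2 := k u v w
  have k3 := k v w u
  rw [s u w] at k1
  rw [s v u] at k2
  rw [s w v] at k3
  set a := fderiv ℝ F x w
  set b := fderiv ℝ F x u
  set c := fderiv ℝ F x v
  have e1 : g (F x) (covDerivEnd Γ J (F x) b c) a = g (F x) (covDerivEnd Γ J (F x) a b) c := by
    rw [h.inner_covDerivEnd_skew, h.covDerivEnd_swap]; simp
  have e2 : g (F x) (covDerivEnd Γ J (F x) c a) b = g (F x) (covDerivEnd Γ J (F x) a b) c := by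
    rw [h.covDerivEnd_swap, map_neg, neg_apply, h.inner_covDerivEnd_skew a c b]; simp
  rw [e1] at k2
  rw [e2] at k3
  linarith

/-- The second fundamental form, paired with `J` of tangent vectors, is symmetric in the last two
arguments. -/
theorem inner_covDerivAlong_J_symm (w u v : E') :
    g (F x) (covDerivAlong Γ F (fun z => fderiv ℝ F z u) x w) (J (F x) (fderiv ℝ F x v))
      = g (F x) (covDerivAlong Γ F (fun z => fderiv ℝ F z v) x w)
          (J (F x) (fderiv ℝ F x u)) := by
  linarith [h.covDerivEnd_lagrangian_aux hF hL w u v, h.inner_covDerivEnd_lagrangian hF hL w u v]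

end FirstOrder

end IsLocalNearlyKahler

/-- `s` is an orthonormal frame of a Lagrangian subspace of dimension `3` on which the `3`-form
`g((∇_u J) v, w)` vanishes, and together with `J s` it separates vectors. -/
structure IsSpecialFrame (g : E → E →L[ℝ] E →L[ℝ] ℝ) (J : E → E →L[ℝ] E)
    (Γ : E → E →L[ℝ] E →L[ℝ] E) (y : E) (s : Fin 3 → E) : Prop where
  inner_self : ∀ i, g y (s i) (s i) = 1
  inner_eq_zero : ∀ i j, i ≠ j → g y (s i) (s j) = 0
  inner_J : ∀ i j, g y (s i) (J y (s j)) = 0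
  form_eq_zero : ∀ i j k, g y (covDerivEnd Γ J y (s i) (s j)) (s k) = 0
  separating : ∀ v, (∀ i, g y v (s i) = 0) → (∀ i, g y v (J y (s i)) = 0) → v = 0

namespace IsLocalNearlyKahler

variable {g : E → E →L[ℝ] E →L[ℝ] ℝ} {J : E → E →L[ℝ] E} {Γ : E → E →L[ℝ] E →L[ℝ] E} {y : E}

theorem inner_covDerivEnd_J_skew (h : IsLocalNearlyKahler g J Γ y) (u v w : E) :
    g y (covDerivEnd Γ J y u v) (J y w) = -g y (covDerivEnd Γ J y u w) (J y v) := by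
  have e := h.inner_J_left (covDerivEnd Γ J y u v) w
  have e2 := h.inner_covDerivEnd_skew u (J y v) w
  rw [h.covDerivEnd_J, map_neg, neg_apply] at e2
  linarith

/-- On a special frame, `(∇_{s i} J) (s j) = c • J (s k)` for `(i, j, k)` a cyclic permutation of
`(0, 1, 2)`. -/
theorem covDerivEnd_specialFrame (h : IsLocalNearlyKahler g J Γ y) {s : Fin 3 → E}
    (hs : IsSpecialFrame g J Γ y s) : ∃ c : ℝ,
      covDerivEnd Γ J y (s 0) (s 1) = c • J y (s 2) ∧
      covDerivEnd Γ J y (s 1) (s 2) = c • J y (s 0) ∧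
      covDerivEnd Γ J y (s 2) (s 0) = c • J y (s 1) := by
  have hJs : ∀ i j, g y (J y (s i)) (s j) = 0 := fun i j => by
    rw [h.symm.self_of_nhds]; exact hs.inner_J j i
  have hJJ : ∀ i j, g y (J y (s i)) (J y (s j)) = g y (s i) (s j) := fun i j =>
    h.isometry.self_of_nhds _ _
  have k := h.inner_covDerivEnd_J_skew
  have hz : ∀ i j, g y (covDerivEnd Γ J y (s i) (s j)) (J y (s j)) = 0 := fun i j => by
    linarith [k (s i) (s j) (s j)]
  have hz' : ∀ i j, g y (covDerivEnd Γ J y (s i) (s j)) (J y (s i)) = 0 := fun i j => by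
    rw [k, h.covDerivEnd_self]; simp
  have hc : ∀ i j l, g y (covDerivEnd Γ J y (s i) (s j)) (J y (s l))
      = g y (covDerivEnd Γ J y (s j) (s l)) (J y (s i)) := fun i j l => by
    rw [k (s j), h.covDerivEnd_swap (s i)]; simp
  have key : ∀ i j l, i ≠ j → j ≠ l → l ≠ i → (∀ m, m = i ∨ m = j ∨ m = l) →
      covDerivEnd Γ J y (s i) (s j)
        = g y (covDerivEnd Γ J y (s i) (s j)) (J y (s l)) • J y (s l) := by
    intro i j l hij hjl hli hm
    rw [← sub_eq_zero]
    refine hs.separating _ (fun m => ?_) (fun m => ?_)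
    · simp [hs.form_eq_zero, hJs]
    · rcases hm m with rfl | rfl | rfl
      · simp [hz', hJJ, hs.inner_eq_zero _ _ hli]
      · simp [hz, hJJ, hs.inner_eq_zero _ _ hjl.symm]
      · simp [hJJ, hs.inner_self]
  refine ⟨g y (covDerivEnd Γ J y (s 0) (s 1)) (J y (s 2)), key 0 1 2 (by decide) (by decide)
    (by decide) (by decide), ?_, ?_⟩
  · rw [hc 0 1 2]
    exact key 1 2 0 (by decide) (by decide) (by decide) (by decide)
  · rw [hc 0 1 2, hc 1 2 0]
    exact key 2 0 1 (by decide) (by decide) (by decide) (by decide)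

/-- The `3`-form `g((∇_u J) v, J w)` does not vanish on a special frame: otherwise the constant in
`covDerivEnd_specialFrame` would be zero, and then `∇_{s 0} J = 0`, against strictness. -/
theorem specialFrame_ne_zero (h : IsLocalNearlyKahler g J Γ y) {s : Fin 3 → E}
    (hs : IsSpecialFrame g J Γ y s) (hstrict : ∀ v, v ≠ 0 → covDerivEnd Γ J y v ≠ 0) :
    g y (covDerivEnd Γ J y (s 0) (s 1)) (J y (s 2)) ≠ 0 := by
  obtain ⟨c, h01, h12, h20⟩ := h.covDerivEnd_specialFrame hs
  rw [h01, map_smul, smul_apply, h.isometry.self_of_nhds, hs.inner_self, smul_eq_mul, mul_one]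
  rintro rfl
  refine hstrict (s 0) (fun h0 => ?_) ?_
  · simpa [h0] using hs.inner_self 0
  · ext v
    have hz : ∀ i, covDerivEnd Γ J y (s 0) (s i) = 0 := by
      intro i
      fin_cases i
      · exact h.covDerivEnd_self _
      · simpa using h01
      · change covDerivEnd Γ J y (s 0) (s 2) = 0
        rw [h.covDerivEnd_swap, h20]; simp
    refine hs.separating _ (fun i => ?_) (fun i => ?_)
    · rw [h.inner_covDerivEnd_skew, hz]; simp
    · rw [h.inner_covDerivEnd_skew, h.covDerivEnd_J, hz]; simp

/-- The covariant derivative of the `3`-form `g((∇_u J) v, w)` in directions tangent to a special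
frame vanishes on the frame, by Gray's formula. -/
theorem inner_covDerivEnd₂_specialFrame (h : IsLocalNearlyKahler g J Γ y) {s : Fin 3 → E}
    (hs : IsSpecialFrame g J Γ y s) {w : E} (hw : w ∈ Submodule.span ℝ (Set.range s)) :
    g y (covDerivEnd₂ Γ J y w (s 0) (s 1)) (s 2) = 0 := by
  obtain ⟨c, h01, h12, h20⟩ := h.covDerivEnd_specialFrame hs
  have hJs : ∀ i j, g y (J y (s i)) (s j) = 0 := fun i j => by
    rw [h.symm.self_of_nhds]; exact hs.inner_J j i
  have hswap : ∀ w u v, covDerivEnd₂ Γ J y w u v = -covDerivEnd₂ Γ J y w v u := fun w u v => by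
    have e := h.covDerivEnd₂_self w (u + v)
    have hadd : covDerivEnd₂ Γ J y w (u + v) = covDerivEnd₂ Γ J y w u + covDerivEnd₂ Γ J y w v := by
      simp only [covDerivEnd₂, map_add, mul_add, add_mul]; abel
    rw [hadd] at e
    simp only [map_add, add_apply, h.covDerivEnd₂_self, zero_add, add_zero] at e
    exact eq_neg_of_add_eq_zero_left (by rw [add_comm]; exact e)
  induction hw using Submodule.span_induction with
  | mem w hw =>
    obtain ⟨i, rfl⟩ := hw
    fin_cases i
    · change g y (covDerivEnd₂ Γ J y (s 0) (s 0) (s 1)) (s 2) = 0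
      rw [hswap, map_neg, neg_apply, h.inner_covDerivEnd₂, h01, h.covDerivEnd_swap (s 0) (s 2), h20]
      simp [h.J_J, hJs]
    · change g y (covDerivEnd₂ Γ J y (s 1) (s 0) (s 1)) (s 2) = 0
      rw [h.inner_covDerivEnd₂, h12, h.covDerivEnd_swap (s 1) (s 0), h01]
      simp [h.J_J, hJs]
    · change g y (covDerivEnd₂ Γ J y (s 2) (s 0) (s 1)) (s 2) = 0
      rw [h.inner_covDerivEnd₂_skew, h.inner_covDerivEnd₂, h.covDerivEnd_swap (s 2) (s 1), h12, h20]
      simp [h.J_J, hJs]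
  | zero => simp [covDerivEnd₂]
  | add a b _ _ ha hb =>
    rw [covDerivEnd₂_apply] at ha hb ⊢
    rw [(fderiv ℝ (covDerivEnd Γ J) y).map_add, (Γ y).map_add]
    simp only [add_apply, map_add, map_sub, sub_apply] at ha hb ⊢
    linarith
  | smul c a _ ha =>
    rw [covDerivEnd₂_apply] at ha ⊢
    rw [(fderiv ℝ (covDerivEnd Γ J) y).map_smul, (Γ y).map_smul]
    simp only [smul_apply, map_smul, map_sub, map_add, add_apply, sub_apply, smul_eq_mul] at ha ⊢
    linear_combination c * ha

/-- If a frame field `s` along `F` annihilates the `3`-form `g((∇_u J) v, w)` and is special at `x`,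
then the trace `∑ i, g(∇_v (s i), J (s i))` vanishes at `x` for `v` tangent to the frame. -/
theorem sum_inner_covDerivAlong_J_eq_zero {F : E' → E} {x : E'}
    (h : IsLocalNearlyKahler g J Γ (F x)) (hF : DifferentiableAt ℝ F x) {s : Fin 3 → E' → E}
    (hd : ∀ i, DifferentiableAt ℝ (s i) x) (hs : IsSpecialFrame g J Γ (F x) fun i => s i x)
    (hstrict : ∀ v, v ≠ 0 → covDerivEnd Γ J (F x) v ≠ 0)
    (hzero : ∀ᶠ z in 𝓝 x, g (F z) (covDerivEnd Γ J (F z) (s 0 z) (s 1 z)) (s 2 z) = 0) {v : E'}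
    (hv : fderiv ℝ F x v ∈ Submodule.span ℝ (Set.range fun i => s i x)) :
    ∑ i, g (F x) (covDerivAlong Γ F (s i) x v) (J (F x) (s i x)) = 0 := by
  have hne := h.specialFrame_ne_zero hs hstrict
  obtain ⟨c, h01, h12, h20⟩ := h.covDerivEnd_specialFrame hs
  have hc : c ≠ 0 := by
    rintro rfl
    apply hne
    rw [h01]; simp
  have hN : DifferentiableAt ℝ (fun z => covDerivEnd Γ J (F z)) x :=
    DifferentiableAt.comp (g := covDerivEnd Γ J) x h.differentiableAt_covDerivEnd hF
  -- Differentiating the form evaluated on the frame gives `c` times the trace, as the form itself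
  -- has covariant derivative zero on the frame.
  have e := fderiv_apply_eq_zero_of_eventually hzero v
  rw [h.fderiv_inner_along hF ((hN.clm_apply (hd 0)).clm_apply (hd 1)) (hd 2),
    h.covDerivAlong_covDerivEnd hF (hd 0) (hd 1), map_add, map_add, add_apply, add_apply,
    h.inner_covDerivEnd₂_specialFrame hs hv, h01,
    h.covDerivEnd_swap (covDerivAlong Γ F (s 0) x v), map_neg, neg_apply,
    h.inner_covDerivEnd_skew (s 1 x), h12, h.inner_covDerivEnd_skew (s 0 x),
    h.covDerivEnd_swap (s 0 x), h20] at e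
  simp only [map_neg, neg_apply, map_smul, smul_apply, smul_eq_mul] at e
  have hsymm := h.symm.self_of_nhds
  rw [hsymm (J (F x) (s 0 x)), hsymm (J (F x) (s 1 x)), hsymm (J (F x) (s 2 x))] at e
  rw [Fin.sum_univ_three]
  have : c * (g (F x) (covDerivAlong Γ F (s 0) x v) (J (F x) (s 0 x))
      + g (F x) (covDerivAlong Γ F (s 1) x v) (J (F x) (s 1 x))
      + g (F x) (covDerivAlong Γ F (s 2) x v) (J (F x) (s 2 x))) = 0 := by linarith
  exact (mul_eq_zero.1 this).resolve_left hc

end IsLocalNearlyKahler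

end LocalLagrangian

/-! ### Vector fields with constant coefficients in a chart -/

noncomputable section ChartFields

variable {E : Type*} [NormedAddCommGroup E] [NormedSpace ℝ E]
  {H : Type*} [TopologicalSpace H] {I : ModelWithCorners ℝ E H}
  {M : Type*} [TopologicalSpace M] [ChartedSpace H M] [IsManifold I ∞ M]
  {G : Type*} [NormedAddCommGroup G] [NormedSpace ℝ G]

variable (I) in
/-- `chartField I x₀ p v` is the value at `p` of the vector field with constant coefficients `v` in
the chart at `x₀`. -/
def chartField (x₀ p : M) : E →L[ℝ] TangentSpace I p :=
  (trivializationAt E (fun x : M => TangentSpace I x) x₀).symmL ℝ p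

variable (I) in
/-- `chartCoord I x₀ p w` is the vector of coefficients of `w ∈ T_p M` in the chart at `x₀`. -/
def chartCoord (x₀ p : M) : TangentSpace I p →L[ℝ] E :=
  (trivializationAt E (fun x : M => TangentSpace I x) x₀).continuousLinearMapAt ℝ p

theorem mem_baseSet_of_mem_chart_source {x₀ p : M} (hp : p ∈ (chartAt H x₀).source) :
    p ∈ (trivializationAt E (fun x : M => TangentSpace I x) x₀).baseSet := hp

omit [IsManifold I ∞ M] in
theorem symm_mem_source {x₀ : M} {y : E} (hy : y ∈ (extChartAt I x₀).target) :
    (extChartAt I x₀).symm y ∈ (chartAt H x₀).source := by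
  have := (extChartAt I x₀).map_target hy
  rwa [extChartAt_source] at this

omit [IsManifold I ∞ M] in
theorem extChartAt_mem_target {x₀ p : M} (hp : p ∈ (chartAt H x₀).source) :
    extChartAt I x₀ p ∈ (extChartAt I x₀).target :=
  (extChartAt I x₀).map_source (by simpa using hp)

@[simp]
theorem chartCoord_chartField {x₀ p : M} (hp : p ∈ (chartAt H x₀).source) (v : E) :
    chartCoord I x₀ p (chartField I x₀ p v) = v :=
  Trivialization.continuousLinearMapAt_symmL _ (mem_baseSet_of_mem_chart_source hp) v

@[simp]
theorem chartField_chartCoord {x₀ p : M} (hp : p ∈ (chartAt H x₀).source) (w : TangentSpace I p) :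
    chartField I x₀ p (chartCoord I x₀ p w) = w :=
  Trivialization.symmL_continuousLinearMapAt _ (mem_baseSet_of_mem_chart_source hp) w

theorem chartCoord_eq_mfderiv {x₀ p : M} (hp : p ∈ (chartAt H x₀).source) :
    chartCoord I x₀ p = mfderiv I 𝓘(ℝ, E) (extChartAt I x₀) p :=
  TangentBundle.continuousLinearMapAt_trivializationAt hp

theorem mfderiv_extChartAt_chartField {x₀ p : M} (hp : p ∈ (chartAt H x₀).source) (v : E) :
    mfderiv I 𝓘(ℝ, E) (extChartAt I x₀) p (chartField I x₀ p v) = v := by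
  rw [← chartCoord_eq_mfderiv hp]
  exact chartCoord_chartField hp v

/-- The extension of a tangent vector used to define the second fundamental form has
constant coefficients in the chart at the base point. -/
theorem extend_eventuallyEq_chartField {x₀ : M} (v : TangentSpace I x₀) :
    ∀ᶠ p in 𝓝 x₀, extend E v p = chartField I x₀ p (chartCoord I x₀ x₀ v) := by
  filter_upwards [(chartAt H x₀).open_source.mem_nhds (mem_chart_source H x₀)] with p hp
  rw [chartCoord, chartField, Trivialization.symmL_apply _ (mem_baseSet_of_mem_chart_source hp),
    Trivialization.continuousLinearMapAt_apply, Trivialization.linearMapAt_apply,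
    if_pos (mem_baseSet_trivializationAt E _ x₀)]
  rfl

theorem chartCoord_eq_snd {x₀ p : M} (hp : p ∈ (chartAt H x₀).source) (w : TangentSpace I p) :
    chartCoord I x₀ p w = (trivializationAt E (fun x : M => TangentSpace I x) x₀ ⟨p, w⟩).2 := by
  rw [chartCoord, Trivialization.continuousLinearMapAt_apply, Trivialization.linearMapAt_apply,
    if_pos (mem_baseSet_of_mem_chart_source hp)]

/-- A vector field along a map is smooth if and only if the map and the coefficients of the field in
a chart are smooth. -/
theorem contMDiffAt_along_iff {E' : Type*} [NormedAddCommGroup E'] [NormedSpace ℝ E']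
    {H' : Type*} [TopologicalSpace H'] {I' : ModelWithCorners ℝ E' H'} {L : Type*}
    [TopologicalSpace L] [ChartedSpace H' L] {f : L → M} {x : L} {x₀ : M}
    (hx : f x ∈ (chartAt H x₀).source) (σ : Π p : L, TangentSpace I (f p)) :
    ContMDiffAt I' I.tangent ∞ (fun p => (⟨f p, σ p⟩ : TangentBundle I M)) x ↔
      ContMDiffAt I' I ∞ f x ∧
      ContMDiffAt I' 𝓘(ℝ, E) ∞ (fun p => chartCoord I x₀ (f p) (σ p)) x := by
  have hmem : (⟨f x, σ x⟩ : TangentBundle I M)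
      ∈ (trivializationAt E (fun x : M => TangentSpace I x) x₀).source := by
    rw [Trivialization.mem_source]; exact mem_baseSet_of_mem_chart_source hx
  refine ((trivializationAt E (fun x : M => TangentSpace I x) x₀).contMDiffAt_iff
    (IB := I) (IM := I') (n := ∞) (f := fun p : L => (⟨f p, σ p⟩ : TangentBundle I M)) hmem).trans ?_
  refine and_congr_right fun hf => ?_
  refine Filter.EventuallyEq.contMDiffAt_iff ?_
  filter_upwards [hf.continuousAt.preimage_mem_nhds
    ((chartAt H x₀).open_source.mem_nhds hx)] with p hp
  exact (chartCoord_eq_snd hp _).symm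

theorem contMDiffAt_field_iff {x₀ p : M} (hp : p ∈ (chartAt H x₀).source)
    (σ : Π x : M, TangentSpace I x) :
    ContMDiffAt I I.tangent ∞ (T% σ) p ↔
      ContMDiffAt I 𝓘(ℝ, E) ∞ (fun q => chartCoord I x₀ q (σ q)) p :=
  (contMDiffAt_along_iff (f := fun q : M => q) hp σ).trans (and_iff_right contMDiffAt_id)

theorem contMDiffAt_chartField {x₀ p : M} (hp : p ∈ (chartAt H x₀).source) (v : E) :
    ContMDiffAt I I.tangent ∞ (T% (fun q => chartField I x₀ q v)) p := by
  rw [contMDiffAt_field_iff hp]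
  refine (contMDiffAt_const (c := v)).congr_of_eventuallyEq ?_
  filter_upwards [(chartAt H x₀).open_source.mem_nhds hp] with q hq
  exact chartCoord_chartField hq v

theorem mdifferentiableAt_chartField {x₀ p : M} (hp : p ∈ (chartAt H x₀).source) (v : E) :
    MDiffAt (T% (fun q => chartField I x₀ q v)) p :=
  (contMDiffAt_chartField hp v).mdifferentiableAt (by simp)

/-- The derivative of a function along a field with constant coefficients is the directional
derivative of its expression in the chart. -/
theorem mvfderiv_chartField {x₀ p : M} (hp : p ∈ (chartAt H x₀).source) {ψ : M → G} {φ : E → G}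
    (h : ∀ᶠ q in 𝓝 p, ψ q = φ (extChartAt I x₀ q))
    (hφ : DifferentiableAt ℝ φ (extChartAt I x₀ p)) (v : E) :
    d% ψ p (chartField I x₀ p v) = fderiv ℝ φ (extChartAt I x₀ p) v := by
  have h0 : HasMFDerivAt I 𝓘(ℝ, G) ψ p ((fderiv ℝ φ (extChartAt I x₀ p)).comp
      (mfderiv I 𝓘(ℝ, E) (extChartAt I x₀) p)) :=
    (hφ.hasFDerivAt.hasMFDerivAt.comp p
      (mdifferentiableAt_extChartAt hp).hasMFDerivAt).congr_of_eventuallyEq h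
  change mfderiv I 𝓘(ℝ, G) ψ p (chartField I x₀ p v) = _
  rw [h0.mfderiv]
  exact congrArg _ (mfderiv_extChartAt_chartField hp v)

theorem mlieBracket_chartField [CompleteSpace E] {x₀ p : M} (hp : p ∈ (chartAt H x₀).source)
    (v w : E) :
    mlieBracket I (fun q => chartField I x₀ q v) (fun q => chartField I x₀ q w) p = 0 := by
  have : IsManifold I (minSmoothness ℝ 2) M := by
    rw [minSmoothness_of_isRCLikeNormedField]
    infer_instance
  set c : E → Π y : E, TangentSpace 𝓘(ℝ, E) y := fun v _ => v with hc
  have key : ∀ v, (fun q => chartField I x₀ q v) =ᶠ[𝓝 p]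
      mpullback I 𝓘(ℝ, E) (extChartAt I x₀) (c v) := by
    intro v
    filter_upwards [(chartAt H x₀).open_source.mem_nhds hp] with q hq
    refine ((isInvertible_mfderiv_extChartAt (by simpa using hq)).inverse_apply_eq.2 ?_).symm
    exact (mfderiv_extChartAt_chartField (I := I) hq v).symm
  have hd : ∀ v : E, MDiffAt (T% (c v)) (extChartAt I x₀ p) := fun v =>
    (contMDiffWithinAt_vectorSpace_iff_contDiffWithinAt.2
      (contDiffWithinAt_const (n := 1) (c := v) (s := univ))).contMDiffAt Filter.univ_mem
      |>.mdifferentiableAt (by simp)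
  have := mpullback_mlieBracket (I := I) (I' := 𝓘(ℝ, E)) (f := extChartAt I x₀) (x₀ := p) (n := ∞)
    (hd v) (hd w) (contMDiffAt_extChartAt' hp) (by
      rw [minSmoothness_of_isRCLikeNormedField]; norm_cast)
  rw [(key v).mlieBracket_vectorField_eq (key w), ← this, mpullback_apply,
    ← mlieBracketWithin_univ, mlieBracketWithin_eq_lieBracketWithin]
  simp only [hc, lieBracketWithin, fderivWithin_fun_const, Pi.zero_apply, zero_apply, sub_zero]
  exact map_zero _

end ChartFields

/-! ### Christoffel symbols -/

noncomputable section Christoffel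

set_option synthInstance.maxHeartbeats 200000

variable {E : Type*} [NormedAddCommGroup E] [NormedSpace ℝ E] [FiniteDimensional ℝ E]

/-- The linear form `z ↦ (D v w z + D w v z - D z v w) / 2`. For `D` the derivative of a metric
these are the Christoffel symbols of the first kind. -/
def christoffelForm (D : E →L[ℝ] E →L[ℝ] E →L[ℝ] ℝ) (v w : E) : E →L[ℝ] ℝ :=
  (1 / 2 : ℝ) • (D v w + D w v - (D.flip v).flip w)

theorem christoffelForm_apply (D : E →L[ℝ] E →L[ℝ] E →L[ℝ] ℝ) (v w z : E) :
    christoffelForm D v w z = (1 / 2 : ℝ) * (D v w z + D w v z - D z v w) := rfl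

/-- The Christoffel symbols of the metric `g`. -/
def christoffel (g : E → E →L[ℝ] E →L[ℝ] ℝ) (y : E) : E →L[ℝ] E →L[ℝ] E :=
  LinearMap.toContinuousBilinearMap (LinearMap.mk₂ ℝ
    (fun v w => (g y).inverse (christoffelForm (fderiv ℝ g y) v w))
    (fun v v' w => by
      rw [← map_add]; congr 1; ext z
      generalize fderiv ℝ g y = D
      rw [add_apply, christoffelForm_apply, christoffelForm_apply, christoffelForm_apply,
        D.map_add, (D w).map_add, (D z).map_add]
      simp only [add_apply]; ring)
    (fun c v w => by
      rw [← map_smul]; congr 1; ext z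
      generalize fderiv ℝ g y = D
      rw [smul_apply, christoffelForm_apply, christoffelForm_apply, D.map_smul, (D w).map_smul,
        (D z).map_smul]
      simp only [smul_apply, smul_eq_mul]; ring)
    (fun v w w' => by
      rw [← map_add]; congr 1; ext z
      generalize fderiv ℝ g y = D
      rw [add_apply, christoffelForm_apply, christoffelForm_apply, christoffelForm_apply,
        D.map_add, (D v).map_add, (D z v).map_add]
      simp only [add_apply]; ring)
    (fun c v w => by
      rw [← map_smul]; congr 1; ext z
      generalize fderiv ℝ g y = D
      rw [smul_apply, christoffelForm_apply, christoffelForm_apply, D.map_smul, (D v).map_smul,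
        (D z v).map_smul]
      simp only [smul_apply, smul_eq_mul]; ring))

theorem christoffel_apply (g : E → E →L[ℝ] E →L[ℝ] ℝ) (y v w : E) :
    christoffel g y v w = (g y).inverse (christoffelForm (fderiv ℝ g y) v w) := rfl

variable {g : E → E →L[ℝ] E →L[ℝ] ℝ} {y : E}

theorem isInvertible_of_pos (h : ∀ v, v ≠ 0 → 0 < g y v v) : (g y).IsInvertible := by
  have hinj : Function.Injective (g y) := by
    rw [injective_iff_map_eq_zero]
    intro v hv
    by_contra hne
    have := h v hne
    rw [hv] at this
    simp at this
  have hfin : Module.finrank ℝ E = Module.finrank ℝ (E →L[ℝ] ℝ) := by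
    rw [← (LinearMap.toContinuousLinearMap (𝕜 := ℝ) (E := E) (F' := ℝ)).finrank_eq]
    exact (Subspace.dual_finrank_eq (K := ℝ) (V := E)).symm
  exact ⟨(LinearEquiv.ofInjectiveOfFinrankEq (g y).toLinearMap hinj hfin).toContinuousLinearEquiv,
    by ext; rfl⟩

theorem inner_christoffel (h : (g y).IsInvertible) (v w z : E) :
    g y (christoffel g y v w) z
      = (1 / 2 : ℝ) * (fderiv ℝ g y v w z + fderiv ℝ g y w v z - fderiv ℝ g y z v w) := by
  rw [christoffel_apply, ← christoffelForm_apply, h.self_apply_inverse]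

variable {U : Set E}

theorem contDiffOn_christoffel (hU : IsOpen U) (hg : ContDiffOn ℝ ∞ g U)
    (hinv : ∀ y ∈ U, (g y).IsInvertible) : ContDiffOn ℝ ∞ (christoffel g) U := by
  rw [contDiffOn_clm_apply]
  intro v
  rw [contDiffOn_clm_apply]
  intro w
  simp only [christoffel_apply]
  refine ContDiffOn.clm_apply (fun y hy => ?_) ?_
  · obtain ⟨e, he⟩ := hinv y hy
    have h1 := contDiffAt_map_inverse (n := ∞) e
    rw [he] at h1
    exact h1.comp_contDiffWithinAt y (hg y hy)
  · have hd : ∀ a b c : E, ContDiffOn ℝ ∞ (fun y => fderiv ℝ g y a b c) U := fun a b c => by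
      have h1 : ContDiffOn ℝ ∞ (fun y => g y b c) U :=
        (hg.clm_apply contDiffOn_const).clm_apply contDiffOn_const
      have h2 : ContDiffOn ℝ ∞ (fun y => fderiv ℝ (fun y => g y b c) y a) U :=
        (h1.fderiv_of_isOpen hU (m := ∞) (by norm_num)).clm_apply contDiffOn_const
      refine h2.congr fun y hy => ?_
      rw [fderiv_apply_const₂ ((hg.contDiffAt (hU.mem_nhds hy)).differentiableAt (by simp))]
    rw [contDiffOn_clm_apply]
    intro z
    simp only [christoffelForm_apply]
    exact contDiffOn_const.mul (((hd _ _ _).add (hd _ _ _)).sub (hd _ _ _))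

theorem fderiv_metric_symm (hg : DifferentiableAt ℝ g y) (hs : ∀ᶠ z in 𝓝 y, ∀ v w, g z v w = g z w v)
    (u v w : E) : fderiv ℝ g y u v w = fderiv ℝ g y u w v := by
  rw [← fderiv_apply_const₂ hg, ← fderiv_apply_const₂ hg,
    Filter.EventuallyEq.fderiv_eq (hs.mono fun z hz => hz v w)]

theorem christoffel_symm (hg : DifferentiableAt ℝ g y) (hs : ∀ᶠ z in 𝓝 y, ∀ v w, g z v w = g z w v)
    (v w : E) : christoffel g y v w = christoffel g y w v := by
  rw [christoffel_apply, christoffel_apply]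
  congr 1
  ext z
  rw [christoffelForm_apply, christoffelForm_apply, fderiv_metric_symm hg hs z v w]
  ring

/-- The Christoffel symbols define a metric connection. -/
theorem fderiv_metric_eq_christoffel (hg : DifferentiableAt ℝ g y)
    (hs : ∀ᶠ z in 𝓝 y, ∀ v w, g z v w = g z w v) (h : (g y).IsInvertible) (u v w : E) :
    fderiv ℝ g y u v w = g y (christoffel g y u v) w + g y v (christoffel g y u w) := by
  rw [hs.self_of_nhds v, inner_christoffel h, inner_christoffel h, fderiv_metric_symm hg hs u w v,
    fderiv_metric_symm hg hs v u w, fderiv_metric_symm hg hs w u v]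
  ring

end Christoffel

/-! ### A Riemannian manifold in a chart -/

noncomputable section RiemannianChart

variable {E : Type*} [NormedAddCommGroup E] [NormedSpace ℝ E] [FiniteDimensional ℝ E]
  [CompleteSpace E]
  {H : Type*} [TopologicalSpace H] {I : ModelWithCorners ℝ E H} [I.Boundaryless]
  {M : Type*} [TopologicalSpace M] [ChartedSpace H M] [IsManifold I ∞ M]
  [RiemannianBundle (fun x : M => TangentSpace I x)]
  [IsContMDiffRiemannianBundle I ∞ E (fun x : M => TangentSpace I x)]

variable (I) in
/-- The metric at `p` in the frame of fields with constant coefficients in the chart at `x₀`. -/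
def metricCoeff (x₀ p : M) : E →L[ℝ] E →L[ℝ] ℝ :=
  (innerSL ℝ (E := TangentSpace I p)).bilinearComp (chartField I x₀ p) (chartField I x₀ p)

variable (I) in
/-- The metric in the chart at `x₀`. -/
def chartMetric (x₀ : M) (y : E) : E →L[ℝ] E →L[ℝ] ℝ :=
  metricCoeff I x₀ ((extChartAt I x₀).symm y)

theorem chartMetric_extChartAt {x₀ p : M} (hp : p ∈ (chartAt H x₀).source) (v w : E) :
    chartMetric I x₀ (extChartAt I x₀ p) v w
      = inner ℝ (chartField I x₀ p v) (chartField I x₀ p w) := by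
  rw [chartMetric, (extChartAt I x₀).left_inv (by simpa using hp)]
  rfl

theorem contDiffOn_comp_extChartAt_symm {G : Type*} [NormedAddCommGroup G] [NormedSpace ℝ G]
    {x₀ : M} {ψ : M → G} (h : ∀ p ∈ (chartAt H x₀).source, ContMDiffAt I 𝓘(ℝ, G) ∞ ψ p) :
    ContDiffOn ℝ ∞ (fun y => ψ ((extChartAt I x₀).symm y)) (extChartAt I x₀).target := by
  rw [← contMDiffOn_iff_contDiffOn]
  intro y hy
  exact (h _ (symm_mem_source hy)).comp_contMDiffWithinAt y (contMDiffOn_extChartAt_symm x₀ y hy)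

theorem contDiffOn_chartMetric (x₀ : M) :
    ContDiffOn ℝ ∞ (chartMetric I x₀) (extChartAt I x₀).target := by
  rw [contDiffOn_clm_apply]
  intro v
  rw [contDiffOn_clm_apply]
  intro w
  refine contDiffOn_comp_extChartAt_symm
    (ψ := fun p => (inner ℝ (chartField I x₀ p v) (chartField I x₀ p w) : ℝ)) fun p hp => ?_
  exact ContMDiffAt.inner_bundle (IB := I) (F := E) (E := fun x : M => TangentSpace I x)
    (b := fun p => p) (contMDiffAt_chartField hp v) (contMDiffAt_chartField hp w)

theorem chartMetric_symm (x₀ : M) (y v w : E) : chartMetric I x₀ y v w = chartMetric I x₀ y w v :=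
  real_inner_comm (F := TangentSpace I ((extChartAt I x₀).symm y)) _ _

theorem isInvertible_chartMetric {x₀ : M} {y : E} (hy : y ∈ (extChartAt I x₀).target) :
    (chartMetric I x₀ y).IsInvertible := by
  refine isInvertible_of_pos fun v hv => ?_
  refine (real_inner_self_pos (F := TangentSpace I ((extChartAt I x₀).symm y))).2 fun h0 => hv ?_
  rw [← chartCoord_chartField (I := I) (symm_mem_source hy) v]
  exact (congrArg _ h0).trans (map_zero _)

theorem differentiableAt_chartMetric {x₀ : M} {y : E} (hy : y ∈ (extChartAt I x₀).target) :
    DifferentiableAt ℝ (chartMetric I x₀) y :=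
  ((contDiffOn_chartMetric x₀).contDiffAt
    ((isOpen_extChartAt_target x₀).mem_nhds hy)).differentiableAt (by simp)

theorem mvfderiv_inner_chartField {x₀ p : M} (hp : p ∈ (chartAt H x₀).source) (u v w : E) :
    d% (fun q => (inner ℝ (chartField I x₀ q v) (chartField I x₀ q w) : ℝ)) p
      (chartField I x₀ p u) = fderiv ℝ (chartMetric I x₀) (extChartAt I x₀ p) u v w := by
  have hd := differentiableAt_chartMetric (extChartAt_mem_target (I := I) hp)
  rw [mvfderiv_chartField hp (φ := fun y => chartMetric I x₀ y v w) ?_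
    ((hd.clm_apply (differentiableAt_const v)).clm_apply (differentiableAt_const w)),
    fderiv_apply_const₂ hd]
  filter_upwards [(chartAt H x₀).open_source.mem_nhds hp] with q hq
  rw [chartMetric_extChartAt hq]

theorem ext_inner_chartField {x₀ p : M} (hp : p ∈ (chartAt H x₀).source) {a b : TangentSpace I p}
    (h : ∀ z, (inner ℝ a (chartField I x₀ p z) : ℝ) = inner ℝ b (chartField I x₀ p z)) : a = b := by
  refine ext_inner_right ℝ fun w => ?_
  rw [← chartField_chartCoord hp w]
  exact h _

/-- The Levi-Civita connection of fields with constant coefficients is given by the Christoffel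
symbols: the Koszul formula has no bracket terms. -/
theorem leviCivita_chartField {x₀ p : M} (hp : p ∈ (chartAt H x₀).source) (v w : E) :
    leviCivita I M (fun q => chartField I x₀ q w) p (chartField I x₀ p v)
      = chartField I x₀ p (christoffel (chartMetric I x₀) (extChartAt I x₀ p) v w) := by
  refine ext_inner_chartField hp fun z => ?_
  have h := inner_leviCivitaFun (mdifferentiableAt_chartField (I := I) hp w)
    (mdifferentiableAt_chartField (I := I) hp v) (mdifferentiableAt_chartField (I := I) hp z)
  refine h.trans ?_
  rw [← chartMetric_extChartAt hp,
    inner_christoffel (isInvertible_chartMetric (extChartAt_mem_target hp)), koszulForm,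
    mvfderiv_inner_chartField hp, mvfderiv_inner_chartField hp, mvfderiv_inner_chartField hp,
    mlieBracket_chartField hp, mlieBracket_chartField hp, mlieBracket_chartField hp]
  simp

variable (I) in
/-- The coefficients of a vector field in the chart at `x₀`. -/
def fieldInChart (x₀ : M) (σ : Π x : M, TangentSpace I x) (y : E) : E :=
  chartCoord I x₀ ((extChartAt I x₀).symm y) (σ ((extChartAt I x₀).symm y))

theorem fieldInChart_extChartAt {x₀ p : M} (hp : p ∈ (chartAt H x₀).source)
    (σ : Π x : M, TangentSpace I x) :
    fieldInChart I x₀ σ (extChartAt I x₀ p) = chartCoord I x₀ p (σ p) := by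
  rw [fieldInChart, (extChartAt I x₀).left_inv (by simpa using hp)]

theorem fderiv_chartMetric {x₀ p : M} (hp : p ∈ (chartAt H x₀).source) (u v w : E) :
    fderiv ℝ (chartMetric I x₀) (extChartAt I x₀ p) u v w
      = chartMetric I x₀ (extChartAt I x₀ p)
          (christoffel (chartMetric I x₀) (extChartAt I x₀ p) u v) w
        + chartMetric I x₀ (extChartAt I x₀ p) v
          (christoffel (chartMetric I x₀) (extChartAt I x₀ p) u w) :=
  have ht := extChartAt_mem_target (I := I) hp
  fderiv_metric_eq_christoffel (differentiableAt_chartMetric ht)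
    (Filter.Eventually.of_forall fun y => chartMetric_symm x₀ y) (isInvertible_chartMetric ht) u v w

/-- The Levi-Civita connection in a chart. -/
theorem leviCivita_eq_chartField {x₀ p : M} (hp : p ∈ (chartAt H x₀).source)
    {σ : Π x : M, TangentSpace I x} (hσ : MDiffAt (T% σ) p)
    (hσ' : DifferentiableAt ℝ (fieldInChart I x₀ σ) (extChartAt I x₀ p)) (u : E) :
    leviCivita I M σ p (chartField I x₀ p u) = chartField I x₀ p
      (fderiv ℝ (fieldInChart I x₀ σ) (extChartAt I x₀ p) u
        + christoffel (chartMetric I x₀) (extChartAt I x₀ p) u (chartCoord I x₀ p (σ p))) := by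
  refine ext_inner_chartField hp fun z => ?_
  have hd := differentiableAt_chartMetric (extChartAt_mem_target (I := I) hp)
  have h1 := leviCivita_isMetric p σ _ hσ (mdifferentiableAt_chartField (I := I) hp z)
    (chartField I x₀ p u)
  rw [leviCivita_chartField hp, mvfderiv_chartField hp
    (φ := fun y => chartMetric I x₀ y (fieldInChart I x₀ σ y) z) ?_
    ((hd.clm_apply hσ').clm_apply (differentiableAt_const z)),
    fderiv_clm_apply₂ hd hσ' (differentiableAt_const z), fieldInChart_extChartAt hp,
    fderiv_chartMetric hp] at h1
  · have h2 : (inner ℝ (σ p) (chartField I x₀ p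
        (christoffel (chartMetric I x₀) (extChartAt I x₀ p) u z)) : ℝ)
        = chartMetric I x₀ (extChartAt I x₀ p) (chartCoord I x₀ p (σ p))
          (christoffel (chartMetric I x₀) (extChartAt I x₀ p) u z) := by
      rw [chartMetric_extChartAt hp, chartField_chartCoord hp]
    rw [h2] at h1
    rw [← chartMetric_extChartAt hp, map_add, add_apply]
    simp only [fderiv_fun_const, Pi.zero_apply, zero_apply, map_zero] at h1
    linarith
  · filter_upwards [(chartAt H x₀).open_source.mem_nhds hp] with q hq
    rw [fieldInChart_extChartAt hq, chartMetric_extChartAt hq, chartField_chartCoord hq]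

end RiemannianChart

/-! ### A nearly Kähler structure in a chart -/

noncomputable section NearlyKahlerChart

namespace AlmostHermitianStructure

variable {E : Type*} [NormedAddCommGroup E] [NormedSpace ℝ E] [FiniteDimensional ℝ E]
  [CompleteSpace E]
  {H : Type*} [TopologicalSpace H] {I : ModelWithCorners ℝ E H} [I.Boundaryless]
  {M : Type*} [TopologicalSpace M] [ChartedSpace H M] [IsManifold I ∞ M]
  [RiemannianBundle (fun x : M => TangentSpace I x)]
  [IsContMDiffRiemannianBundle I ∞ E (fun x : M => TangentSpace I x)]
  (S : AlmostHermitianStructure I M)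

/-- The almost complex structure in the chart at `x₀`. -/
def chartJ (x₀ : M) (y : E) : E →L[ℝ] E :=
  (chartCoord I x₀ ((extChartAt I x₀).symm y)).comp
    ((S.J ((extChartAt I x₀).symm y)).comp (chartField I x₀ ((extChartAt I x₀).symm y)))

theorem chartField_chartJ {x₀ p : M} (hp : p ∈ (chartAt H x₀).source) (v : E) :
    chartField I x₀ p (S.chartJ x₀ (extChartAt I x₀ p) v) = S.J p (chartField I x₀ p v) := by
  rw [chartJ, (extChartAt I x₀).left_inv (by simpa using hp)]
  exact chartField_chartCoord hp _

theorem contMDiffAt_J_chartField {x₀ p : M} (hp : p ∈ (chartAt H x₀).source) (v : E) :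
    ContMDiffAt I I.tangent ∞ (T% (fun q => S.J q (chartField I x₀ q v))) p :=
  ContMDiffAt.clm_bundle_apply (F₁ := E) (F₂ := E)
    (E₁ := fun x : M => TangentSpace I x) (E₂ := fun x : M => TangentSpace I x) (b := fun p => p)
    (S.smooth p) (contMDiffAt_chartField hp v)

theorem contDiffOn_chartJ (x₀ : M) : ContDiffOn ℝ ∞ (S.chartJ x₀) (extChartAt I x₀).target := by
  rw [contDiffOn_clm_apply]
  intro v
  exact contDiffOn_comp_extChartAt_symm
    (ψ := fun p => chartCoord I x₀ p (S.J p (chartField I x₀ p v)))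
    fun p hp => (contMDiffAt_field_iff hp _).1 (S.contMDiffAt_J_chartField hp v)

theorem differentiableAt_chartJ {x₀ : M} {y : E} (hy : y ∈ (extChartAt I x₀).target) :
    DifferentiableAt ℝ (S.chartJ x₀) y :=
  ((S.contDiffOn_chartJ x₀).contDiffAt
    ((isOpen_extChartAt_target x₀).mem_nhds hy)).differentiableAt (by simp)

/-- The covariant derivative of `J` in a chart. -/
theorem nablaJ_chartField {x₀ p : M} (hp : p ∈ (chartAt H x₀).source) (u v : E) :
    S.nablaJ p (chartField I x₀ p u) (chartField I x₀ p v)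
      = chartField I x₀ p (covDerivEnd (christoffel (chartMetric I x₀)) (S.chartJ x₀)
          (extChartAt I x₀ p) u v) := by
  have hy := extChartAt_mem_target (I := I) hp
  have hd := S.differentiableAt_chartJ hy
  have h1 := S.nablaJ_apply (mdifferentiableAt_chartField (I := I) hp v) (chartField I x₀ p u)
  have h2 := leviCivita_eq_chartField hp
    ((S.contMDiffAt_J_chartField hp v).mdifferentiableAt (by simp))
    (hd.clm_apply (differentiableAt_const v)) u
  have h3 : fderiv ℝ (fieldInChart I x₀ fun q => S.J q (chartField I x₀ q v)) (extChartAt I x₀ p) u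
      = fderiv ℝ (S.chartJ x₀) (extChartAt I x₀ p) u v := fderiv_apply_const hd v u
  have h4 : chartCoord I x₀ p (S.J p (chartField I x₀ p v))
      = S.chartJ x₀ (extChartAt I x₀ p) v := by
    rw [← S.chartField_chartJ hp, chartCoord_chartField hp]
  rw [h3, h4] at h2
  rw [h1, h2, leviCivita_chartField hp, ← S.chartField_chartJ hp, ← map_sub, covDerivEnd_apply]
  simp only [add_apply, sub_apply, mul_apply_eq_comp]

/-- In a chart, a nearly Kähler structure is a local nearly Kähler structure on the model space. -/
theorem IsNearlyKahler.isLocalNearlyKahler {S : AlmostHermitianStructure I M}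
    (hS : S.IsNearlyKahler) {x₀ p : M} (hp : p ∈ (chartAt H x₀).source) :
    IsLocalNearlyKahler (chartMetric I x₀) (S.chartJ x₀) (christoffel (chartMetric I x₀))
      (extChartAt I x₀ p) := by
  have hy := extChartAt_mem_target (I := I) hp
  have ho := (isOpen_extChartAt_target (I := I) x₀).mem_nhds hy
  have key : ∀ P : E → Prop, (∀ q ∈ (chartAt H x₀).source, P (extChartAt I x₀ q)) →
      ∀ᶠ z in 𝓝 (extChartAt I x₀ p), P z := fun P hP => by
    filter_upwards [ho] with z hz
    have := hP _ (symm_mem_source hz)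
    rwa [(extChartAt I x₀).right_inv hz] at this
  have hinj : ∀ {q : M}, q ∈ (chartAt H x₀).source → ∀ {a b : E},
      chartField I x₀ q a = chartField I x₀ q b → a = b := fun hq a b hab => by
    rw [← chartCoord_chartField (I := I) hq a, hab, chartCoord_chartField hq]
  refine ⟨((contDiffOn_chartMetric x₀).contDiffAt ho).of_le (by norm_cast),
    ((S.contDiffOn_chartJ x₀).contDiffAt ho).of_le (by norm_cast), ?_,
    Filter.Eventually.of_forall fun y => chartMetric_symm x₀ y, key _ fun q hq => ?_,
    key _ fun q hq v w => ?_, key _ fun q hq v w => ?_, key _ fun q hq => fderiv_chartMetric hq,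
    key _ fun q hq u => ?_⟩
  · exact ((contDiffOn_christoffel (isOpen_extChartAt_target x₀) (contDiffOn_chartMetric x₀)
      fun y hy => isInvertible_chartMetric hy).contDiffAt ho).of_le (by norm_cast)
  · ext v
    refine hinj hq ?_
    rw [mul_apply_eq_comp, S.chartField_chartJ hq, S.chartField_chartJ hq, S.sq]
    simp
  · rw [chartMetric_extChartAt hq, chartMetric_extChartAt hq, S.chartField_chartJ hq,
      S.chartField_chartJ hq, S.isometry]
  · exact christoffel_symm (differentiableAt_chartMetric (extChartAt_mem_target hq))
      (Filter.Eventually.of_forall fun y => chartMetric_symm x₀ y) v w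
  · refine hinj hq ?_
    rw [← S.nablaJ_chartField hq, hS, map_zero]

theorem IsStrictNearlyKahler.covDerivEnd_ne_zero {S : AlmostHermitianStructure I M}
    (hS : S.IsStrictNearlyKahler) {x₀ p : M} (hp : p ∈ (chartAt H x₀).source) {v : E} (hv : v ≠ 0) :
    covDerivEnd (christoffel (chartMetric I x₀)) (S.chartJ x₀) (extChartAt I x₀ p) v ≠ 0 := by
  intro h0
  refine hS.2 p (chartField I x₀ p v) (fun h => hv ?_) ?_
  · rw [← chartCoord_chartField (I := I) hp v, h, map_zero]
  · ext w
    rw [← chartField_chartCoord hp w, S.nablaJ_chartField hp, h0]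
    exact map_zero _

end AlmostHermitianStructure

end NearlyKahlerChart

/-! ### Vector fields along a map, in charts -/

noncomputable section AlongChart

variable {E : Type*} [NormedAddCommGroup E] [NormedSpace ℝ E]
  {H : Type*} [TopologicalSpace H] {I : ModelWithCorners ℝ E H}
  {M : Type*} [TopologicalSpace M] [ChartedSpace H M] [IsManifold I ∞ M]
  {E' : Type*} [NormedAddCommGroup E'] [NormedSpace ℝ E']
  {H' : Type*} [TopologicalSpace H'] {I' : ModelWithCorners ℝ E' H'} [I'.Boundaryless]
  {L : Type*} [TopologicalSpace L] [ChartedSpace H' L] [IsManifold I' ∞ L] {f : L → M} {x : L}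

theorem eventually_extChartAt {P : E' → Prop} (h : ∀ᶠ p in 𝓝 x, P (extChartAt I' x p)) :
    ∀ᶠ z in 𝓝 (extChartAt I' x x), P z := by
  rw [← map_extChartAt_nhds_of_boundaryless (I := I') x]
  exact h

theorem contDiffAt_comp_extChartAt_symm {G : Type*} [NormedAddCommGroup G] [NormedSpace ℝ G]
    {ψ : L → G} {p : L} (hp : p ∈ (chartAt H' x).source) (h : ContMDiffAt I' 𝓘(ℝ, G) ∞ ψ p) :
    ContDiffAt ℝ ∞ (fun y => ψ ((extChartAt I' x).symm y)) (extChartAt I' x p) := by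
  rw [← contMDiffAt_iff_contDiffAt]
  refine ContMDiffAt.comp (I' := I') (g := ψ) _ ?_
    ((contMDiffOn_extChartAt_symm x).contMDiffAt
      ((isOpen_extChartAt_target x).mem_nhds (extChartAt_mem_target hp)))
  rwa [(extChartAt I' x).left_inv (by simpa using hp)]

theorem eventually_mem_chart_source (hf : ContinuousAt f x) :
    ∀ᶠ p in 𝓝 x, p ∈ (chartAt H' x).source ∧ f p ∈ (chartAt H (f x)).source :=
  Filter.Eventually.and ((chartAt H' x).open_source.mem_nhds (mem_chart_source H' x))
    (hf.preimage_mem_nhds ((chartAt H (f x)).open_source.mem_nhds (mem_chart_source H (f x))))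

theorem writtenInExtChartAt_extChartAt_self {p : L} (hp : p ∈ (chartAt H' x).source) :
    writtenInExtChartAt I' I x f (extChartAt I' x p) = extChartAt I (f x) (f p) := by
  simp only [writtenInExtChartAt, Function.comp_apply]
  rw [(extChartAt I' x).left_inv (by simpa using hp)]

theorem contDiffAt_writtenInExtChartAt (hf : ContMDiff I' I ∞ f) {p : L}
    (hp : p ∈ (chartAt H' x).source) (hfp : f p ∈ (chartAt H (f x)).source) :
    ContDiffAt ℝ ∞ (writtenInExtChartAt I' I x f) (extChartAt I' x p) :=
  contDiffAt_comp_extChartAt_symm (ψ := fun q => extChartAt I (f x) (f q)) hp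
    ((contMDiffAt_extChartAt' hfp).comp p (hf p))

/-- The differential of a map in charts. -/
theorem mfderiv_chartField (hf : ContMDiff I' I ∞ f) {p : L}
    (hp : p ∈ (chartAt H' x).source) (hfp : f p ∈ (chartAt H (f x)).source) (u : E') :
    mfderiv I' I f p (chartField I' x p u) = chartField I (f x) (f p)
      (fderiv ℝ (writtenInExtChartAt I' I x f) (extChartAt I' x p) u) := by
  have hF := (contDiffAt_writtenInExtChartAt hf hp hfp).differentiableAt (by simp)
  have h := mvfderiv_chartField (I := I') hp (ψ := fun q => extChartAt I (f x) (f q))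
    (φ := writtenInExtChartAt I' I x f) ?_ hF u
  · rw [← h, ← chartField_chartCoord hfp (mfderiv I' I f p _), chartCoord_eq_mfderiv hfp]
    congr 1
    exact (congr($(mfderiv_comp p (mdifferentiableAt_extChartAt hfp)
      ((hf p).mdifferentiableAt (by simp))) _)).symm
  · filter_upwards [(chartAt H' x).open_source.mem_nhds hp] with q hq
    exact (writtenInExtChartAt_extChartAt_self hq).symm

theorem mfderiv_eq_chartField (hf : ContMDiff I' I ∞ f) {p : L}
    (hp : p ∈ (chartAt H' x).source) (hfp : f p ∈ (chartAt H (f x)).source)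
    (v : TangentSpace I' p) :
    mfderiv I' I f p v = chartField I (f x) (f p)
      (fderiv ℝ (writtenInExtChartAt I' I x f) (extChartAt I' x p)
        (chartCoord I' x p v)) := by
  rw [← mfderiv_chartField hf hp hfp, chartField_chartCoord hp]

variable (I I') in
/-- The coefficients of a vector field along `f`, in the charts at `x` and `f x`. -/
def alongInChart (f : L → M) (x : L) (σ : Π p : L, TangentSpace I (f p)) (y : E') : E :=
  chartCoord I (f x) (f ((extChartAt I' x).symm y)) (σ ((extChartAt I' x).symm y))

theorem alongInChart_extChartAt {p : L} (hp : p ∈ (chartAt H' x).source)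
    (σ : Π p : L, TangentSpace I (f p)) :
    alongInChart I I' f x σ (extChartAt I' x p) = chartCoord I (f x) (f p) (σ p) := by
  rw [alongInChart, (extChartAt I' x).left_inv (by simpa using hp)]

theorem chartField_alongInChart {p : L} (hp : p ∈ (chartAt H' x).source)
    (hfp : f p ∈ (chartAt H (f x)).source) (σ : Π p : L, TangentSpace I (f p)) :
    chartField I (f x) (f p) (alongInChart I I' f x σ (extChartAt I' x p)) = σ p := by
  rw [alongInChart_extChartAt hp, chartField_chartCoord hfp]

theorem contDiffAt_alongInChart {σ : Π p : L, TangentSpace I (f p)}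
    (hσ : ContMDiffAt I' I.tangent ∞ (fun p => (⟨f p, σ p⟩ : TangentBundle I M)) x) :
    ContDiffAt ℝ ∞ (alongInChart I I' f x σ) (extChartAt I' x x) :=
  contDiffAt_comp_extChartAt_symm (ψ := fun p => chartCoord I (f x) (f p) (σ p))
    (mem_chart_source _ x) ((contMDiffAt_along_iff (mem_chart_source H (f x)) σ).1 hσ).2

theorem contMDiffAt_along_of_eventuallyEq (hf : ContMDiff I' I ∞ f)
    {σ : Π p : L, TangentSpace I (f p)} {s : E' → E}
    (hs : ContDiffAt ℝ ∞ s (extChartAt I' x x))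
    (h : ∀ᶠ p in 𝓝 x, σ p = chartField I (f x) (f p) (s (extChartAt I' x p))) :
    ContMDiffAt I' I.tangent ∞ (fun p => (⟨f p, σ p⟩ : TangentBundle I M)) x := by
  rw [contMDiffAt_along_iff (mem_chart_source H (f x))]
  refine ⟨hf x, ?_⟩
  have h1 : ContMDiffAt I' 𝓘(ℝ, E) ∞ (fun p => s (extChartAt I' x p)) x :=
    (contMDiffAt_iff_contDiffAt.2 hs).comp x contMDiffAt_extChartAt
  refine h1.congr_of_eventuallyEq ?_
  filter_upwards [h, eventually_mem_chart_source (H := H) (H' := H') (hf x).continuousAt] with p hp hp'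
  rw [hp, chartCoord_chartField hp'.2]

/-- The image under `df` of a vector field with constant coefficients is smooth. -/
theorem contMDiffAt_mfderiv_chartField (hf : ContMDiff I' I ∞ f) (u : E') :
    ContMDiffAt I' I.tangent ∞
      (fun p => (⟨f p, mfderiv I' I f p (chartField I' x p u)⟩ : TangentBundle I M)) x := by
  refine contMDiffAt_along_of_eventuallyEq hf
    (s := fun y => fderiv ℝ (writtenInExtChartAt I' I x f) y u) ?_ ?_
  · exact ((contDiffAt_writtenInExtChartAt hf (mem_chart_source _ x)
      (mem_chart_source H (f x))).fderiv_right (m := ∞) (by norm_num)).clm_apply contDiffAt_const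
  · filter_upwards [eventually_mem_chart_source (H := H) (H' := H') (hf x).continuousAt] with p hp
    exact mfderiv_chartField hf hp.1 hp.2 u

end AlongChart

/-! ### The pull-back connection in charts -/

noncomputable section PullbackChart

variable {E : Type*} [NormedAddCommGroup E] [NormedSpace ℝ E] [FiniteDimensional ℝ E]
  [CompleteSpace E]
  {H : Type*} [TopologicalSpace H] {I : ModelWithCorners ℝ E H}
  {M : Type*} [TopologicalSpace M] [ChartedSpace H M] [IsManifold I ∞ M]
  {n : ℕ} {L : Type*} [TopologicalSpace L] [ChartedSpace (EuclideanSpace ℝ (Fin n)) L]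
  [IsManifold (𝓡 n) ∞ L] {f : L → M} {x : L}

theorem localFrame_trivializationAt {ι : Type*} (b : Module.Basis ι ℝ E) (x₀ : M) (i : ι) :
    (trivializationAt E (fun x : M => TangentSpace I x) x₀).localFrame b i
      = fun p => chartField I x₀ p (b i) := by
  ext p
  by_cases hp : p ∈ (trivializationAt E (fun x : M => TangentSpace I x) x₀).baseSet
  · rw [Trivialization.localFrame_apply_of_mem_baseSet _ _ hp, chartField,
      Trivialization.symmL_apply _ hp]
    simp [Trivialization.basisAt]
  · rw [Trivialization.localFrame_apply_of_notMem _ _ hp]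
    have h0 : (trivializationAt E (fun x : M => TangentSpace I x) x₀).symmₗ ℝ p = 0 := dif_neg hp
    exact (DFunLike.congr_fun h0 (b i)).symm

theorem localFrameCoeff_trivializationAt {ι : Type*} (b : Module.Basis ι ℝ E) {x₀ p : M}
    (hp : p ∈ (chartAt H x₀).source) (i : ι) (w : TangentSpace I p) :
    (trivializationAt E (fun x : M => TangentSpace I x) x₀).localFrameCoeff I b i p w
      = b.repr (chartCoord I x₀ p w) i := by
  have h := Trivialization.localFrameCoeff_eq_coeff (I := I) (b := b)
    (hxe := mem_baseSet_of_mem_chart_source (I := I) hp)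
    (s := (extend E w : Π x : M, TangentSpace I x)) (i := i)
  simp only [extend_apply_self] at h
  rw [h, chartCoord_eq_snd hp]

/-- The pull-back connection in terms of the coefficients of a field along `f` in a chart. The linear
map `A` is the zeroth order part: it differentiates the fields with constant coefficients. -/
theorem pullbackConnection_eq_chartField
    (D : CovariantDerivative I E (fun x : M => TangentSpace I x))
    {σ : Π p : L, TangentSpace I (f p)}
    (hσ : ContMDiffAt (𝓡 n) I.tangent ∞ (fun p => (⟨f p, σ p⟩ : TangentBundle I M)) x)
    (v : TangentSpace (𝓡 n) x) (A : E →L[ℝ] TangentSpace I (f x))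
    (hA : ∀ w, D (fun p => chartField I (f x) p w) (f x) (mfderiv (𝓡 n) I f x v) = A w) :
    pullbackConnection D f σ x v = chartField I (f x) (f x)
        (fderiv ℝ (alongInChart I (𝓡 n) f x σ) (extChartAt (𝓡 n) x x) (chartCoord (𝓡 n) x x v))
      + A (chartCoord I (f x) (f x) (σ x)) := by
  classical
  set b := Module.finBasis ℝ E with hb
  have hx := mem_chart_source H (f x)
  have hσ' := (contDiffAt_alongInChart hσ).differentiableAt (by simp)
  have h1 : ∀ i, mvfderiv (𝓡 n) (fun p => (trivializationAt E (fun x : M => TangentSpace I x)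
      (f x)).localFrameCoeff I b i (f p) (σ p)) x v
      = b.repr (fderiv ℝ (alongInChart I (𝓡 n) f x σ) (extChartAt (𝓡 n) x x)
        (chartCoord (𝓡 n) x x v)) i := fun i => by
    have hcl : ∀ w, b.repr w i = (b.coord i).toContinuousLinearMap w := fun w => rfl
    rw [← chartField_chartCoord (mem_chart_source (EuclideanSpace ℝ (Fin n)) x) v,
      mvfderiv_chartField (mem_chart_source (EuclideanSpace ℝ (Fin n)) x)
        (φ := fun y => (b.coord i).toContinuousLinearMap (alongInChart I (𝓡 n) f x σ y)) ?_
        ((ContinuousLinearMap.differentiableAt _).comp _ hσ'),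
      chartField_chartCoord (mem_chart_source (EuclideanSpace ℝ (Fin n)) x), hcl]
    · exact congr($(((b.coord i).toContinuousLinearMap.hasFDerivAt.comp _
        hσ'.hasFDerivAt).fderiv) _)
    · filter_upwards [eventually_mem_chart_source (H := H) (H' := EuclideanSpace ℝ (Fin n))
        ((contMDiffAt_along_iff hx σ).1 hσ).1.continuousAt] with p hp
      rw [localFrameCoeff_trivializationAt b hp.2, alongInChart_extChartAt hp.1, hcl]
  simp only [pullbackConnection, ← hb, h1, localFrameCoeff_trivializationAt b hx,
    localFrame_trivializationAt, hA, Finset.sum_add_distrib, ← map_smul, ← map_sum, b.sum_repr]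

end PullbackChart

/-! ### Lagrangian immersions into nearly Kähler six-manifolds -/

section LagrangianFrame

theorem eq_zero_of_inner_frame_eq_zero {V : Type*} [NormedAddCommGroup V] [InnerProductSpace ℝ V]
    [FiniteDimensional ℝ V] {n : ℕ} (hV : Module.finrank ℝ V = 2 * n) {a b : Fin n → V}
    (ha : Orthonormal ℝ a) (hb : Orthonormal ℝ b) (hab : ∀ i j, (inner ℝ (a i) (b j) : ℝ) = 0)
    {v : V} (hva : ∀ i, (inner ℝ v (a i) : ℝ) = 0) (hvb : ∀ i, (inner ℝ v (b i) : ℝ) = 0) :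
    v = 0 := by
  have ho : Orthonormal ℝ (Sum.elim a b) := by
    classical
    rw [orthonormal_iff_ite] at ha hb ⊢
    rintro (i | i) (j | j)
    · simpa using ha i j
    · simpa using hab i j
    · simpa [real_inner_comm] using hab j i
    · simpa using hb i j
  have hspan := ho.linearIndependent.span_eq_top_of_card_eq_finrank' (by
    rw [hV, Fintype.card_sum, Fintype.card_fin]; ring)
  have hle : Submodule.span ℝ (Set.range (Sum.elim a b)) ≤ (ℝ ∙ v)ᗮ := by
    rw [Submodule.span_le]
    rintro _ ⟨i | i, rfl⟩
    · exact Submodule.mem_orthogonal_singleton_iff_inner_right.2 (hva i)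
    · exact Submodule.mem_orthogonal_singleton_iff_inner_right.2 (hvb i)
  rw [hspan] at hle
  exact inner_self_eq_zero.1
    (Submodule.mem_orthogonal_singleton_iff_inner_right.1 (hle (Submodule.mem_top (x := v))))

end LagrangianFrame

noncomputable section LagrangianImmersion

namespace AlmostHermitianStructure

variable {E : Type*} [NormedAddCommGroup E] [NormedSpace ℝ E] [FiniteDimensional ℝ E]
  [CompleteSpace E]
  {H : Type*} [TopologicalSpace H] {I : ModelWithCorners ℝ E H} [I.Boundaryless]
  {M : Type*} [TopologicalSpace M] [ChartedSpace H M] [IsManifold I ∞ M]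
  [RiemannianBundle (fun x : M => TangentSpace I x)]
  [IsContMDiffRiemannianBundle I ∞ E (fun x : M => TangentSpace I x)]
  {n : ℕ} {L : Type*} [TopologicalSpace L] [ChartedSpace (EuclideanSpace ℝ (Fin n)) L]
  [IsManifold (𝓡 n) ∞ L]
  {S : AlmostHermitianStructure I M} {f : L → M}

theorem orthonormal_J {p : M} {e : Fin n → TangentSpace I p} (he : Orthonormal ℝ e) :
    Orthonormal ℝ fun i => S.J p (e i) := by
  classical
  rw [orthonormal_iff_ite] at he ⊢
  intro i j
  rw [S.isometry]
  exact he i j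

namespace IsLagrangianImmersion

variable (hf : S.IsLagrangianImmersion n f)
include hf

theorem inner_J_mfderiv (x : L) (v w : TangentSpace (𝓡 n) x) :
    (inner ℝ (S.J (f x) (mfderiv (𝓡 n) I f x v)) (mfderiv (𝓡 n) I f x w) : ℝ) = 0 :=
  hf.omega_eq_zero x v w

/-- The Lagrangian condition in charts. -/
theorem eventually_chartMetric_J (x : L) :
    ∀ᶠ z in 𝓝 (extChartAt (𝓡 n) x x), ∀ u v,
      chartMetric I (f x) (writtenInExtChartAt (𝓡 n) I x f z)
        (S.chartJ (f x) (writtenInExtChartAt (𝓡 n) I x f z)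
          (fderiv ℝ (writtenInExtChartAt (𝓡 n) I x f) z u))
        (fderiv ℝ (writtenInExtChartAt (𝓡 n) I x f) z v) = 0 := by
  refine eventually_extChartAt ?_
  filter_upwards [eventually_mem_chart_source (H := H) (H' := EuclideanSpace ℝ (Fin n))
    (hf.contMDiff x).continuousAt] with p hp u v
  rw [writtenInExtChartAt_extChartAt_self hp.1, chartMetric_extChartAt hp.2,
    S.chartField_chartJ hp.2, ← mfderiv_chartField hf.contMDiff hp.1 hp.2,
    ← mfderiv_chartField hf.contMDiff hp.1 hp.2]
  exact hf.inner_J_mfderiv p _ _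

/-- The `3`-form `g((∇_u J) v, w)` of a nearly Kähler manifold vanishes on Lagrangian
submanifolds. -/
theorem inner_nablaJ_mfderiv (hS : S.IsNearlyKahler) (x : L) (u v w : TangentSpace (𝓡 n) x) :
    (inner ℝ (S.nablaJ (f x) (mfderiv (𝓡 n) I f x u) (mfderiv (𝓡 n) I f x v))
      (mfderiv (𝓡 n) I f x w) : ℝ) = 0 := by
  have hx := mem_chart_source (EuclideanSpace ℝ (Fin n)) x
  have hfx := mem_chart_source H (f x)
  have h := hS.isLocalNearlyKahler hfx
  rw [← writtenInExtChartAt_extChartAt_self (I' := 𝓡 n) hx] at h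
  have h1 := h.inner_covDerivEnd_lagrangian
    ((contDiffAt_writtenInExtChartAt hf.contMDiff hx hfx).of_le (by norm_cast))
    (hf.eventually_chartMetric_J x) (chartCoord (𝓡 n) x x u) (chartCoord (𝓡 n) x x v)
    (chartCoord (𝓡 n) x x w)
  rw [writtenInExtChartAt_extChartAt_self hx, chartMetric_extChartAt hfx] at h1
  rwa [mfderiv_eq_chartField hf.contMDiff hx hfx, mfderiv_eq_chartField hf.contMDiff hx hfx,
    mfderiv_eq_chartField hf.contMDiff hx hfx, S.nablaJ_chartField hfx]

/-- An orthonormal frame `e` of a Lagrangian subspace and `J e` together span the tangent space. -/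
theorem eq_zero_of_inner_eq_zero {x : L} {e : Fin n → TangentSpace I (f x)}
    (he : Orthonormal ℝ e)
    (her : ∀ i, e i ∈ LinearMap.range (mfderiv (𝓡 n) I f x).toLinearMap) {v : TangentSpace I (f x)}
    (h1 : ∀ i, (inner ℝ v (e i) : ℝ) = 0) (h2 : ∀ i, (inner ℝ v (S.J (f x) (e i)) : ℝ) = 0) :
    v = 0 := by
  refine eq_zero_of_inner_frame_eq_zero (V := TangentSpace I (f x)) hf.finrank_eq he
    (orthonormal_J he) (fun i j => ?_) h1 h2
  obtain ⟨a, ha⟩ := her i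
  obtain ⟨b, hb⟩ := her j
  rw [← ha, ← hb, real_inner_comm]
  exact hf.inner_J_mfderiv x b a

end IsLagrangianImmersion

/-- The pull-back of the Levi-Civita connection in charts. -/
theorem pullbackConnection_leviCivita (hf : ContMDiff (𝓡 n) I ∞ f) {x : L}
    {σ : Π p : L, TangentSpace I (f p)}
    (hσ : ContMDiffAt (𝓡 n) I.tangent ∞ (fun p => (⟨f p, σ p⟩ : TangentBundle I M)) x)
    (v : TangentSpace (𝓡 n) x) :
    pullbackConnection (leviCivita I M) f σ x v = chartField I (f x) (f x)
      (covDerivAlong (christoffel (chartMetric I (f x))) (writtenInExtChartAt (𝓡 n) I x f)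
        (alongInChart I (𝓡 n) f x σ) (extChartAt (𝓡 n) x x) (chartCoord (𝓡 n) x x v)) := by
  have hx := mem_chart_source (EuclideanSpace ℝ (Fin n)) x
  have hfx := mem_chart_source H (f x)
  rw [pullbackConnection_eq_chartField (leviCivita I M) hσ v
    ((chartField I (f x) (f x)).comp (christoffel (chartMetric I (f x)) (extChartAt I (f x) (f x))
      (fderiv ℝ (writtenInExtChartAt (𝓡 n) I x f) (extChartAt (𝓡 n) x x)
        (chartCoord (𝓡 n) x x v)))) fun w => ?_, covDerivAlong, map_add,
    writtenInExtChartAt_extChartAt_self hx, alongInChart_extChartAt hx]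
  · rfl
  · rw [mfderiv_eq_chartField hf hx hfx, leviCivita_chartField hfx]
    rfl

/-- The canonical connection differs from the Levi-Civita connection by `canonicalTensor`, also after
pull-back. -/
theorem pullbackConnection_canonical (hf : ContMDiff (𝓡 n) I ∞ f) {x : L}
    {σ : Π p : L, TangentSpace I (f p)}
    (hσ : ContMDiffAt (𝓡 n) I.tangent ∞ (fun p => (⟨f p, σ p⟩ : TangentBundle I M)) x)
    (v : TangentSpace (𝓡 n) x) :
    pullbackConnection S.canonicalConnection f σ x v = pullbackConnection (leviCivita I M) f σ x v
      + S.canonicalTensor (f x) (σ x) (mfderiv (𝓡 n) I f x v) := by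
  have hx := mem_chart_source (EuclideanSpace ℝ (Fin n)) x
  have hfx := mem_chart_source H (f x)
  set A : E →L[ℝ] TangentSpace I (f x) :=
    (chartField I (f x) (f x)).comp (christoffel (chartMetric I (f x)) (extChartAt I (f x) (f x))
      (fderiv ℝ (writtenInExtChartAt (𝓡 n) I x f) (extChartAt (𝓡 n) x x)
        (chartCoord (𝓡 n) x x v))) with hA
  have h1 : ∀ w, leviCivita I M (fun p => chartField I (f x) p w) (f x) (mfderiv (𝓡 n) I f x v)
      = A w := fun w => by
    rw [mfderiv_eq_chartField hf hx hfx, leviCivita_chartField hfx]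
    rfl
  rw [pullbackConnection_eq_chartField (leviCivita I M) hσ v A h1,
    pullbackConnection_eq_chartField S.canonicalConnection hσ v
      (A + ((S.canonicalTensor (f x)).flip (mfderiv (𝓡 n) I f x v)).comp
        (chartField I (f x) (f x))) fun w => ?_]
  · have h2 : ∀ B : TangentSpace I (f x) →L[ℝ] TangentSpace I (f x),
        (B.comp (chartField I (f x) (f x))) (chartCoord I (f x) (f x) (σ x)) = B (σ x) :=
      fun B => congrArg B (chartField_chartCoord hfx (σ x))
    rw [add_apply, ← add_assoc, h2, ContinuousLinearMap.flip_apply]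
  · rw [canonicalConnection_apply, h1]
    rfl

end AlmostHermitianStructure

end LagrangianImmersion

/-! ### The trace lemma -/

noncomputable section TraceLemma

namespace AlmostHermitianStructure

variable {E : Type*} [NormedAddCommGroup E] [NormedSpace ℝ E] [FiniteDimensional ℝ E]
  [CompleteSpace E]
  {H : Type*} [TopologicalSpace H] {I : ModelWithCorners ℝ E H} [I.Boundaryless]
  {M : Type*} [TopologicalSpace M] [ChartedSpace H M] [IsManifold I ∞ M]
  [RiemannianBundle (fun x : M => TangentSpace I x)]
  [IsContMDiffRiemannianBundle I ∞ E (fun x : M => TangentSpace I x)]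
  {L : Type*} [TopologicalSpace L] [ChartedSpace (EuclideanSpace ℝ (Fin 3)) L]
  [IsManifold (𝓡 3) ∞ L]
  {S : AlmostHermitianStructure I M} {f : L → M}

namespace IsLagrangianImmersion

theorem span_eq_range {n : ℕ} {L : Type*} [TopologicalSpace L]
    [ChartedSpace (EuclideanSpace ℝ (Fin n)) L] {f : L → M} {x : L}
    (hf : Function.Injective (mfderiv (𝓡 n) I f x)) {e : Fin n → TangentSpace I (f x)}
    (he : LinearIndependent ℝ e)
    (her : ∀ i, e i ∈ LinearMap.range (mfderiv (𝓡 n) I f x).toLinearMap) :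
    Submodule.span ℝ (Set.range e) = LinearMap.range (mfderiv (𝓡 n) I f x).toLinearMap := by
  refine Submodule.eq_of_le_of_finrank_eq (Submodule.span_le.2 ?_) ?_
  · rintro _ ⟨i, rfl⟩
    exact her i
  · rw [finrank_span_eq_card he, Fintype.card_fin, LinearMap.finrank_range_of_inj hf]
    exact (finrank_euclideanSpace_fin (𝕜 := ℝ)).symm

variable (hf : S.IsLagrangianImmersion 3 f)
include hf

theorem isSpecialFrame_chartCoord (hS : S.IsNearlyKahler) {x : L}
    {e : Fin 3 → TangentSpace I (f x)} (he : Orthonormal ℝ e)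
    (her : ∀ i, e i ∈ LinearMap.range (mfderiv (𝓡 3) I f x).toLinearMap) :
    IsSpecialFrame (chartMetric I (f x)) (S.chartJ (f x)) (christoffel (chartMetric I (f x)))
      (extChartAt I (f x) (f x)) fun i => chartCoord I (f x) (f x) (e i) := by
  have hfx := mem_chart_source H (f x)
  have hinner : ∀ i j, (inner ℝ (S.J (f x) (e i)) (e j) : ℝ) = 0 := fun i j => by
    obtain ⟨a, ha⟩ := her i
    obtain ⟨b, hb⟩ := her j
    rw [← ha, ← hb]
    exact hf.inner_J_mfderiv x a b
  refine ⟨fun i => ?_, fun i j hij => ?_, fun i j => ?_, fun i j k => ?_, fun v h1 h2 => ?_⟩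
  · rw [chartMetric_extChartAt hfx, chartField_chartCoord hfx, real_inner_self_eq_norm_sq, he.1,
      one_pow]
  · rw [chartMetric_extChartAt hfx, chartField_chartCoord hfx, chartField_chartCoord hfx]
    exact he.2 hij
  · rw [chartMetric_extChartAt hfx, S.chartField_chartJ hfx, chartField_chartCoord hfx,
      chartField_chartCoord hfx, real_inner_comm]
    exact hinner j i
  · rw [chartMetric_extChartAt hfx, ← S.nablaJ_chartField hfx, chartField_chartCoord hfx,
      chartField_chartCoord hfx, chartField_chartCoord hfx]
    obtain ⟨a, ha⟩ := her i
    obtain ⟨b, hb⟩ := her j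
    obtain ⟨c, hc⟩ := her k
    rw [← ha, ← hb, ← hc]
    exact hf.inner_nablaJ_mfderiv hS x a b c
  · have h0 : chartField I (f x) (f x) v = 0 := by
      refine hf.eq_zero_of_inner_eq_zero he her (fun i => ?_) fun i => ?_
      · have := h1 i
        rwa [chartMetric_extChartAt hfx, chartField_chartCoord hfx] at this
      · have := h2 i
        rwa [chartMetric_extChartAt hfx, S.chartField_chartJ hfx, chartField_chartCoord hfx] at this
    rw [← chartCoord_chartField (I := I) hfx v, h0, map_zero]

/-- The trace of the connection form: for an orthonormal frame `σ` of a Lagrangian submanifold,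
`∑ i, g(∇_v σ i, J σ i) = 0`. -/
theorem sum_inner_pullbackConnection_J (hS : S.IsStrictNearlyKahler) {x : L}
    {σ : Fin 3 → Π p : L, TangentSpace I (f p)}
    (hσ : ∀ i, ContMDiffAt (𝓡 3) I.tangent ∞ (fun p => (⟨f p, σ i p⟩ : TangentBundle I M)) x)
    (hr : ∀ᶠ p in 𝓝 x, ∀ i, σ i p ∈ LinearMap.range (mfderiv (𝓡 3) I f p).toLinearMap)
    (ho : Orthonormal ℝ fun i => σ i x) (v : TangentSpace (𝓡 3) x) :
    ∑ i, (inner ℝ (pullbackConnection (leviCivita I M) f (σ i) x v)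
      (S.J (f x) (σ i x)) : ℝ) = 0 := by
  have hx := mem_chart_source (EuclideanSpace ℝ (Fin 3)) x
  have hfx := mem_chart_source H (f x)
  have h := hS.1.isLocalNearlyKahler hfx
  have hs := hf.isSpecialFrame_chartCoord hS.1 ho hr.self_of_nhds
  have hc : (fun i => chartCoord I (f x) (f x) (σ i x))
      = fun i => alongInChart I (𝓡 3) f x (σ i) (extChartAt (𝓡 3) x x) :=
    funext fun i => (alongInChart_extChartAt hx (σ i)).symm
  rw [hc] at hs
  rw [← writtenInExtChartAt_extChartAt_self (I' := 𝓡 3) hx] at h hs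
  have key := h.sum_inner_covDerivAlong_J_eq_zero
    ((contDiffAt_writtenInExtChartAt hf.contMDiff hx hfx).differentiableAt (by simp))
    (s := fun i => alongInChart I (𝓡 3) f x (σ i))
    (fun i => (contDiffAt_alongInChart (hσ i)).differentiableAt (by simp)) hs ?_ ?_
    (v := chartCoord (𝓡 3) x x v) ?_
  · rw [← key]
    refine Finset.sum_congr rfl fun i _ => ?_
    rw [writtenInExtChartAt_extChartAt_self hx, chartMetric_extChartAt hfx,
      pullbackConnection_leviCivita hf.contMDiff (hσ i) v, S.chartField_chartJ hfx,
      chartField_alongInChart hx hfx]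
  · intro v hv
    rw [writtenInExtChartAt_extChartAt_self hx]
    exact hS.covDerivEnd_ne_zero hfx hv
  · refine eventually_extChartAt ?_
    filter_upwards [hr, eventually_mem_chart_source (H := H) (H' := EuclideanSpace ℝ (Fin 3))
      (hf.contMDiff x).continuousAt] with p hp hp'
    rw [writtenInExtChartAt_extChartAt_self hp'.1, chartMetric_extChartAt hp'.2,
      ← S.nablaJ_chartField hp'.2, chartField_alongInChart hp'.1 hp'.2,
      chartField_alongInChart hp'.1 hp'.2, chartField_alongInChart hp'.1 hp'.2]
    obtain ⟨a, ha⟩ := hp 0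
    obtain ⟨b, hb⟩ := hp 1
    obtain ⟨c, hc⟩ := hp 2
    rw [← ha, ← hb, ← hc]
    exact hf.inner_nablaJ_mfderiv hS.1 p a b c
  · have h1 : mfderiv (𝓡 3) I f x v ∈ Submodule.span ℝ (Set.range fun i => σ i x) := by
      rw [span_eq_range (hf.injective_mfderiv x) ho.linearIndependent hr.self_of_nhds]
      exact ⟨v, rfl⟩
    have h2 := Submodule.mem_map_of_mem (f := (chartCoord I (f x) (f x)).toLinearMap) h1
    rw [Submodule.map_span, ← Set.range_comp] at h2
    rw [← hc]
    have h3 : fderiv ℝ (writtenInExtChartAt (𝓡 3) I x f) (extChartAt (𝓡 3) x x)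
        (chartCoord (𝓡 3) x x v) = chartCoord I (f x) (f x) (mfderiv (𝓡 3) I f x v) := by
      rw [mfderiv_eq_chartField hf.contMDiff hx hfx, chartCoord_chartField hfx]
    rw [h3]
    exact h2

end IsLagrangianImmersion

end AlmostHermitianStructure

end TraceLemma

/-! ### Minimality -/

noncomputable section Minimality

namespace AlmostHermitianStructure

variable {E : Type*} [NormedAddCommGroup E] [NormedSpace ℝ E] [FiniteDimensional ℝ E]
  [CompleteSpace E]
  {H : Type*} [TopologicalSpace H] {I : ModelWithCorners ℝ E H} [I.Boundaryless]
  {M : Type*} [TopologicalSpace M] [ChartedSpace H M] [IsManifold I ∞ M]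
  [RiemannianBundle (fun x : M => TangentSpace I x)]
  [IsContMDiffRiemannianBundle I ∞ E (fun x : M => TangentSpace I x)]
  {n : ℕ} {L : Type*} [TopologicalSpace L] [ChartedSpace (EuclideanSpace ℝ (Fin n)) L]
  [IsManifold (𝓡 n) ∞ L]
  {S : AlmostHermitianStructure I M} {f : L → M}

theorem contMDiffAt_mfderiv_extend (hf : ContMDiff (𝓡 n) I ∞ f) {x : L}
    (w : TangentSpace (𝓡 n) x) :
    ContMDiffAt (𝓡 n) I.tangent ∞ (fun p => (⟨f p, mfderiv (𝓡 n) I f p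
      (extend (EuclideanSpace ℝ (Fin n)) w p)⟩ : TangentBundle I M)) x := by
  refine (contMDiffAt_mfderiv_chartField hf (chartCoord (𝓡 n) x x w)).congr_of_eventuallyEq ?_
  filter_upwards [extend_eventuallyEq_chartField w] with p hp
  rw [hp]

theorem pullbackConnection_mfderiv_extend (hf : ContMDiff (𝓡 n) I ∞ f) {x : L}
    (w v : TangentSpace (𝓡 n) x) :
    pullbackConnection (leviCivita I M) f
        (fun p => mfderiv (𝓡 n) I f p (extend (EuclideanSpace ℝ (Fin n)) w p)) x v
      = chartField I (f x) (f x) (covDerivAlong (christoffel (chartMetric I (f x)))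
          (writtenInExtChartAt (𝓡 n) I x f)
          (fun z => fderiv ℝ (writtenInExtChartAt (𝓡 n) I x f) z (chartCoord (𝓡 n) x x w))
          (extChartAt (𝓡 n) x x) (chartCoord (𝓡 n) x x v)) := by
  have h : alongInChart I (𝓡 n) f x
      (fun p => mfderiv (𝓡 n) I f p (extend (EuclideanSpace ℝ (Fin n)) w p))
      =ᶠ[𝓝 (extChartAt (𝓡 n) x x)]
      fun z => fderiv ℝ (writtenInExtChartAt (𝓡 n) I x f) z (chartCoord (𝓡 n) x x w) := by
    refine eventually_extChartAt ?_
    filter_upwards [extend_eventuallyEq_chartField w, eventually_mem_chart_source (H := H)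
      (H' := EuclideanSpace ℝ (Fin n)) (hf x).continuousAt] with p hp hp'
    rw [alongInChart_extChartAt hp'.1, hp, mfderiv_chartField hf hp'.1 hp'.2,
      chartCoord_chartField hp'.2]
  rw [pullbackConnection_leviCivita hf (contMDiffAt_mfderiv_extend hf w), covDerivAlong,
    covDerivAlong, h.fderiv_eq, h.eq_of_nhds]

/-- The second fundamental form is symmetric. -/
theorem pullbackConnection_mfderiv_extend_symm (hf : ContMDiff (𝓡 n) I ∞ f) {x : L}
    (w v : TangentSpace (𝓡 n) x) :
    pullbackConnection (leviCivita I M) f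
        (fun p => mfderiv (𝓡 n) I f p (extend (EuclideanSpace ℝ (Fin n)) w p)) x v
      = pullbackConnection (leviCivita I M) f
        (fun p => mfderiv (𝓡 n) I f p (extend (EuclideanSpace ℝ (Fin n)) v p)) x w := by
  have hx := mem_chart_source (EuclideanSpace ℝ (Fin n)) x
  have hfx := mem_chart_source H (f x)
  rw [pullbackConnection_mfderiv_extend hf, pullbackConnection_mfderiv_extend hf,
    covDerivAlong_fderiv_symm ((contDiffAt_writtenInExtChartAt hf hx hfx).of_le (by norm_cast))]
  intro a b
  rw [writtenInExtChartAt_extChartAt_self hx]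
  exact christoffel_symm (differentiableAt_chartMetric (extChartAt_mem_target hfx))
    (Filter.Eventually.of_forall fun y => chartMetric_symm (f x) y) a b

namespace IsLagrangianImmersion

/-- The cubic form `g(∇_v df(u), J df(w))` of a Lagrangian submanifold is symmetric. -/
theorem inner_pullbackConnection_J_comm (hf : S.IsLagrangianImmersion n f) (hS : S.IsNearlyKahler)
    {x : L} (u v w : TangentSpace (𝓡 n) x) :
    (inner ℝ (pullbackConnection (leviCivita I M) f
        (fun p => mfderiv (𝓡 n) I f p (extend (EuclideanSpace ℝ (Fin n)) u p)) x v)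
        (S.J (f x) (mfderiv (𝓡 n) I f x w)) : ℝ)
      = inner ℝ (pullbackConnection (leviCivita I M) f
        (fun p => mfderiv (𝓡 n) I f p (extend (EuclideanSpace ℝ (Fin n)) w p)) x v)
        (S.J (f x) (mfderiv (𝓡 n) I f x u)) := by
  have hx := mem_chart_source (EuclideanSpace ℝ (Fin n)) x
  have hfx := mem_chart_source H (f x)
  have h := hS.isLocalNearlyKahler hfx
  rw [← writtenInExtChartAt_extChartAt_self (I' := 𝓡 n) hx] at h
  have h1 := h.inner_covDerivAlong_J_symm
    ((contDiffAt_writtenInExtChartAt hf.contMDiff hx hfx).of_le (by norm_cast))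
    (hf.eventually_chartMetric_J x) (chartCoord (𝓡 n) x x v) (chartCoord (𝓡 n) x x u)
    (chartCoord (𝓡 n) x x w)
  rw [writtenInExtChartAt_extChartAt_self hx, chartMetric_extChartAt hfx,
    chartMetric_extChartAt hfx, S.chartField_chartJ hfx, S.chartField_chartJ hfx] at h1
  rwa [pullbackConnection_mfderiv_extend hf.contMDiff,
    pullbackConnection_mfderiv_extend hf.contMDiff, mfderiv_eq_chartField hf.contMDiff hx hfx w,
    mfderiv_eq_chartField hf.contMDiff hx hfx u]

end IsLagrangianImmersion

theorem inner_normalPart {x : L} {w u : TangentSpace I (f x)}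
    (hu : u ∈ LinearMap.range (mfderiv (𝓡 n) I f x).toLinearMap) :
    (inner ℝ (normalPart I n f x w) u : ℝ) = 0 :=
  Submodule.starProjection_inner_eq_zero _ _ hu

theorem inner_normalPart_of_orthogonal {x : L} {w u : TangentSpace I (f x)}
    (hu : ∀ z ∈ LinearMap.range (mfderiv (𝓡 n) I f x).toLinearMap, (inner ℝ z u : ℝ) = 0) :
    (inner ℝ (normalPart I n f x w) u : ℝ) = inner ℝ w u := by
  rw [normalPart, inner_sub_left, hu _ (Submodule.starProjection_apply_mem _ _), sub_zero]

theorem mfderiv_inducedOrthonormalBasis (x : L)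
    (i : Fin (Module.finrank ℝ (LinearMap.range (mfderiv (𝓡 n) I f x).toLinearMap))) :
    mfderiv (𝓡 n) I f x (inducedOrthonormalBasis I n f x i)
      = stdOrthonormalBasis ℝ (LinearMap.range (mfderiv (𝓡 n) I f x).toLinearMap) i :=
  Classical.choose_spec
    (stdOrthonormalBasis ℝ (LinearMap.range (mfderiv (𝓡 n) I f x).toLinearMap) i).2

theorem orthonormal_mfderiv_inducedOrthonormalBasis (x : L) :
    Orthonormal ℝ fun i => mfderiv (𝓡 n) I f x (inducedOrthonormalBasis I n f x i) := by
  simp only [mfderiv_inducedOrthonormalBasis]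
  exact (stdOrthonormalBasis ℝ
    (LinearMap.range (mfderiv (𝓡 n) I f x).toLinearMap)).orthonormal.comp_linearIsometry
    (Submodule.subtypeₗᵢ _)

/-- A Lagrangian submanifold of a strict nearly Kähler six-manifold is minimal: for an orthonormal
frame `b` of `L`, symmetry of the cubic form `C` gives
`g(H, J w) = ∑ i, C(b i, b i, w) = ∑ i, C(w, b i, b i)`, which vanishes by the trace lemma. -/
theorem IsLagrangianImmersion.isMinimalImmersion {L : Type*} [TopologicalSpace L]
    [ChartedSpace (EuclideanSpace ℝ (Fin 3)) L] [IsManifold (𝓡 3) ∞ L] {f : L → M}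
    (hf : S.IsLagrangianImmersion 3 f) (hS : S.IsStrictNearlyKahler) :
    IsMinimalImmersion I 3 f := by
  intro x
  have hfin : Module.finrank ℝ (LinearMap.range (mfderiv (𝓡 3) I f x).toLinearMap) = 3 := by
    rw [LinearMap.finrank_range_of_inj (hf.injective_mfderiv x)]
    exact finrank_euclideanSpace_fin (𝕜 := ℝ)
  let b : Fin 3 → TangentSpace (𝓡 3) x := fun i =>
    inducedOrthonormalBasis I 3 f x (finCongr hfin.symm i)
  have hb : Orthonormal ℝ fun i => mfderiv (𝓡 3) I f x (b i) :=
    (orthonormal_mfderiv_inducedOrthonormalBasis x).comp _ (finCongr hfin.symm).injective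
  have hsum : meanCurvature I 3 f x = ∑ i, secondFundamentalForm I 3 f x (b i) (b i) :=
    (Equiv.sum_comp (finCongr hfin.symm) fun i => secondFundamentalForm I 3 f x
      (inducedOrthonormalBasis I 3 f x i) (inducedOrthonormalBasis I 3 f x i)).symm
  rw [hsum]
  refine hf.eq_zero_of_inner_eq_zero hb (fun i => ⟨b i, rfl⟩) (fun j => ?_) fun j => ?_
  · rw [sum_inner]
    exact Finset.sum_eq_zero fun i _ => inner_normalPart ⟨b j, rfl⟩
  · have htrace := hf.sum_inner_pullbackConnection_J hS (x := x)
      (σ := fun i p => mfderiv (𝓡 3) I f p (extend (EuclideanSpace ℝ (Fin 3)) (b i) p))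
      (fun i => contMDiffAt_mfderiv_extend hf.contMDiff (b i))
      (Filter.Eventually.of_forall fun p i => ⟨_, rfl⟩) (by simpa using hb) (b j)
    rw [sum_inner, ← htrace]
    refine Finset.sum_congr rfl fun i _ => ?_
    rw [secondFundamentalForm, inner_normalPart_of_orthogonal,
      hf.inner_pullbackConnection_J_comm hS.1, pullbackConnection_mfderiv_extend_symm hf.contMDiff,
      extend_apply_self]
    rintro _ ⟨a, rfl⟩
    rw [real_inner_comm]
    exact hf.inner_J_mfderiv x (b j) a

end AlmostHermitianStructure

end Minimality

/-! ### The Maslov form -/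

noncomputable section Maslov

namespace AlmostHermitianStructure

variable {E : Type*} [NormedAddCommGroup E] [NormedSpace ℝ E] [FiniteDimensional ℝ E]
  [CompleteSpace E]
  {H : Type*} [TopologicalSpace H] {I : ModelWithCorners ℝ E H} [I.Boundaryless]
  {M : Type*} [TopologicalSpace M] [ChartedSpace H M] [IsManifold I ∞ M]
  [RiemannianBundle (fun x : M => TangentSpace I x)]
  [IsContMDiffRiemannianBundle I ∞ E (fun x : M => TangentSpace I x)]
  {S : AlmostHermitianStructure I M}

theorem inner_nablaJ_self {p : M} (u v : TangentSpace I p) :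
    (inner ℝ (S.nablaJ p u v) v : ℝ) = 0 := by
  linarith [inner_nablaJ_skew (S := S) u v v]

theorem inner_nablaJ_J_self {p : M} (u v : TangentSpace I p) :
    (inner ℝ (S.nablaJ p u v) (S.J p v) : ℝ) = 0 := by
  have h1 := inner_nablaJ_skew (S := S) u v (S.J p v)
  rw [nablaJ_J, inner_neg_left, S.inner_J_left] at h1
  linarith

theorem canonicalForm_self {p : M} (u v : TangentSpace I p) : S.canonicalForm p v u v = 0 := by
  rw [canonicalForm, inner_nablaJ_J_self]
  ring

/-- As `(∇_v J) v = 0`, the canonical connection and the Levi-Civita connection induce the same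
connection on the canonical line bundle. -/
theorem IsNearlyKahler.canonicalForm_J (hS : S.IsNearlyKahler) {p : M} (u v : TangentSpace I p) :
    S.canonicalForm p v u (S.J p v) = 0 := by
  rw [canonicalForm, S.sq, hS p (S.J p v), inner_neg_right, inner_nablaJ_self, map_neg, map_neg,
    neg_apply, hS p v]
  simp

variable {n : ℕ} {L : Type*} [TopologicalSpace L] [ChartedSpace (EuclideanSpace ℝ (Fin n)) L]
  [IsManifold (𝓡 n) ∞ L] {f : L → M}

/-- A vector field of constant length along `f` is orthogonal to its covariant derivatives. -/
theorem inner_pullbackConnection_self (hS : S.IsNearlyKahler) (hf : ContMDiff (𝓡 n) I ∞ f) {x : L}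
    {σ : Π p : L, TangentSpace I (f p)}
    (hσ : ContMDiffAt (𝓡 n) I.tangent ∞ (fun p => (⟨f p, σ p⟩ : TangentBundle I M)) x)
    (h1 : ∀ᶠ p in 𝓝 x, ‖σ p‖ = 1) (v : TangentSpace (𝓡 n) x) :
    (inner ℝ (pullbackConnection (leviCivita I M) f σ x v) (σ x) : ℝ) = 0 := by
  have hx := mem_chart_source (EuclideanSpace ℝ (Fin n)) x
  have hfx := mem_chart_source H (f x)
  have h := hS.isLocalNearlyKahler hfx
  rw [← writtenInExtChartAt_extChartAt_self (I' := 𝓡 n) hx] at h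
  have hd := (contDiffAt_alongInChart hσ).differentiableAt (by simp)
  have key := h.fderiv_inner_along
    ((contDiffAt_writtenInExtChartAt hf hx hfx).differentiableAt (by simp)) hd hd
    (chartCoord (𝓡 n) x x v)
  have hc : (fun z => chartMetric I (f x) (writtenInExtChartAt (𝓡 n) I x f z)
      (alongInChart I (𝓡 n) f x σ z) (alongInChart I (𝓡 n) f x σ z))
      =ᶠ[𝓝 (extChartAt (𝓡 n) x x)] fun _ => 1 := by
    refine eventually_extChartAt ?_
    filter_upwards [h1, eventually_mem_chart_source (H := H) (H' := EuclideanSpace ℝ (Fin n))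
      (hf x).continuousAt] with p hp hp'
    rw [writtenInExtChartAt_extChartAt_self hp'.1, chartMetric_extChartAt hp'.2,
      chartField_alongInChart hp'.1 hp'.2, real_inner_self_eq_norm_sq, hp, one_pow]
  rw [hc.fderiv_eq, writtenInExtChartAt_extChartAt_self hx, chartMetric_extChartAt hfx,
    chartMetric_extChartAt hfx, ← pullbackConnection_leviCivita hf hσ,
    chartField_alongInChart hx hfx, real_inner_comm (pullbackConnection _ _ _ _ _)] at key
  simp at key
  linarith

/-- The form `γ` vanishes along the Gauss lifts of a Lagrangian submanifold. -/
theorem IsLagrangianImmersion.gammaForm_eq_zero {L : Type*} [TopologicalSpace L]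
    [ChartedSpace (EuclideanSpace ℝ (Fin 3)) L] [IsManifold (𝓡 3) ∞ L] {f : L → M}
    (hf : S.IsLagrangianImmersion 3 f) (hS : S.IsStrictNearlyKahler) {x : L}
    {e : Fin 3 → Π p : L, TangentSpace I (f p)} (he : S.IsGaussLift f x e)
    (v : TangentSpace (𝓡 3) x) : S.gammaForm f e x v = 0 := by
  have hr : ∀ᶠ p in 𝓝 x, ∀ i, e i p ∈ LinearMap.range (mfderiv (𝓡 3) I f p).toLinearMap := by
    filter_upwards [he.span_eq] with p hp i
    rw [← hp]
    exact Submodule.subset_span ⟨i, rfl⟩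
  have htrace := hf.sum_inner_pullbackConnection_J hS he.smooth hr he.unitary.self_of_nhds.1 v
  have hentry : ∀ i, S.connectionEntry f e x v i i
      = (inner ℝ (pullbackConnection (leviCivita I M) f (e i) x v) (S.J (f x) (e i x)) : ℝ)
        * Complex.I := fun i => by
    have h1 := inner_pullbackConnection_self hS.1 hf.contMDiff (he.smooth i)
      (he.unitary.mono fun p hp => hp.1.1 i) v
    rw [connectionEntry, pullbackConnection_canonical hf.contMDiff (he.smooth i), inner_add_left,
      inner_add_left, inner_canonicalTensor, inner_canonicalTensor, h1, canonicalForm_self,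
      hS.1.canonicalForm_J]
    apply Complex.ext <;> simp
  rw [gammaForm, Finset.sum_congr rfl fun i _ => hentry i, ← Finset.sum_mul, ← Complex.ofReal_sum,
    htrace]
  simp

end AlmostHermitianStructure

end Maslov

/-! ### Local lifts of the Gauss map -/

noncomputable section GaussLift

variable {E : Type*} [NormedAddCommGroup E] [NormedSpace ℝ E]
  {H : Type*} [TopologicalSpace H] {I : ModelWithCorners ℝ E H}
  {M : Type*} [TopologicalSpace M] [ChartedSpace H M] [IsManifold I ∞ M]
  {E' : Type*} [NormedAddCommGroup E'] [NormedSpace ℝ E']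
  {H' : Type*} [TopologicalSpace H'] {I' : ModelWithCorners ℝ E' H'}
  {L : Type*} [TopologicalSpace L] [ChartedSpace H' L] {f : L → M} {x : L}

theorem contMDiffAt_along_smul {c : L → ℝ} {σ : Π p : L, TangentSpace I (f p)}
    (hc : ContMDiffAt I' 𝓘(ℝ, ℝ) ∞ c x)
    (hσ : ContMDiffAt I' I.tangent ∞ (fun p => (⟨f p, σ p⟩ : TangentBundle I M)) x) :
    ContMDiffAt I' I.tangent ∞ (fun p => (⟨f p, c p • σ p⟩ : TangentBundle I M)) x := by
  rw [contMDiffAt_along_iff (mem_chart_source H (f x))] at hσ ⊢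
  refine ⟨hσ.1, ?_⟩
  simp only [map_smul]
  exact hc.smul hσ.2

theorem contMDiffAt_along_sub_sum {ι : Type*} {T : Finset ι} {σ : Π p : L, TangentSpace I (f p)}
    {τ : ι → Π p : L, TangentSpace I (f p)}
    (hσ : ContMDiffAt I' I.tangent ∞ (fun p => (⟨f p, σ p⟩ : TangentBundle I M)) x)
    (hτ : ∀ i ∈ T, ContMDiffAt I' I.tangent ∞ (fun p => (⟨f p, τ i p⟩ : TangentBundle I M)) x) :
    ContMDiffAt I' I.tangent ∞
      (fun p => (⟨f p, σ p - ∑ i ∈ T, τ i p⟩ : TangentBundle I M)) x := by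
  rw [contMDiffAt_along_iff (mem_chart_source H (f x))] at hσ ⊢
  refine ⟨hσ.1, ?_⟩
  simp only [map_sub, map_sum]
  exact hσ.2.sub (ContMDiffAt.sum fun i hi =>
    ((contMDiffAt_along_iff (mem_chart_source H (f x)) _).1 (hτ i hi)).2)

variable [RiemannianBundle (fun x : M => TangentSpace I x)]
  [IsContMDiffRiemannianBundle I ∞ E (fun x : M => TangentSpace I x)]

theorem contMDiffAt_inner_along {σ τ : Π p : L, TangentSpace I (f p)}
    (hσ : ContMDiffAt I' I.tangent ∞ (fun p => (⟨f p, σ p⟩ : TangentBundle I M)) x)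
    (hτ : ContMDiffAt I' I.tangent ∞ (fun p => (⟨f p, τ p⟩ : TangentBundle I M)) x) :
    ContMDiffAt I' 𝓘(ℝ, ℝ) ∞ (fun p => (inner ℝ (σ p) (τ p) : ℝ)) x :=
  ContMDiffAt.inner_bundle (IB := I) (F := E) (E := fun x : M => TangentSpace I x) (b := f) hσ hτ

theorem contMDiffAt_norm_along {σ : Π p : L, TangentSpace I (f p)}
    (hσ : ContMDiffAt I' I.tangent ∞ (fun p => (⟨f p, σ p⟩ : TangentBundle I M)) x)
    (h0 : σ x ≠ 0) : ContMDiffAt I' 𝓘(ℝ, ℝ) ∞ (fun p => ‖σ p‖) x := by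
  have h1 : (fun p => ‖σ p‖) = fun p => √(inner ℝ (σ p) (σ p) : ℝ) := by
    ext p; exact norm_eq_sqrt_real_inner _
  rw [h1]
  refine ContMDiffAt.comp (I' := 𝓘(ℝ, ℝ)) (g := Real.sqrt) x ?_ (contMDiffAt_inner_along hσ hσ)
  exact (Real.contDiffAt_sqrt (inner_self_ne_zero.2 h0)).contMDiffAt

/-- The Gram–Schmidt process preserves smoothness. -/
theorem contMDiffAt_gramSchmidt {n : ℕ} {t : Fin n → Π p : L, TangentSpace I (f p)}
    (ht : ∀ i, ContMDiffAt I' I.tangent ∞ (fun p => (⟨f p, t i p⟩ : TangentBundle I M)) x)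
    (hli : LinearIndependent ℝ fun i => t i x) (i : Fin n) :
    ContMDiffAt I' I.tangent ∞ (fun p => (⟨f p,
      InnerProductSpace.gramSchmidt ℝ (fun i => t i p) i⟩ : TangentBundle I M)) x := by
  induction i using WellFoundedLT.induction with
  | ind i ih =>
    have h1 : ∀ p, InnerProductSpace.gramSchmidt ℝ (fun i => t i p) i
        = t i p - ∑ j ∈ Finset.Iio i,
          ((inner ℝ (InnerProductSpace.gramSchmidt ℝ (fun i => t i p) j) (t i p) : ℝ)
            / ‖InnerProductSpace.gramSchmidt ℝ (fun i => t i p) j‖ ^ 2)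
            • InnerProductSpace.gramSchmidt ℝ (fun i => t i p) j := fun p =>
      eq_sub_of_add_eq (InnerProductSpace.gramSchmidt_def'' ℝ (fun i => t i p) i).symm
    simp only [h1]
    refine contMDiffAt_along_sub_sum (ht i) fun j hj => ?_
    have hj' := ih j (Finset.mem_Iio.1 hj)
    have hne := InnerProductSpace.gramSchmidt_ne_zero j hli
    refine contMDiffAt_along_smul (ContMDiffAt.div₀ (contMDiffAt_inner_along hj' (ht i))
      ((contMDiffAt_norm_along hj' hne).pow 2) ?_) hj'
    exact pow_ne_zero 2 (norm_ne_zero_iff.2 hne)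

end GaussLift

noncomputable section GaussLiftExistence

namespace AlmostHermitianStructure

variable {E : Type*} [NormedAddCommGroup E] [NormedSpace ℝ E] [FiniteDimensional ℝ E]
  [CompleteSpace E]
  {H : Type*} [TopologicalSpace H] {I : ModelWithCorners ℝ E H} [I.Boundaryless]
  {M : Type*} [TopologicalSpace M] [ChartedSpace H M] [IsManifold I ∞ M]
  [RiemannianBundle (fun x : M => TangentSpace I x)]
  [IsContMDiffRiemannianBundle I ∞ E (fun x : M => TangentSpace I x)]
  {n : ℕ} {L : Type*} [TopologicalSpace L] [ChartedSpace (EuclideanSpace ℝ (Fin n)) L]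
  [IsManifold (𝓡 n) ∞ L]
  {S : AlmostHermitianStructure I M} {f : L → M}

/-- The image under `df` of the coordinate frame of the chart at `x`. -/
def coordinateFrame (I : ModelWithCorners ℝ E H) (f : L → M) (x : L) (i : Fin n) (p : L) :
    TangentSpace I (f p) :=
  mfderiv (𝓡 n) I f p (chartField (𝓡 n) x p (EuclideanSpace.basisFun (Fin n) ℝ i))

theorem linearIndependent_coordinateFrame
    (hinj : ∀ p, Function.Injective (mfderiv (𝓡 n) I f p)) {x p : L}
    (hp : p ∈ (chartAt (EuclideanSpace ℝ (Fin n)) x).source) :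
    LinearIndependent ℝ fun i : Fin n => coordinateFrame I f x i p := by
  have key : ∀ {V : Type _} [AddCommGroup V] [Module ℝ V] (A : EuclideanSpace ℝ (Fin n) →ₗ[ℝ] V),
      Function.Injective A → LinearIndependent ℝ fun i => A (EuclideanSpace.basisFun (Fin n) ℝ i) :=
    fun A hA => (EuclideanSpace.basisFun (Fin n) ℝ).orthonormal.linearIndependent.map' A
      (LinearMap.ker_eq_bot.2 hA)
  exact key (V := TangentSpace I (f p))
    ((mfderiv (𝓡 n) I f p).comp (chartField (𝓡 n) x p)).toLinearMap
    ((hinj p).comp (Function.LeftInverse.injective (g := chartCoord (𝓡 n) x p)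
      (chartCoord_chartField hp)))

variable (I) in
/-- The orthonormal frame obtained from `coordinateFrame` by the Gram–Schmidt process. -/
def orthonormalFrame (f : L → M) (x : L) (i : Fin n) (p : L) : TangentSpace I (f p) :=
  InnerProductSpace.gramSchmidtNormed ℝ (fun i : Fin n => coordinateFrame I f x i p) i

theorem orthonormalFrame_mem_range (x p : L) (i : Fin n) :
    orthonormalFrame I f x i p ∈ LinearMap.range (mfderiv (𝓡 n) I f p).toLinearMap := by
  have h1 : orthonormalFrame I f x i p
      ∈ Submodule.span ℝ (Set.range fun i : Fin n => coordinateFrame I f x i p) := by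
    rw [← InnerProductSpace.span_gramSchmidt ℝ,
      ← InnerProductSpace.span_gramSchmidtNormed_range]
    exact Submodule.subset_span ⟨i, rfl⟩
  refine Submodule.span_le.2 ?_ h1
  rintro _ ⟨j, rfl⟩
  exact ⟨_, rfl⟩

theorem contMDiffAt_orthonormalFrame (hf : ContMDiff (𝓡 n) I ∞ f)
    (hinj : ∀ p, Function.Injective (mfderiv (𝓡 n) I f p)) (x : L) (i : Fin n) :
    ContMDiffAt (𝓡 n) I.tangent ∞
      (fun p => (⟨f p, orthonormalFrame I f x i p⟩ : TangentBundle I M)) x := by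
  have hli := linearIndependent_coordinateFrame hinj
    (mem_chart_source (EuclideanSpace ℝ (Fin n)) x)
  have hg := contMDiffAt_gramSchmidt (t := coordinateFrame I f x)
    (fun i => contMDiffAt_mfderiv_chartField hf _) hli i
  have hne := InnerProductSpace.gramSchmidt_ne_zero i hli
  exact contMDiffAt_along_smul
    ((contMDiffAt_norm_along hg hne).inv₀ (norm_ne_zero_iff.2 hne)) hg

/-- The Gauss map of a Lagrangian immersion has local lifts to the unitary frame bundle: apply the
Gram–Schmidt process to the image of a coordinate frame. -/
theorem IsLagrangianImmersion.exists_isGaussLift (hf : S.IsLagrangianImmersion n f) (x : L) :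
    ∃ e : Fin n → Π p : L, TangentSpace I (f p), S.IsGaussLift f x e := by
  have hsrc := (chartAt (EuclideanSpace ℝ (Fin n)) x).open_source.mem_nhds (mem_chart_source _ x)
  refine ⟨orthonormalFrame I f x,
    contMDiffAt_orthonormalFrame hf.contMDiff hf.injective_mfderiv x, ?_, ?_⟩
  · filter_upwards [hsrc] with p hp
    refine ⟨InnerProductSpace.gramSchmidtNormed_orthonormal
      (linearIndependent_coordinateFrame hf.injective_mfderiv hp), fun i j => ?_⟩
    obtain ⟨a, ha⟩ := orthonormalFrame_mem_range (I := I) (f := f) x p i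
    obtain ⟨b, hb⟩ := orthonormalFrame_mem_range (I := I) (f := f) x p j
    beta_reduce
    rw [← ha, ← hb, real_inner_comm]
    exact hf.inner_J_mfderiv p b a
  · filter_upwards [hsrc] with p hp
    exact IsLagrangianImmersion.span_eq_range (hf.injective_mfderiv p)
      (InnerProductSpace.gramSchmidtNormed_linearIndependent
        (linearIndependent_coordinateFrame hf.injective_mfderiv hp))
      (orthonormalFrame_mem_range x p)

/-- The Maslov form of a Lagrangian submanifold of a strict nearly Kähler six-manifold is zero. -/
theorem IsLagrangianImmersion.isMaslovForm_iff {L : Type*} [TopologicalSpace L]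
    [ChartedSpace (EuclideanSpace ℝ (Fin 3)) L] [IsManifold (𝓡 3) ∞ L] {f : L → M}
    (hf : S.IsLagrangianImmersion 3 f) (hS : S.IsStrictNearlyKahler)
    (μ : Π x : L, TangentSpace (𝓡 3) x →L[ℝ] ℝ) : S.IsMaslovForm f μ ↔ μ = 0 := by
  constructor
  · intro h
    funext x
    ext v
    obtain ⟨e, he⟩ := hf.exists_isGaussLift x
    have h1 := h x e he v
    rw [hf.gammaForm_eq_zero hS he, mul_zero] at h1
    exact_mod_cast h1
  · rintro rfl x e he v
    rw [hf.gammaForm_eq_zero hS he, mul_zero]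
    exact Complex.ofReal_zero

end AlmostHermitianStructure

end GaussLiftExistence

/-! ### Orientability -/

noncomputable section Orientability

namespace AlmostHermitianStructure

variable {E : Type*} [NormedAddCommGroup E] [NormedSpace ℝ E] [FiniteDimensional ℝ E]
  [CompleteSpace E]
  {H : Type*} [TopologicalSpace H] {I : ModelWithCorners ℝ E H} [I.Boundaryless]
  {M : Type*} [TopologicalSpace M] [ChartedSpace H M] [IsManifold I ∞ M]
  [RiemannianBundle (fun x : M => TangentSpace I x)]
  [IsContMDiffRiemannianBundle I ∞ E (fun x : M => TangentSpace I x)]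
  {S : AlmostHermitianStructure I M}

theorem IsNearlyKahler.nablaJ_swap (hS : S.IsNearlyKahler) {q : M} (u v : TangentSpace I q) :
    S.nablaJ q u v = -S.nablaJ q v u := by
  have h := hS q (u + v)
  simp only [map_add, add_apply, hS q u, hS q v, zero_add, add_zero] at h
  rw [add_comm] at h
  exact eq_neg_of_add_eq_zero_left h

/-- The `3`-form `g((∇_u J) v, J w)` of a nearly Kähler manifold. -/
def IsNearlyKahler.volumeForm (hS : S.IsNearlyKahler) (q : M) :
    TangentSpace I q [⋀^Fin 3]→ₗ[ℝ] ℝ where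
  toFun m := inner ℝ (S.nablaJ q (m 0) (m 1)) (S.J q (m 2))
  map_update_add' := by
    intro inst m i x y
    obtain rfl := Subsingleton.elim inst (instDecidableEqFin 3)
    fin_cases i <;> simp [inner_add_left, inner_add_right]
  map_update_smul' := by
    intro inst m i c x
    obtain rfl := Subsingleton.elim inst (instDecidableEqFin 3)
    fin_cases i <;> simp [inner_smul_left, inner_smul_right]
  map_eq_zero_of_eq' m i j hij hne := by
    have h01 : ∀ u w : TangentSpace I q, (inner ℝ (S.nablaJ q u u) (S.J q w) : ℝ) = 0 :=
      fun u w => by rw [hS q u, inner_zero_left]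
    have h02 : ∀ u v : TangentSpace I q, (inner ℝ (S.nablaJ q u v) (S.J q u) : ℝ) = 0 :=
      fun u v => by rw [hS.nablaJ_swap, inner_neg_left, inner_nablaJ_J_self, neg_zero]
    fin_cases i <;> fin_cases j <;> simp at hij hne ⊢ <;>
      simp [hij, h01, h02, inner_nablaJ_J_self]

theorem IsNearlyKahler.volumeForm_apply (hS : S.IsNearlyKahler) (q : M)
    (m : Fin 3 → TangentSpace I q) :
    hS.volumeForm q m = inner ℝ (S.nablaJ q (m 0) (m 1)) (S.J q (m 2)) := rfl

/-- The value on the standard frame of the pull-back of `volumeForm` by `h : ℝ³ → M`. -/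
def IsNearlyKahler.pullbackVolume (hS : S.IsNearlyKahler) (h : EuclideanSpace ℝ (Fin 3) → M)
    (y : EuclideanSpace ℝ (Fin 3)) : ℝ :=
  hS.volumeForm (h y) fun i => mfderiv (𝓡 3) I h y (EuclideanSpace.basisFun (Fin 3) ℝ i)

theorem IsNearlyKahler.pullbackVolume_congr (hS : S.IsNearlyKahler)
    {h h' : EuclideanSpace ℝ (Fin 3) → M} {y : EuclideanSpace ℝ (Fin 3)} (hh : h =ᶠ[𝓝 y] h') :
    hS.pullbackVolume h y = hS.pullbackVolume h' y := by
  -- The base points of the two differentials agree only propositionally, so both are regarded as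
  -- maps into the model space `E`.
  have key : ∀ {q q' : M} {A A' : EuclideanSpace ℝ (Fin 3) →L[ℝ] E}, q = q' → A = A' →
      hS.volumeForm q (fun i => A (EuclideanSpace.basisFun (Fin 3) ℝ i))
        = hS.volumeForm q' (fun i => A' (EuclideanSpace.basisFun (Fin 3) ℝ i)) := by
    rintro q _ A _ rfl rfl
    rfl
  exact key hh.eq_of_nhds hh.mfderiv_eq

/-- Change of variables for `pullbackVolume`. -/
theorem IsNearlyKahler.pullbackVolume_comp (hS : S.IsNearlyKahler)
    {h : EuclideanSpace ℝ (Fin 3) → M} {τ : EuclideanSpace ℝ (Fin 3) → EuclideanSpace ℝ (Fin 3)}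
    {y : EuclideanSpace ℝ (Fin 3)} (hτ : DifferentiableAt ℝ τ y)
    (hh : MDifferentiableAt (𝓡 3) I h (τ y)) :
    hS.pullbackVolume (h ∘ τ) y = (fderiv ℝ τ y).det * hS.pullbackVolume h (τ y) := by
  let b := (EuclideanSpace.basisFun (Fin 3) ℝ).toBasis
  let φ : EuclideanSpace ℝ (Fin 3) [⋀^Fin 3]→ₗ[ℝ] ℝ :=
    (hS.volumeForm (h (τ y))).compLinearMap (mfderiv (𝓡 3) I h (τ y)).toLinearMap
  have h1 : hS.pullbackVolume (h ∘ τ) y = φ ((fderiv ℝ τ y).toLinearMap ∘ b) := by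
    have hc := mfderiv_comp y hh hτ.mdifferentiableAt
    rw [mfderiv_eq_fderiv] at hc
    rw [pullbackVolume, hc]
    simp only [b, OrthonormalBasis.coe_toBasis]
    rfl
  have h2 : hS.pullbackVolume h (τ y) = φ b := by
    simp only [b, OrthonormalBasis.coe_toBasis]
    rfl
  rw [h1, h2, φ.eq_smul_basis_det b, AlternatingMap.smul_apply, AlternatingMap.smul_apply,
    b.det_comp, b.det_self]
  simp only [smul_eq_mul, ContinuousLinearMap.det]
  ring

theorem IsNearlyKahler.pullbackVolume_ne_zero_of_mem_range (hS : S.IsNearlyKahler)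
    {h : EuclideanSpace ℝ (Fin 3) → M} {y : EuclideanSpace ℝ (Fin 3)}
    {s : Fin 3 → TangentSpace I (h y)} (hs : hS.volumeForm (h y) s ≠ 0)
    (hr : ∀ i, ∃ c : EuclideanSpace ℝ (Fin 3), mfderiv (𝓡 3) I h y c = s i) :
    hS.pullbackVolume h y ≠ 0 := by
  choose c hc using hr
  obtain rfl : s = fun i => mfderiv (𝓡 3) I h y (c i) := funext fun i => (hc i).symm
  let b := (EuclideanSpace.basisFun (Fin 3) ℝ).toBasis
  let φ : EuclideanSpace ℝ (Fin 3) [⋀^Fin 3]→ₗ[ℝ] ℝ :=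
    (hS.volumeForm (h y)).compLinearMap (mfderiv (𝓡 3) I h y).toLinearMap
  have hφ : φ ≠ 0 := fun h0 => hs (congrArg (fun ψ => ψ c) h0)
  have h2 : hS.pullbackVolume h y = φ b := by
    simp only [b, OrthonormalBasis.coe_toBasis]
    rfl
  rw [h2]
  exact (φ.map_basis_ne_zero_iff b).2 hφ

theorem mfderiv_eq_chartField_fderiv {h : EuclideanSpace ℝ (Fin 3) → M}
    {y : EuclideanSpace ℝ (Fin 3)} {x₀ : M} (hh : MDifferentiableAt (𝓡 3) I h y)
    (hy : h y ∈ (chartAt H x₀).source) (u : EuclideanSpace ℝ (Fin 3)) :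
    mfderiv (𝓡 3) I h y u = chartField I x₀ (h y)
      (fderiv ℝ (fun z => extChartAt I x₀ (h z)) y u) := by
  rw [← chartField_chartCoord hy (mfderiv (𝓡 3) I h y u), chartCoord_eq_mfderiv hy,
    ← mfderiv_eq_fderiv]
  congr 1
  exact (congr($(mfderiv_comp y (mdifferentiableAt_extChartAt hy) hh) u)).symm

theorem IsNearlyKahler.continuousAt_pullbackVolume (hS : S.IsNearlyKahler)
    {h : EuclideanSpace ℝ (Fin 3) → M} {y : EuclideanSpace ℝ (Fin 3)}
    (hh : ContMDiffAt (𝓡 3) I ∞ h y) : ContinuousAt (hS.pullbackVolume h) y := by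
  have hy := mem_chart_source H (h y)
  have hloc := hS.isLocalNearlyKahler hy
  set F : EuclideanSpace ℝ (Fin 3) → E := fun z => extChartAt I (h y) (h z) with hF
  have hFd : ContDiffAt ℝ ∞ F y :=
    contMDiffAt_iff_contDiffAt.1 ((contMDiffAt_extChartAt' hy).comp y hh)
  have hF' : ∀ u, ContinuousAt (fun z => fderiv ℝ F z u) y := fun u =>
    ((hFd.fderiv_right (m := ∞) (by norm_num)).clm_apply contDiffAt_const).continuousAt
  have hg : ContinuousAt (fun z => chartMetric I (h y) (F z)) y :=
    ContinuousAt.comp (g := chartMetric I (h y)) hloc.differentiableAt_metric.continuousAt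
      hFd.continuousAt
  have hJ : ContinuousAt (fun z => S.chartJ (h y) (F z)) y :=
    ContinuousAt.comp (g := S.chartJ (h y)) hloc.differentiableAt_J.continuousAt hFd.continuousAt
  have hN : ContinuousAt (fun z => covDerivEnd (christoffel (chartMetric I (h y)))
      (S.chartJ (h y)) (F z)) y :=
    ContinuousAt.comp (g := covDerivEnd (christoffel (chartMetric I (h y))) (S.chartJ (h y)))
      hloc.differentiableAt_covDerivEnd.continuousAt hFd.continuousAt
  let b := EuclideanSpace.basisFun (Fin 3) ℝ
  have hcont := (hg.clm_apply ((hN.clm_apply (hF' (b 0))).clm_apply (hF' (b 1)))).clm_apply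
    (hJ.clm_apply (hF' (b 2)))
  refine hcont.congr ?_
  filter_upwards [contMDiffAt_iff_contMDiffAt_nhds (n := 1) (by simp)
      |>.1 (hh.of_le (by norm_cast)),
    hh.continuousAt.preimage_mem_nhds ((chartAt H (h y)).open_source.mem_nhds hy)] with z hz hz'
  have hd := hz.mdifferentiableAt (by simp)
  rw [pullbackVolume, volumeForm_apply, mfderiv_eq_chartField_fderiv hd hz',
    mfderiv_eq_chartField_fderiv hd hz', mfderiv_eq_chartField_fderiv hd hz',
    S.nablaJ_chartField hz', ← S.chartField_chartJ hz', ← chartMetric_extChartAt hz']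

variable {L : Type*} [TopologicalSpace L] [ChartedSpace (EuclideanSpace ℝ (Fin 3)) L]
  [IsManifold (𝓡 3) ∞ L] {f : L → M}

namespace IsLagrangianImmersion

theorem volumeForm_ne_zero (hf : S.IsLagrangianImmersion 3 f) (hS : S.IsStrictNearlyKahler) {x : L}
    {e : Fin 3 → TangentSpace I (f x)} (he : Orthonormal ℝ e)
    (her : ∀ i, e i ∈ LinearMap.range (mfderiv (𝓡 3) I f x).toLinearMap) :
    hS.1.volumeForm (f x) e ≠ 0 := by
  have hfx := mem_chart_source H (f x)
  have h := (hS.1.isLocalNearlyKahler hfx).specialFrame_ne_zero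
    (hf.isSpecialFrame_chartCoord hS.1 he her) fun v hv => hS.covDerivEnd_ne_zero hfx hv
  rwa [chartMetric_extChartAt hfx, ← S.nablaJ_chartField hfx, S.chartField_chartJ hfx,
    chartField_chartCoord hfx, chartField_chartCoord hfx, chartField_chartCoord hfx] at h

/-- `volumeForm` does not vanish on Lagrangian submanifolds. -/
theorem pullbackVolume_ne_zero (hf : S.IsLagrangianImmersion 3 f) (hS : S.IsStrictNearlyKahler)
    {e : OpenPartialHomeomorph L (EuclideanSpace ℝ (Fin 3))}
    (he : e ∈ IsManifold.maximalAtlas (𝓡 3) ∞ L) {y : EuclideanSpace ℝ (Fin 3)}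
    (hy : y ∈ e.target) : hS.1.pullbackVolume (f ∘ e.symm) y ≠ 0 := by
  have hed : e.MDifferentiable (𝓡 3) (𝓡 3) :=
    ⟨(contMDiffOn_of_mem_maximalAtlas he).mdifferentiableOn (by simp),
      (contMDiffOn_symm_of_mem_maximalAtlas he).mdifferentiableOn (by simp)⟩
  obtain ⟨s, hs⟩ := hf.exists_isGaussLift (e.symm y)
  have hr : ∀ i, s i (e.symm y)
      ∈ LinearMap.range (mfderiv (𝓡 3) I f (e.symm y)).toLinearMap := fun i => by
    rw [← hs.span_eq.self_of_nhds]
    exact Submodule.subset_span ⟨i, rfl⟩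
  have hne := hf.volumeForm_ne_zero hS hs.unitary.self_of_nhds.1 hr
  have hc : ∀ i, ∃ c : EuclideanSpace ℝ (Fin 3),
      mfderiv (𝓡 3) I (f ∘ e.symm) y c = s i (e.symm y) := fun i => by
    obtain ⟨a, ha⟩ := hr i
    obtain ⟨c, hc⟩ := hed.symm.mfderiv_surjective (x := y) hy a
    refine ⟨c, ?_⟩
    rw [mfderiv_comp y ((hf.contMDiff _).mdifferentiableAt (by simp))
      (hed.mdifferentiableAt_symm hy)]
    exact (congrArg (mfderiv (𝓡 3) I f (e.symm y)) hc).trans ha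
  exact hS.1.pullbackVolume_ne_zero_of_mem_range (h := f ∘ e.symm) hne hc

theorem contMDiffAt_comp_symm (hf : S.IsLagrangianImmersion 3 f)
    {e : OpenPartialHomeomorph L (EuclideanSpace ℝ (Fin 3))}
    (he : e ∈ IsManifold.maximalAtlas (𝓡 3) ∞ L) {y : EuclideanSpace ℝ (Fin 3)}
    (hy : y ∈ e.target) : ContMDiffAt (𝓡 3) I ∞ (f ∘ e.symm) y :=
  (hf.contMDiff _).comp y (contMDiffAt_symm_of_mem_maximalAtlas he hy)

/-- A chart on which `volumeForm` is positive at one point can be restricted to a positively oriented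
chart. -/
theorem exists_positive_restr (hf : S.IsLagrangianImmersion 3 f) (hS : S.IsNearlyKahler) {x : L}
    {e : OpenPartialHomeomorph L (EuclideanSpace ℝ (Fin 3))}
    (he : e ∈ IsManifold.maximalAtlas (𝓡 3) ∞ L) (hx : x ∈ e.source)
    (hpos : 0 < hS.pullbackVolume (f ∘ e.symm) (e x)) :
    ∃ e' ∈ IsManifold.maximalAtlas (𝓡 3) ∞ L, x ∈ e'.source ∧
      ∀ y ∈ e'.target, 0 < hS.pullbackVolume (f ∘ e'.symm) y := by
  have h1 : ∀ᶠ p in 𝓝 x, 0 < hS.pullbackVolume (f ∘ e.symm) (e p) :=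
    (e.continuousAt hx).eventually ((hS.continuousAt_pullbackVolume
      (hf.contMDiffAt_comp_symm he (e.map_source hx))).eventually (lt_mem_nhds hpos))
  obtain ⟨s, hs, hso, hxs⟩ := eventually_nhds_iff.1 h1
  refine ⟨e.restr s, restr_mem_maximalAtlas (G := contDiffGroupoid ∞ (𝓡 3)) he hso, ?_, ?_⟩
  · rw [e.restr_source, hso.interior_eq]
    exact ⟨hx, hxs⟩
  · intro y hy
    rw [e.restr_target, hso.interior_eq] at hy
    have := hs _ hy.2
    rwa [e.right_inv hy.1] at this

theorem exists_positive_chart (hf : S.IsLagrangianImmersion 3 f) (hS : S.IsStrictNearlyKahler)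
    (x : L) : ∃ e ∈ IsManifold.maximalAtlas (𝓡 3) ∞ L, x ∈ e.source ∧
      ∀ y ∈ e.target, 0 < hS.1.pullbackVolume (f ∘ e.symm) y := by
  set e := chartAt (EuclideanSpace ℝ (Fin 3)) x with he
  have hemax : e ∈ IsManifold.maximalAtlas (𝓡 3) ∞ L := IsManifold.chart_mem_maximalAtlas x
  have hx : x ∈ e.source := mem_chart_source _ x
  rcases lt_or_gt_of_ne (hf.pullbackVolume_ne_zero hS hemax (e.map_source hx)).symm with h | h
  · exact hf.exists_positive_restr hS.1 hemax hx h
  · -- The point reflection of `ℝ³` reverses the orientation.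
    let ν := Homeomorph.neg (EuclideanSpace ℝ (Fin 3))
    have hmem : e.transHomeomorph ν ∈ IsManifold.maximalAtlas (𝓡 3) ∞ L := by
      refine OpenPartialHomeomorph.mem_maximalAtlas_of_contMDiffOn _ ?_ ?_
      · exact contMDiff_iff_contDiff.2 contDiff_neg |>.comp_contMDiffOn
          (contMDiffOn_of_mem_maximalAtlas hemax)
      · exact (contMDiffOn_symm_of_mem_maximalAtlas hemax).comp
          (contMDiff_iff_contDiff.2 contDiff_neg).contMDiffOn fun y hy => hy
    refine hf.exists_positive_restr hS.1 hmem hx ?_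
    have hcomp := hS.1.pullbackVolume_comp (h := f ∘ e.symm)
      (τ := fun z : EuclideanSpace ℝ (Fin 3) => -z) (y := -(e x)) differentiableAt_id.neg (by
        rw [neg_neg]
        exact (hf.contMDiffAt_comp_symm hemax (e.map_source hx)).mdifferentiableAt (by simp))
    have hdet : (fderiv ℝ (fun z : EuclideanSpace ℝ (Fin 3) => -z) (-(e x))).det = -1 := by
      rw [fderiv_fun_neg, fderiv_fun_id, ContinuousLinearMap.det]
      have h3 : (-ContinuousLinearMap.id ℝ (EuclideanSpace ℝ (Fin 3))).toLinearMap
          = (-1 : ℝ) • LinearMap.id := by ext; simp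
      rw [h3, LinearMap.det_smul, LinearMap.det_id, finrank_euclideanSpace_fin]
      norm_num
    rw [hdet, neg_neg] at hcomp
    change 0 < hS.1.pullbackVolume ((f ∘ e.symm) ∘ fun z => -z) (-(e x))
    rw [hcomp]
    linarith

/-- A Lagrangian submanifold of a strict nearly Kähler six-manifold is orientable: the charts in
which the nowhere vanishing `3`-form `volumeForm` is positive form an oriented atlas. -/
theorem isOrientableManifold (hf : S.IsLagrangianImmersion 3 f) (hS : S.IsStrictNearlyKahler) :
    IsOrientableManifold 3 L := by
  refine ⟨{e | e ∈ IsManifold.maximalAtlas (𝓡 3) ∞ L ∧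
    ∀ y ∈ e.target, 0 < hS.1.pullbackVolume (f ∘ e.symm) y}, fun e he => he.1, fun x => ?_, ?_⟩
  · obtain ⟨e, he, hx, hpos⟩ := hf.exists_positive_chart hS x
    exact ⟨e, ⟨he, hpos⟩, hx⟩
  · rintro e ⟨he, hpos⟩ e' ⟨he', hpos'⟩ y hy
    have hy1 : y ∈ e.target := hy.1
    have hy2 : e.symm y ∈ e'.source := hy.2
    have hτ : DifferentiableAt ℝ (e.symm ≫ₕ e') y :=
      (contMDiffAt_iff_contDiffAt.1 ((contMDiffAt_of_mem_maximalAtlas he' hy2).comp y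
        (contMDiffAt_symm_of_mem_maximalAtlas he hy1))).differentiableAt (by simp)
    have hy3 : (e.symm ≫ₕ e') y ∈ e'.target := e'.map_source hy2
    have hcomp := hS.1.pullbackVolume_comp hτ
      ((hf.contMDiffAt_comp_symm he' hy3).mdifferentiableAt (by simp))
    have hcongr : f ∘ e.symm =ᶠ[𝓝 y] (f ∘ e'.symm) ∘ (e.symm ≫ₕ e') := by
      filter_upwards [(e.symm ≫ₕ e').open_source.mem_nhds hy] with z hz
      exact congrArg f (e'.left_inv hz.2).symm
    rw [← hS.1.pullbackVolume_congr hcongr] at hcomp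
    have h1 := hpos y hy1
    rw [hcomp] at h1
    exact pos_of_mul_pos_left h1 (hpos' _ hy3).le

end IsLagrangianImmersion

end AlmostHermitianStructure

end Orientability

theorem mainTheorem6
    {M : Type*} [TopologicalSpace M] [T2Space M] [SecondCountableTopology M]
    [ChartedSpace (EuclideanSpace ℝ (Fin 6)) M] [IsManifold (𝓡 6) ∞ M]
    [RiemannianBundle (fun x : M => TangentSpace (𝓡 6) x)]
    [IsContMDiffRiemannianBundle (𝓡 6) ∞ (EuclideanSpace ℝ (Fin 6))
      (fun x : M => TangentSpace (𝓡 6) x)]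
    {L : Type*} [TopologicalSpace L] [T2Space L] [SecondCountableTopology L]
    [ChartedSpace (EuclideanSpace ℝ (Fin 3)) L] [IsManifold (𝓡 3) ∞ L]
    (S : AlmostHermitianStructure (𝓡 6) M) (hS : S.IsStrictNearlyKahler)
    (f : L → M) (hf : S.IsLagrangianImmersion 3 f) :
    IsOrientableManifold 3 L ∧
      IsMinimalImmersion (𝓡 6) 3 f ∧
      ∀ μ : (x : L) → TangentSpace (𝓡 3) x →L[ℝ] ℝ, S.IsMaslovForm f μ ↔ μ = 0 := by
  exact ⟨hf.isOrientableManifold hS, hf.isMinimalImmersion hS, hf.isMaslovForm_iff hS⟩
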